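/- Let $R$ be an integral domain and $q\in R^\times$. For $n\ge 0$ let $\mathcal H_n=\mathcal H_n(q^2)$ be the Iwahori–Hecke algebra of the symmetric group $\mathfrak S_n$: the unital $R$-algebra with generators $T_1,\dots,T_{n-1}$ and relations $T_iT_j=T_jT_i$ for $|i-j|>1$, $T_iT_{i+1}T_i=T_{i+1}T_iT_{i+1}$, and $(T_i-q)(T_i+q^{-1})=0$; put $T_v=T_{i_1}\cdots T_{i_l}$ for a reduced expression $v=s_{i_1}\cdots s_{i_l}\in\mathfrak S_n$ (permutations act from the right), let $l(v)$ be the length of $v$, and let $*$ be the $R$-linear anti-automorphism fixing every $T_i$. Partitions of $n$ are identified with Young diagrams and ordered by dominance $\unrhd$. For a partition $\lambda$ of $n$ let $\mathfrak t^\lambda$ be the standard $\lambda$-tableau with $1,\dots,n$ entered in order along successive rows, $\mathfrak S_\lambda$ its row stabilizer, $w(\mathfrak t)$ the permutation with $\mathfrak t=\mathfrak t^\lambda w(\mathfrak t)$, $m_\lambda=\sum_{v\in\mathfrak S_\lambda}q^{l(v)}T_v$, and $m^\lambda_{\mathfrak s\mathfrak t}=T_{w(\mathfrak s)}^*\,m_\lambda\,T_{w(\mathfrak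 t)}$ for standard $\lambda$-tableaux $\mathfrak s,\mathfrak t$. (Murphy.) For every $n\ge 0$ the elements $m^\lambda_{\mathfrak s\mathfrak t}$ form a cellular basis of $\mathcal H_n$ with respect to $*$ and $\unrhd$. That is, they form an $R$-basis of $\mathcal H_n$, and, with $\mathcal H_n^{\rhd\lambda}$ the $R$-span of all $m^\mu_{\mathfrak u\mathfrak v}$ with $\mu\rhd\lambda$: one has $(m^\lambda_{\mathfrak s\mathfrak t})^*\equiv m^\lambda_{\mathfrak t\mathfrak s}\pmod{\mathcal H_n^{\rhd\lambda}}$, and for all $\lambda$, $\mathfrak t$ and $a\in\mathcal H_n$ there are $r_{\mathfrak v}(\mathfrak t,a)\in R$, independent of $\mathfrak s$, with $m^\lambda_{\mathfrak s\mathfrak t}a\equiv\sum_{\mathfrak v}r_{\mathfrak v}(\mathfrak t,a)\,m^\lambda_{\mathfrak s\mathfrak v}\pmod{\mathcal H_n^{\rhd\lambda}}$ for all $\mathfrak s$. The cell module $\Delta_n^\lambda$ is therefore defined: it is the right $\mathcal H_n$-module that is free over $R$ with basis $\{m^\lambda_{\mathfrak t}\}$ indexed by the standard $\lambda$-tableaux,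 with $m^\lambda_{\mathfrak t}a=\sum_{\mathfrak v}r_{\mathfrak v}(\mathfrak t,a)\,m^\lambda_{\mathfrak v}$. **Theorem.** Let $n\ge1$ and let $\lambda$ be a partition of $n$. Then the restriction of $\Delta_n^\lambda$ to $\mathcal H_{n-1}$ (along $\mathcal H_{n-1}\to\mathcal H_n$, $T_i\mapsto T_i$) has an order preserving cell filtration. Explicitly, let $\alpha_1,\dots,\alpha_p$ be the removable nodes of $\lambda$ listed from bottom to top, let $\mu^{(j)}=\lambda\setminus\alpha_j$, and for $0\le j\le p$ let $N_j$ be the $R$-span of the basis elements $m^\lambda_{\mathfrak t}$ such that the node of $\mathfrak t$ containing $n$ is one of $\alpha_1,\dots,\alpha_j$. Then $$(0)=N_0\subseteq N_1\subseteq\cdots\subseteq N_p=\mathrm{Res}^{\mathcal H_n}_{\mathcal H_{n-1}}(\Delta_n^\lambda)$$ are right $\mathcal H_{n-1}$-submodules; $\mu^{(i)}\rhd\mu^{(j)}$ whenever $i<j$; and for $1\le j\le p$ there is an isomorphism of right $\mathcal H_{n-1}$-modules $$\Delta_{n-1}^{\mu^{(j)}}\;\cong\;N_j/N_{j-1},\qquad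 m^{\mu^{(j)}}_{\mathfrak s}\mapsto m^\lambda_{\mathfrak s\cup\alpha_j}+N_{j-1},$$ where $\mathfrak s\cup\alpha_j$ is the standard $\lambda$-tableau that agrees with $\mathfrak s$ on $\mu^{(j)}$ and has the entry $n$ in the node $\alpha_j$. -/

import Mathlib

noncomputable section

namespace HeckeCell

/-! ## Cellular algebras and their cell modules -/

section Cellular

variable {R A : Type*} [CommRing R] [Ring A] [Algebra R A]
variable {Λ : Type*} [PartialOrder Λ] {M : Λ → Type*}

/-- `A^{▷ lam}`: the `R`-span of the `c^μ_{st}` with `μ ▷ lam`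
(the order `▷` on the index poset is written `>`). -/
def strictSpan (R : Type*) [CommRing R] [Algebra R A] (c : ∀ lam, M lam → M lam → A) (lam : Λ) :
    Submodule R A :=
  Submodule.span R {x | ∃ μ : Λ, lam < μ ∧ ∃ s t : M μ, x = c μ s t}

/-- `(A, *, Λ, ≥, c)` is a cell datum.  The involution is given as an `R`-algebra homomorphism
from `A` to its opposite algebra. -/
structure IsCellDatum (star : A →ₐ[R] Aᵐᵒᵖ) (c : ∀ lam, M lam → M lam → A) : Prop where
  finite_index : Finite Λ
  finite_tab : ∀ lam, Finite (M lam)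
  star_star : ∀ x : A, (star (star x).unop).unop = x
  linearIndependent :
    LinearIndependent R (fun x : (lam : Λ) × (M lam × M lam) => c x.1 x.2.1 x.2.2)
  span_eq_top :
    Submodule.span R (Set.range fun x : (lam : Λ) × (M lam × M lam) => c x.1 x.2.1 x.2.2) = ⊤
  mul_mem : ∀ (lam : Λ) (t : M lam) (a : A), ∃ r : M lam →₀ R, ∀ s : M lam,
    c lam s t * a - r.linearCombination R (c lam s) ∈ strictSpan R c lam
  star_mem : ∀ (lam : Λ) (s t : M lam),
    (star (c lam s t)).unop - c lam t s ∈ strictSpan R c lam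

namespace IsCellDatum

variable {star : A →ₐ[R] Aᵐᵒᵖ} {c : ∀ lam, M lam → M lam → A}

/-- The structure coefficients `r_v(t, a)`, as a finitely supported function of `v`. -/
def coeff (h : IsCellDatum star c) (lam : Λ) (t : M lam) (a : A) : M lam →₀ R :=
  (h.mul_mem lam t a).choose

theorem coeff_spec (h : IsCellDatum star c) (lam : Λ) (s t : M lam) (a : A) :
    c lam s t * a - (h.coeff lam t a).linearCombination R (c lam s) ∈ strictSpan R c lam :=
  (h.mul_mem lam t a).choose_spec s

theorem strictSpan_mul (h : IsCellDatum star c) (lam : Λ) (a : A) {x : A}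
    (hx : x ∈ strictSpan R c lam) : x * a ∈ strictSpan R c lam := by
  unfold strictSpan at hx
  induction hx using Submodule.span_induction with
  | zero => simp
  | add x y _ _ hx hy => rw [add_mul]; exact add_mem hx hy
  | smul r x _ hx => rw [smul_mul_assoc]; exact Submodule.smul_mem _ _ hx
  | mem x hx =>
    obtain ⟨μ, hμ, s, t, rfl⟩ := hx
    have h1 : strictSpan R c μ ≤ strictSpan R c lam := by
      apply Submodule.span_mono
      rintro _ ⟨ν, hν, s, t, rfl⟩
      exact ⟨ν, hμ.trans hν, s, t, rfl⟩
    have h2 : (h.coeff μ t a).linearCombination R (c μ s) ∈ strictSpan R c lam := by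
      rw [Finsupp.linearCombination_apply]
      exact Submodule.sum_mem _ fun v _ => Submodule.smul_mem _ _
        (Submodule.subset_span ⟨μ, hμ, s, v, rfl⟩)
    simpa using add_mem (h1 (h.coeff_spec μ s t a)) h2

theorem eq_zero_of_mem (h : IsCellDatum star c) (lam : Λ) (s : M lam) (r : M lam →₀ R)
    (hr : r.linearCombination R (c lam s) ∈ strictSpan R c lam) : r = 0 := by
  set f : (lam : Λ) × (M lam × M lam) → A := fun x => c x.1 x.2.1 x.2.2 with hf
  set S : Set ((lam : Λ) × (M lam × M lam)) := {x | x.1 = lam}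
  set T : Set ((lam : Λ) × (M lam × M lam)) := {x | lam < x.1}
  have hST : Disjoint S T := by
    rw [Set.disjoint_left]
    rintro x (hx : x.1 = lam) (hx' : lam < x.1)
    exact absurd hx (ne_of_gt hx')
  have hT : strictSpan R c lam = Submodule.span R (f '' T) := by
    unfold strictSpan
    congr 1
    ext x
    constructor
    · rintro ⟨μ, hμ, s, t, rfl⟩; exact ⟨⟨μ, s, t⟩, hμ, rfl⟩
    · rintro ⟨⟨μ, s, t⟩, hμ, rfl⟩; exact ⟨μ, hμ, s, t, rfl⟩
  have hS : r.linearCombination R (c lam s) ∈ Submodule.span R (f '' S) := by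
    rw [Finsupp.linearCombination_apply]
    exact Submodule.sum_mem _ fun v _ => Submodule.smul_mem _ _
      (Submodule.subset_span ⟨⟨lam, s, v⟩, rfl, rfl⟩)
  have h0 : r.linearCombination R (c lam s) = 0 :=
    Submodule.disjoint_def.1 (h.linearIndependent.disjoint_span_image hST) _ hS (hT ▸ hr)
  have hli : LinearIndependent R (c lam s) :=
    h.linearIndependent.comp (fun v : M lam => (⟨lam, s, v⟩ : (lam : Λ) × (M lam × M lam)))
      (by intro v w hvw; simpa using hvw)
  exact (linearIndependent_iff.1 hli) r h0

theorem coeff_unique (h : IsCellDatum star c) (lam : Λ) (s t : M lam) (a : A) (r : M lam →₀ R)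
    (hr : c lam s t * a - r.linearCombination R (c lam s) ∈ strictSpan R c lam) :
    h.coeff lam t a = r := by
  rw [← sub_eq_zero]
  apply h.eq_zero_of_mem lam s
  rw [map_sub]
  have := sub_mem hr (h.coeff_spec lam s t a)
  rwa [sub_sub_sub_cancel_left] at this

/-- The cell module `Δ^lam`: as an `R`-module, free on the index set `M lam`. -/
def CellModule (_h : IsCellDatum star c) (lam : Λ) : Type _ := M lam →₀ R

instance (h : IsCellDatum star c) (lam : Λ) : AddCommGroup (h.CellModule lam) :=
  inferInstanceAs (AddCommGroup (M lam →₀ R))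

instance (h : IsCellDatum star c) (lam : Λ) : Module R (h.CellModule lam) :=
  inferInstanceAs (Module R (M lam →₀ R))

/-- The standard basis of the cell module. -/
def cellBasis (h : IsCellDatum star c) (lam : Λ) : Module.Basis (M lam) R (h.CellModule lam) :=
  Module.Basis.ofRepr (LinearEquiv.refl R (M lam →₀ R))

/-- Right multiplication by `a` on the cell module: `c_t a = ∑ v, r_v(t, a) c_v`. -/
def act (h : IsCellDatum star c) (lam : Λ) (a : A) : (M lam →₀ R) →ₗ[R] (M lam →₀ R) :=
  Finsupp.linearCombination R (fun t => h.coeff lam t a)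

theorem act_spec (h : IsCellDatum star c) (lam : Λ) (s : M lam) (x : M lam →₀ R) (a : A) :
    x.linearCombination R (c lam s) * a - (h.act lam a x).linearCombination R (c lam s)
      ∈ strictSpan R c lam := by
  induction x using Finsupp.induction_linear with
  | zero => simp
  | add x y hx hy =>
    have := add_mem hx hy
    simp only [map_add, add_mul]
    convert this using 1
    abel
  | single t b =>
    have := Submodule.smul_mem _ b (h.coeff_spec lam s t a)
    simpa [act, smul_sub] using this

theorem act_unique (h : IsCellDatum star c) (lam : Λ) (s : M lam) (x y : M lam →₀ R) (a : A)
    (hy : x.linearCombination R (c lam s) * a - y.linearCombination R (c lam s)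
      ∈ strictSpan R c lam) : h.act lam a x = y := by
  rw [← sub_eq_zero]
  apply h.eq_zero_of_mem lam s
  rw [map_sub]
  have := sub_mem hy (h.act_spec lam s x a)
  rwa [sub_sub_sub_cancel_left] at this

theorem act_unique' (h : IsCellDatum star c) (lam : Λ) (x y : M lam →₀ R) (a : A)
    (hy : ∀ s, x.linearCombination R (c lam s) * a - y.linearCombination R (c lam s)
      ∈ strictSpan R c lam) : h.act lam a x = y := by
  rcases isEmpty_or_nonempty (M lam) with _ | ⟨⟨s⟩⟩
  · exact Subsingleton.elim _ _
  · exact h.act_unique lam s x y a (hy s)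

/-- The right `A`-module structure of the cell module. -/
instance (h : IsCellDatum star c) (lam : Λ) : Module Aᵐᵒᵖ (h.CellModule lam) where
  smul a x := h.act lam a.unop x
  one_smul x := h.act_unique' lam x x 1 fun s => by simp
  mul_smul a b x := h.act_unique' lam x (h.act lam a.unop (h.act lam b.unop x)) _ fun s => by
    have h1 := h.strictSpan_mul lam a.unop (h.act_spec lam s x b.unop)
    have h2 := h.act_spec lam s (h.act lam b.unop x) a.unop
    have h3 := add_mem h1 h2
    rw [sub_mul, mul_assoc, sub_add_sub_cancel] at h3
    simpa using h3
  smul_zero a := (h.act lam a.unop).map_zero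
  smul_add a := (h.act lam a.unop).map_add
  add_smul a b x := h.act_unique' lam x (h.act lam a.unop x + h.act lam b.unop x) _ fun s => by
    have h3 := add_mem (h.act_spec lam s x a.unop) (h.act_spec lam s x b.unop)
    rw [map_add, MulOpposite.unop_add, mul_add]
    convert h3 using 1
    abel
  zero_smul x := h.act_unique' lam x 0 0 fun s => by simp

theorem op_smul_cellBasis (h : IsCellDatum star c) (lam : Λ) (t : M lam) (a : A) :
    MulOpposite.op a • h.cellBasis lam t =
      (h.coeff lam t a).linearCombination R (h.cellBasis lam) := by
  change h.act lam a (Finsupp.single t 1) = _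
  have : ∀ r : M lam →₀ R, r.linearCombination R (h.cellBasis lam) = r := fun r => by
    exact (h.cellBasis lam).linearCombination_repr r
  rw [this]
  simp [act]

instance (h : IsCellDatum star c) (lam : Λ) : IsScalarTower R Aᵐᵒᵖ (h.CellModule lam) where
  smul_assoc r a x := h.act_unique' lam x (r • h.act lam a.unop x) _ fun s => by
    have := Submodule.smul_mem _ r (h.act_spec lam s x a.unop)
    simpa [smul_sub] using this

/-- `0 = N 0 ⊆ N 1 ⊆ ⋯ ⊆ N p = V` is an order preserving cell filtration of the right `A`-module
`V`, the `j`-th subquotient being isomorphic to the cell module of `μ j`. -/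
structure IsOrderPreservingCellFiltration (h : IsCellDatum star c)
    {V : Type*} [AddCommGroup V] [Module Aᵐᵒᵖ V] {p : ℕ}
    (N : Fin (p + 1) → Submodule Aᵐᵒᵖ V) (μ : Fin p → Λ) : Prop where
  zero_eq_bot : N 0 = ⊥
  last_eq_top : N (Fin.last p) = ⊤
  le_succ : ∀ j : Fin p, N j.castSucc ≤ N j.succ
  quotient : ∀ j : Fin p, Nonempty
    (h.CellModule (μ j) ≃ₗ[Aᵐᵒᵖ] (N j.succ ⧸ (N j.castSucc).submoduleOf (N j.succ)))
  order : ∀ i j : Fin p, i < j → μ j < μ i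

end IsCellDatum

/-- The right `A`-module `V`, restricted to a right `B`-module along `f : B → A`. -/
def Res {B : Type*} [Ring B] [Algebra R B] (_f : B →ₐ[R] A) (V : Type*) : Type _ := V

section Res

variable {B : Type*} [Ring B] [Algebra R B] (f : B →ₐ[R] A) (V : Type*) [AddCommGroup V]

instance : AddCommGroup (Res f V) := inferInstanceAs (AddCommGroup V)

instance [Module R V] : Module R (Res f V) := inferInstanceAs (Module R V)

instance [Module Aᵐᵒᵖ V] : Module Bᵐᵒᵖ (Res f V) :=
  Module.compHom V (AlgHom.op f : Bᵐᵒᵖ →ₐ[R] Aᵐᵒᵖ).toRingHom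

/-- The identity map from `V` to its restriction. -/
def toRes [Module R V] : V ≃ₗ[R] Res f V := LinearEquiv.refl R V

theorem op_smul_toRes [Module R V] [Module Aᵐᵒᵖ V] (b : B) (v : V) :
    MulOpposite.op b • toRes f V v = toRes f V (MulOpposite.op (f b) • v) := rfl

end Res

end Cellular

/-! ## Partitions and tableaux

Rows, columns, and the entries of tableaux are numbered from `0`: the entry `k` of the usual
convention is the element `k - 1` of `Fin n`, and the generator `T_i` is the one with index
`i - 1` in `Fin (n - 1)`. -/

/-- Partitions of `n`, as Young diagrams. -/
@[ext] structure Shape (n : ℕ) where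
  diagram : YoungDiagram
  card_eq : diagram.card = n

namespace Shape

variable {n : ℕ}

/-- The number of nodes in the first `j` rows. -/
def rowSum (lam : Shape n) (j : ℕ) : ℕ := ∑ i ∈ Finset.range j, lam.diagram.rowLen i

theorem rowSum_succ (lam : Shape n) (j : ℕ) :
    lam.rowSum (j + 1) = lam.rowSum j + lam.diagram.rowLen j :=
  Finset.sum_range_succ _ _

theorem rowSum_mono (lam : Shape n) : Monotone lam.rowSum :=
  monotone_nat_of_le_succ fun j => by rw [rowSum_succ]; omega

theorem rowSum_le (lam : Shape n) (j : ℕ) : lam.rowSum j ≤ n := by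
  have h1 : lam.rowSum j = ((Finset.range j).biUnion lam.diagram.row).card := by
    rw [Finset.card_biUnion]
    · simp [rowSum, YoungDiagram.rowLen_eq_card]
    · intro a _ b _ hab
      refine Finset.disjoint_left.2 ?_
      intro x hx hx'
      rw [YoungDiagram.mem_row_iff] at hx hx'
      exact hab (hx.2.symm.trans hx'.2)
  rw [h1]
  refine le_trans (Finset.card_le_card ?_) lam.card_eq.le
  intro x hx
  simp only [Finset.mem_biUnion, YoungDiagram.mem_row_iff] at hx
  obtain ⟨_, _, hx, _⟩ := hx
  exact hx

/-- The dominance order: `μ ≤ lam` if and only if `lam ⊵ μ`. -/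
instance : PartialOrder (Shape n) where
  le μ lam := ∀ j, μ.rowSum j ≤ lam.rowSum j
  le_refl _ _ := le_rfl
  le_trans _ _ _ h h' j := (h j).trans (h' j)
  le_antisymm μ lam h h' := by
    have h0 : ∀ j, μ.rowSum j = lam.rowSum j := fun j => le_antisymm (h j) (h' j)
    have h1 : ∀ j, μ.diagram.rowLen j = lam.diagram.rowLen j := fun j => by
      have := h0 (j + 1)
      rw [rowSum_succ, rowSum_succ, h0 j] at this
      omega
    ext ⟨i, j⟩
    change (i, j) ∈ μ.diagram ↔ (i, j) ∈ lam.diagram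
    rw [YoungDiagram.mem_iff_lt_rowLen, YoungDiagram.mem_iff_lt_rowLen, h1]

/-- Removable nodes: nodes of `lam` whose removal leaves a Young diagram. -/
def IsRemovable (lam : Shape n) (α : ℕ × ℕ) : Prop :=
  α ∈ lam.diagram ∧ IsLowerSet (lam.diagram.cells.erase α : Set (ℕ × ℕ))

/-- The partition `lam ∖ α`. -/
def remove (lam : Shape (n + 1)) (α : ℕ × ℕ) (hα : lam.IsRemovable α) : Shape n where
  diagram := ⟨lam.diagram.cells.erase α, hα.2⟩
  card_eq := by
    have h := Finset.card_erase_of_mem (s := lam.diagram.cells) (a := α) hα.1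
    have h' : lam.diagram.cells.card = n + 1 := lam.card_eq
    change (lam.diagram.cells.erase α).card = n
    omega

/-- Injective `lam`-tableaux: every entry appears exactly once. -/
abbrev InjTableau (lam : Shape n) : Type := {x // x ∈ lam.diagram.cells} ≃ Fin n

/-- An injective map from the nodes of `lam` to the `n` entries is an injective tableau. -/
def mkTableau (lam : Shape n) (f : {x // x ∈ lam.diagram.cells} → Fin n)
    (hf : Function.Injective f) : lam.InjTableau :=
  Equiv.ofBijective f ((Fintype.bijective_iff_injective_and_card f).2
    ⟨hf, by rw [Fintype.card_coe, Fintype.card_fin]; exact lam.card_eq⟩)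

theorem rowEntry_lt (lam : Shape n) {x : ℕ × ℕ} (hx : x ∈ lam.diagram.cells) :
    lam.rowSum x.1 + x.2 < lam.rowSum (x.1 + 1) := by
  have : x.2 < lam.diagram.rowLen x.1 := YoungDiagram.mem_iff_lt_rowLen.1 hx
  rw [rowSum_succ]
  omega

/-- The tableau `t^lam`, with the entries in increasing order along the rows. -/
def rowTableau (lam : Shape n) : lam.InjTableau :=
  lam.mkTableau (fun x => ⟨lam.rowSum x.1.1 + x.1.2,
    (lam.rowEntry_lt x.2).trans_le (lam.rowSum_le _)⟩) (by
    rintro ⟨⟨i, j⟩, hx⟩ ⟨⟨k, l⟩, hy⟩ h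
    have hx' := lam.rowEntry_lt hx
    have hy' := lam.rowEntry_lt hy
    simp only [Fin.mk.injEq] at h hx' hy'
    rcases lt_trichotomy i k with hik | hik | hik
    · have := lam.rowSum_mono (show i + 1 ≤ k from hik)
      omega
    · subst hik
      simp only [Subtype.mk.injEq, Prod.mk.injEq, true_and]
      omega
    · have := lam.rowSum_mono (show k + 1 ≤ i from hik)
      omega)

/-- The permutation `w(t)` with `t = t^lam w(t)`, where permutations act on entries from the
right: `w(t)` sends the entry of `t^lam` in a node to the entry of `t` in that node. -/
def perm (lam : Shape n) (t : lam.InjTableau) : Equiv.Perm (Fin n) :=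
  lam.rowTableau.symm.trans t

/-- The Young subgroup: the row stabilizer of `t^lam`. -/
def youngSubgroup (lam : Shape n) : Subgroup (Equiv.Perm (Fin n)) where
  carrier := {v | ∀ k, (lam.rowTableau.symm (v k)).1.1 = (lam.rowTableau.symm k).1.1}
  one_mem' k := rfl
  mul_mem' {v w} hv hw k := (hv (w k)).trans (hw k)
  inv_mem' {v} hv k := by
    have := hv (v⁻¹ k)
    simpa using this.symm

/-- A standard tableau: entries strictly increase along rows and down columns. -/
def IsStandard (lam : Shape n) (t : lam.InjTableau) : Prop :=
  (∀ x y : {x // x ∈ lam.diagram.cells}, x.1.1 = y.1.1 → x.1.2 < y.1.2 → t x < t y) ∧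
  (∀ x y : {x // x ∈ lam.diagram.cells}, x.1.2 = y.1.2 → x.1.1 < y.1.1 → t x < t y)

/-- The set of standard `lam`-tableaux. -/
def Std (lam : Shape n) : Type := {t : lam.InjTableau // lam.IsStandard t}

theorem mem_remove {lam : Shape (n + 1)} {α : ℕ × ℕ} (hα : lam.IsRemovable α) {x : ℕ × ℕ}
    (hx : x ∈ lam.diagram.cells) (h : x ≠ α) : x ∈ (lam.remove α hα).diagram.cells :=
  Finset.mem_erase.2 ⟨h, hx⟩

open Classical in
/-- The map underlying `s ∪ α`: it agrees with `s` away from `α` and has the largest entry in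
the node `α`. -/
def adjoinFun {lam : Shape (n + 1)} {α : ℕ × ℕ} (hα : lam.IsRemovable α)
    (s : (lam.remove α hα).InjTableau) (x : {x // x ∈ lam.diagram.cells}) : Fin (n + 1) :=
  if h : x.1 = α then Fin.last n else (s ⟨x.1, mem_remove hα x.2 h⟩).castSucc

theorem adjoinFun_injective {lam : Shape (n + 1)} {α : ℕ × ℕ} (hα : lam.IsRemovable α)
    (s : (lam.remove α hα).InjTableau) : Function.Injective (adjoinFun hα s) := by
  intro x y h
  unfold adjoinFun at h
  split_ifs at h with h1 h2 h2
  · exact Subtype.ext (h1.trans h2.symm)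
  · exact absurd h.symm (Fin.castSucc_lt_last _).ne
  · exact absurd h (Fin.castSucc_lt_last _).ne
  · have := s.injective (Fin.castSucc_injective _ h)
    exact Subtype.ext (Subtype.mk.inj this)

theorem adjoinFun_lt {lam : Shape (n + 1)} {α : ℕ × ℕ} (hα : lam.IsRemovable α)
    (s : (lam.remove α hα).InjTableau) (x y : {x // x ∈ lam.diagram.cells})
    (hxy : x.1 ≤ y.1) (hne : x.1 ≠ y.1)
    (hs : ∀ (hx : x.1 ∈ (lam.remove α hα).diagram.cells)
      (hy : y.1 ∈ (lam.remove α hα).diagram.cells), s ⟨x.1, hx⟩ < s ⟨y.1, hy⟩) :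
    adjoinFun hα s x < adjoinFun hα s y := by
  have hx : x.1 ≠ α := by
    intro h
    have hy : y.1 ∈ (lam.diagram.cells.erase α : Set (ℕ × ℕ)) := by
      have : y.1 ≠ α := fun h' => hne (h.trans h'.symm)
      simp [this]
    have := hα.2 hxy hy
    simp [h] at this
  unfold adjoinFun
  rw [dif_neg hx]
  split_ifs with hy
  · exact Fin.castSucc_lt_last _
  · exact Fin.castSucc_lt_castSucc_iff.2 (hs _ _)

/-- The standard tableau `s ∪ α` of shape `lam`, for `s` a standard tableau of shape
`lam ∖ α`. -/
def adjoin {lam : Shape (n + 1)} {α : ℕ × ℕ} (hα : lam.IsRemovable α)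
    (s : (lam.remove α hα).Std) : lam.Std :=
  ⟨lam.mkTableau (adjoinFun hα s.1) (adjoinFun_injective hα s.1),
    ⟨fun x y h h' => adjoinFun_lt hα s.1 x y ⟨h.le, h'.le⟩
        (fun h'' => by rw [h''] at h'; exact lt_irrefl _ h') fun _ _ => s.2.1 _ _ h h',
      fun x y h h' => adjoinFun_lt hα s.1 x y ⟨h'.le, h.le⟩
        (fun h'' => by rw [h''] at h'; exact lt_irrefl _ h') fun _ _ => s.2.2 _ _ h h'⟩⟩

/-- The node of `t` that contains the largest entry. -/
def Std.lastNode {lam : Shape (n + 1)} (t : lam.Std) : ℕ × ℕ := (t.1.symm (Fin.last n)).1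

end Shape

/-! ## Reduced expressions in the symmetric group -/

/-- The simple transposition exchanging the consecutive entries `i` and `i + 1`. -/
def simpleTransposition {n : ℕ} (i : Fin (n - 1)) : Equiv.Perm (Fin n) :=
  Equiv.swap ⟨i, by omega⟩ ⟨i + 1, by omega⟩

/-- The product `s_{i_1} s_{i_2} ⋯ s_{i_l}` of permutations acting from the right
(`s_{i_1}` is applied first). -/
def wordPerm {n : ℕ} : List (Fin (n - 1)) → Equiv.Perm (Fin n)
  | [] => Equiv.refl _
  | i :: l => (simpleTransposition i).trans (wordPerm l)

theorem wordPerm_append_singleton {n : ℕ} (l : List (Fin (n - 1))) (i : Fin (n - 1)) :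
    wordPerm (l ++ [i]) = (wordPerm l).trans (simpleTransposition i) := by
  induction l with
  | nil => rfl
  | cons j l ih => simp only [List.cons_append, wordPerm, ih]; rfl

theorem exists_wordPerm_eq {n : ℕ} (w : Equiv.Perm (Fin n)) :
    ∃ l : List (Fin (n - 1)), wordPerm l = w := by
  cases n with
  | zero => exact ⟨[], Subsingleton.elim _ _⟩
  | succ n =>
    have hw : w ∈ Submonoid.closure
        (Set.range fun i : Fin n => Equiv.swap i.castSucc i.succ) := by
      rw [Equiv.Perm.mclosure_swap_castSucc_succ]; trivial
    induction hw using Submonoid.closure_induction_left with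
    | one => exact ⟨[], rfl⟩
    | mul_left x hx y _ ih =>
      obtain ⟨i, rfl⟩ := hx
      obtain ⟨l, rfl⟩ := ih
      exact ⟨List.append l [i], wordPerm_append_singleton (n := n + 1) l i⟩

/-- The length `l(w)`: the least length of an expression of `w` as a product of simple
transpositions. -/
def permLength {n : ℕ} (w : Equiv.Perm (Fin n)) : ℕ :=
  sInf {k | ∃ l : List (Fin (n - 1)), wordPerm l = w ∧ l.length = k}

theorem exists_reducedWord {n : ℕ} (w : Equiv.Perm (Fin n)) :
    ∃ l : List (Fin (n - 1)), wordPerm l = w ∧ l.length = permLength w := by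
  obtain ⟨l, hl⟩ := exists_wordPerm_eq w
  exact Nat.sInf_mem (s := {k | ∃ l : List (Fin (n - 1)), wordPerm l = w ∧ l.length = k})
    ⟨l.length, l, hl, rfl⟩

/-- A reduced expression of `w`. -/
def reducedWord {n : ℕ} (w : Equiv.Perm (Fin n)) : List (Fin (n - 1)) :=
  (exists_reducedWord w).choose

/-! ## The Iwahori-Hecke algebra of the symmetric group -/

section Hecke

variable {R : Type*} [CommRing R]

/-- The defining relations, on generators `T_i` indexed by `Fin (n - 1)`. -/
inductive HeckeRel (q : Rˣ) (n : ℕ) :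
    FreeAlgebra R (Fin (n - 1)) → FreeAlgebra R (Fin (n - 1)) → Prop
  | comm (i j : Fin (n - 1)) (h : (i : ℕ) + 1 < j ∨ (j : ℕ) + 1 < i) :
      HeckeRel q n (FreeAlgebra.ι R i * FreeAlgebra.ι R j) (FreeAlgebra.ι R j * FreeAlgebra.ι R i)
  | braid (i j : Fin (n - 1)) (h : (i : ℕ) + 1 = j) :
      HeckeRel q n (FreeAlgebra.ι R i * FreeAlgebra.ι R j * FreeAlgebra.ι R i)
        (FreeAlgebra.ι R j * FreeAlgebra.ι R i * FreeAlgebra.ι R j)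
  | quad (i : Fin (n - 1)) :
      HeckeRel q n
        ((FreeAlgebra.ι R i - algebraMap R _ (q : R)) *
          (FreeAlgebra.ι R i + algebraMap R _ ((q⁻¹ : Rˣ) : R))) 0

/-- The Iwahori-Hecke algebra `H_n(q²)` of the symmetric group. -/
def Hecke (q : Rˣ) (n : ℕ) : Type _ := RingQuot (HeckeRel q n)

instance (q : Rˣ) (n : ℕ) : Ring (Hecke q n) := inferInstanceAs (Ring (RingQuot (HeckeRel q n)))

instance (q : Rˣ) (n : ℕ) : Algebra R (Hecke q n) :=
  inferInstanceAs (Algebra R (RingQuot (HeckeRel q n)))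

namespace Hecke

/-- The generator `T_i`. -/
def gen (q : Rˣ) {n : ℕ} (i : Fin (n - 1)) : Hecke q n :=
  RingQuot.mkAlgHom R (HeckeRel q n) (FreeAlgebra.ι R i)

theorem gen_comm (q : Rˣ) {n : ℕ} (i j : Fin (n - 1))
    (h : (i : ℕ) + 1 < j ∨ (j : ℕ) + 1 < i) : gen q i * gen q j = gen q j * gen q i := by
  have := RingQuot.mkAlgHom_rel R (HeckeRel.comm (q := q) (n := n) i j h)
  rw [map_mul, map_mul] at this
  exact this

theorem gen_braid (q : Rˣ) {n : ℕ} (i j : Fin (n - 1)) (h : (i : ℕ) + 1 = j) :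
    gen q i * gen q j * gen q i = gen q j * gen q i * gen q j := by
  have := RingQuot.mkAlgHom_rel R (HeckeRel.braid (q := q) (n := n) i j h)
  simp only [map_mul] at this
  exact this

theorem gen_quad (q : Rˣ) {n : ℕ} (i : Fin (n - 1)) :
    (gen q i - algebraMap R (Hecke q n) q) *
      (gen q i + algebraMap R (Hecke q n) ((q⁻¹ : Rˣ) : R)) = 0 := by
  have := RingQuot.mkAlgHom_rel R (HeckeRel.quad (q := q) (n := n) i)
  simp only [map_mul, map_sub, map_add, AlgHom.commutes, map_zero] at this
  exact this

/-- The universal property of the Hecke algebra. -/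
def lift (q : Rˣ) {n : ℕ} {B : Type*} [Ring B] [Algebra R B] (f : Fin (n - 1) → B)
    (hcomm : ∀ i j : Fin (n - 1), (i : ℕ) + 1 < j ∨ (j : ℕ) + 1 < i → f i * f j = f j * f i)
    (hbraid : ∀ i j : Fin (n - 1), (i : ℕ) + 1 = j → f i * f j * f i = f j * f i * f j)
    (hquad : ∀ i, (f i - algebraMap R B q) * (f i + algebraMap R B ((q⁻¹ : Rˣ) : R)) = 0) :
    Hecke q n →ₐ[R] B :=
  RingQuot.liftAlgHom R ⟨FreeAlgebra.lift R f, by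
    intro x y hxy
    cases hxy with
    | comm i j h => simpa using hcomm i j h
    | braid i j h => simpa using hbraid i j h
    | quad i => simpa using hquad i⟩

theorem lift_gen (q : Rˣ) {n : ℕ} {B : Type*} [Ring B] [Algebra R B] (f : Fin (n - 1) → B)
    (hcomm hbraid hquad) (i : Fin (n - 1)) :
    lift q f hcomm hbraid hquad (gen q i) = f i := by
  have := RingQuot.liftAlgHom_mkAlgHom_apply R (s := HeckeRel q n) (FreeAlgebra.lift R f)
    (by
      intro x y hxy
      cases hxy with
      | comm i j h => simpa using hcomm i j h
      | braid i j h => simpa using hbraid i j h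
      | quad i => simpa using hquad i) (FreeAlgebra.ι R i)
  rw [FreeAlgebra.lift_ι_apply] at this
  exact this

/-- The natural map `H_n → H_{n+1}`, sending `T_i` to `T_i`. -/
def incl (q : Rˣ) (n : ℕ) : Hecke q n →ₐ[R] Hecke q (n + 1) :=
  lift q (fun i => gen q (Fin.castLE (by omega) i))
    (fun i j h => gen_comm q _ _ h) (fun i j h => gen_braid q _ _ h) (fun i => gen_quad q _)

/-- The algebra involution `*`: the anti-automorphism fixing every `T_i` (so it maps `T_v` to
`T_{v⁻¹}`). -/
def star (q : Rˣ) (n : ℕ) : Hecke q n →ₐ[R] (Hecke q n)ᵐᵒᵖ :=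
  lift q (fun i => MulOpposite.op (gen q i))
    (fun i j h => MulOpposite.unop_injective (gen_comm q i j h).symm)
    (fun i j h => MulOpposite.unop_injective (by
      simpa [mul_assoc] using gen_braid q i j h))
    (fun i => MulOpposite.unop_injective (by
      have h := gen_quad q (n := n) i
      have hc : Commute (gen q i - algebraMap R (Hecke q n) q)
          (gen q i + algebraMap R (Hecke q n) ((q⁻¹ : Rˣ) : R)) :=
        ((Commute.refl _).add_right (Algebra.commute_algebraMap_right _ _)).sub_left
          (Algebra.commute_algebraMap_left _ _)
      rw [hc.eq] at h
      simpa [MulOpposite.algebraMap_apply] using h))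

/-- `T_w`, for a permutation `w`: the product of the generators along a reduced expression. -/
def T (q : Rˣ) {n : ℕ} (w : Equiv.Perm (Fin n)) : Hecke q n :=
  ((reducedWord w).map (gen q)).prod

open Classical in
/-- `m_lam = ∑ q^{l(v)} T_v`, the sum over the Young subgroup of `lam`. -/
def m (q : Rˣ) {n : ℕ} (lam : Shape n) : Hecke q n :=
  ∑ v : Equiv.Perm (Fin n) with v ∈ lam.youngSubgroup, ((q : R) ^ permLength v) • T q v

/-- The Murphy basis elements `m^lam_{st} = T_{w(s)}^* m_lam T_{w(t)}`. -/
def murphy (q : Rˣ) (n : ℕ) (lam : Shape n) (s t : lam.Std) : Hecke q n :=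
  (star q n (T q (lam.perm s.1))).unop * m q lam * T q (lam.perm t.1)

end Hecke

/-- The Murphy basis is a cellular basis of `H_n`, with respect to the involution `*` and the
dominance order on partitions of `n`. -/
abbrev IsMurphyCellular (q : Rˣ) (n : ℕ) : Prop :=
  IsCellDatum (Hecke.star q n) (Hecke.murphy q n)

end Hecke

end HeckeCell

end

open HeckeCell

/-! The Hecke algebra acts from the right on the free module on words of length `n` (quantized
tensor space). The words of a fixed content span a permutation module. The homomorphism `theta`
carries the one of content λ into the Hecke algebra and sends the row word of a standard tableau `t`
to `m_λ T_{w(t)}`. Computing in a cell module thus becomes straightening words.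

Straightening comes from the other side of Schur–Weyl duality. The divided powers `divPow`, which
turn `k` letters `i` into `i + 1`, commute with the Hecke action (`divPow_opT`). Modulo the images
of divided powers with `k ≥ 1`, every word is a combination of ballot words (`straightening`), and a
ballot word of content λ is the row word of a standard tableau (`exists_std_of_ballot`). Under
`theta` for λ, the divided power of a word is zero or lies in the two-sided ideal of some `m_μ` with
μ ▷ λ (`theta_divPow_mem`): content λ is reached only from a content whose sorted form dominates λ
strictly, and by `mem_span_symmetrizer` any homomorphism into the Hecke algebra sends the generator
of the corresponding permutation module to a left multiple of `m_μ`. Downward induction on dominance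
then shows that the Murphy elements span and multiply as a cellular basis should. Linear
independence follows by counting: Young's lattice gives `∑ (f^λ)² ≤ n!`, and a spanning family with
no more members than the rank is independent.

For the branching rule, let `n` be the largest entry. A tableau with `n` in the node α has a row
word ending in the row of α, and `H_{n-1}` acts on the first `n - 1` letters only. When the prefix
is straightened, the recursion of `divPow` on the last letter replaces that letter, if at all, by a
larger one, that is, by a lower row (`theta_app_mem`). Hence the `N_j` are submodules. Modulo lower
rows the prefix straightens exactly as it does for λ∖α (`exists_lift_eq`), so `m_s ↦ m_{s∪α}` is a
homomorphism to the subquotient, and comparing bases shows that it is bijective. The order statement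
is a comparison of row sums. -/

noncomputable section

namespace HeckeCell

/-! ## Inversions -/

/-- The lower of the two entries exchanged by the `i`-th simple transposition. -/
def lo {n : ℕ} (i : Fin (n - 1)) : Fin n := ⟨i, by omega⟩

/-- The upper of the two entries exchanged by the `i`-th simple transposition. -/
def hi {n : ℕ} (i : Fin (n - 1)) : Fin n := ⟨i + 1, by omega⟩

theorem lo_lt_hi {n : ℕ} (i : Fin (n - 1)) : lo i < hi i := by
  simp [lo, hi, Fin.lt_def]

theorem lo_ne_hi {n : ℕ} (i : Fin (n - 1)) : lo i ≠ hi i := (lo_lt_hi i).ne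

theorem simpleTransposition_eq {n : ℕ} (i : Fin (n - 1)) :
    simpleTransposition i = Equiv.swap (lo i) (hi i) := rfl

@[simp] theorem simpleTransposition_lo {n : ℕ} (i : Fin (n - 1)) :
    simpleTransposition i (lo i) = hi i := Equiv.swap_apply_left _ _

@[simp] theorem simpleTransposition_hi {n : ℕ} (i : Fin (n - 1)) :
    simpleTransposition i (hi i) = lo i := Equiv.swap_apply_right _ _

@[simp] theorem simpleTransposition_simpleTransposition {n : ℕ} (i : Fin (n - 1)) (k : Fin n) :
    simpleTransposition i (simpleTransposition i k) = k := Equiv.swap_apply_self _ _ _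

@[simp] theorem simpleTransposition_symm {n : ℕ} (i : Fin (n - 1)) :
    (simpleTransposition i).symm = simpleTransposition i := Equiv.symm_swap _ _

theorem simpleTransposition_of_ne {n : ℕ} (i : Fin (n - 1)) {k : Fin n} (h : k ≠ lo i)
    (h' : k ≠ hi i) : simpleTransposition i k = k := Equiv.swap_apply_of_ne_of_ne h h'

theorem simpleTransposition_lt {n : ℕ} (i : Fin (n - 1)) {k l : Fin n} (h : k < l)
    (hne : ¬ (k = lo i ∧ l = hi i)) : simpleTransposition i k < simpleTransposition i l := by
  rw [simpleTransposition_eq, Equiv.swap_apply_def, Equiv.swap_apply_def]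
  simp only [lo, hi, Fin.ext_iff, Fin.lt_def] at *
  split_ifs <;> (try dsimp only) <;> omega

/-- Inversions of the word `w` between letters in the same fibre of `π`. -/
def inversions {A : Type*} [LinearOrder A] (π : A → ℕ) {n : ℕ} (w : Fin n → A) :
    Finset (Fin n × Fin n) :=
  Finset.univ.filter fun p => p.1 < p.2 ∧ w p.2 < w p.1 ∧ π (w p.1) = π (w p.2)

/-- Exchanging two adjacent letters that are in order transports every old inversion along the
exchange of positions. The only possible new inversion is the exchanged pair, counted when both
letters lie in one fibre of `π`. Constant `π` gives the length of a permutation; `π = c` gives the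
exponent in `theta`. -/
theorem card_inversions_swap {A : Type*} [LinearOrder A] (π : A → ℕ) {n : ℕ} (w : Fin n → A)
    (i : Fin (n - 1)) (h : w (lo i) < w (hi i)) :
    (inversions π (w ∘ simpleTransposition i)).card =
      (inversions π w).card + if π (w (lo i)) = π (w (hi i)) then 1 else 0 := by
  set s := simpleTransposition i
  set e : Fin n × Fin n ↪ Fin n × Fin n := (Equiv.prodCongr s s).toEmbedding
  have he : ∀ p : Fin n × Fin n, p ∈ (inversions π w).map e ↔ (s p.1, s p.2) ∈ inversions π w := by
    intro p
    simp only [Finset.mem_map]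
    constructor
    · rintro ⟨a, ha, rfl⟩
      simpa [e, s] using ha
    · intro hp
      exact ⟨_, hp, by simp [e, s]⟩
  have hnot : (lo i, hi i) ∉ (inversions π w).map e := by
    rw [he]
    simp [inversions, s, (lo_lt_hi i).le]
  have key : ∀ p : Fin n × Fin n, p ≠ (lo i, hi i) →
      (p ∈ inversions π (w ∘ s) ↔ p ∈ (inversions π w).map e) := by
    rintro ⟨k, l⟩ hp
    rw [he]
    simp only [inversions, Finset.mem_filter, Finset.mem_univ, true_and, Function.comp]
    constructor
    · rintro ⟨h1, h2, h3⟩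
      exact ⟨simpleTransposition_lt i h1 (by simpa using hp), h2, h3⟩
    · rintro ⟨h1, h2, h3⟩
      refine ⟨?_, h2, h3⟩
      have := simpleTransposition_lt i h1 (by
        rintro ⟨h4, h5⟩
        simp only [s] at h2
        rw [h4, h5] at h2
        exact absurd h (not_lt.2 h2.le))
      simpa [s] using this
  split_ifs with hπ
  · have : inversions π (w ∘ s) = insert (lo i, hi i) ((inversions π w).map e) := by
      ext p
      rw [Finset.mem_insert]
      by_cases hp : p = (lo i, hi i)
      · subst hp
        simp [inversions, s, lo_lt_hi, h, hπ]
      · simp [key p hp, hp]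
    rw [this, Finset.card_insert_of_notMem hnot, Finset.card_map]
  · have : inversions π (w ∘ s) = (inversions π w).map e := by
      ext p
      by_cases hp : p = (lo i, hi i)
      · subst hp
        simp only [hnot, iff_false]
        simp [inversions, s, Ne.symm hπ]
      · exact key p hp
    rw [this, Finset.card_map, add_zero]

/-- The inversion number of a permutation. -/
def inv {n : ℕ} (v : Equiv.Perm (Fin n)) : ℕ := (inversions (fun _ => 0) v.symm).card

/-- Permutations act from the right, so appending `s_i` exchanges two values of `v`, that is, two
positions of `v.symm`. This is why lengths and descents are read off `v.symm`. -/
theorem trans_simple_symm {n : ℕ} (v : Equiv.Perm (Fin n)) (i : Fin (n - 1)) :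
    ⇑(v.trans (simpleTransposition i)).symm = v.symm ∘ simpleTransposition i := by
  ext k; simp

theorem trans_simple_simple {n : ℕ} (v : Equiv.Perm (Fin n)) (i : Fin (n - 1)) :
    (v.trans (simpleTransposition i)).trans (simpleTransposition i) = v := by
  ext k; simp

theorem inv_trans_of_lt {n : ℕ} {v : Equiv.Perm (Fin n)} {i : Fin (n - 1)}
    (h : v.symm (lo i) < v.symm (hi i)) : inv (v.trans (simpleTransposition i)) = inv v + 1 := by
  unfold inv
  rw [trans_simple_symm, card_inversions_swap _ _ _ h, if_pos rfl]

theorem inv_trans_of_gt {n : ℕ} {v : Equiv.Perm (Fin n)} {i : Fin (n - 1)}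
    (h : v.symm (hi i) < v.symm (lo i)) :
    inv (v.trans (simpleTransposition i)) + 1 = inv v := by
  rw [← inv_trans_of_lt, trans_simple_simple]
  simpa using h

theorem symm_lt_or_gt {n : ℕ} (v : Equiv.Perm (Fin n)) (i : Fin (n - 1)) :
    v.symm (lo i) < v.symm (hi i) ∨ v.symm (hi i) < v.symm (lo i) :=
  lt_or_gt_of_ne fun h => lo_ne_hi i (v.symm.injective h)

theorem strictMono_of_lo_lt_hi {n : ℕ} {A : Type*} [Preorder A] {f : Fin n → A}
    (h : ∀ i, f (lo i) < f (hi i)) : StrictMono f := by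
  cases n with
  | zero => exact fun a => a.elim0
  | succ n => exact Fin.strictMono_iff_lt_succ.2 fun i => h i

theorem eq_refl_of_lo_lt_hi {n : ℕ} {v : Equiv.Perm (Fin n)}
    (h : ∀ i, v (lo i) < v (hi i)) : v = Equiv.refl _ := by
  have hm := strictMono_of_lo_lt_hi h
  have : (hm.orderIsoOfSurjective v v.surjective) = OrderIso.refl _ := Subsingleton.elim _ _
  ext k
  have := congrArg (fun e : Fin n ≃o Fin n => ((e k : Fin n) : ℕ)) this
  simpa using this

theorem inv_refl {n : ℕ} : inv (Equiv.refl (Fin n)) = 0 := by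
  unfold inv inversions
  rw [Finset.card_eq_zero, Finset.filter_eq_empty_iff]
  rintro p - ⟨h1, h2, -⟩
  exact absurd h1 (not_lt.2 (le_of_lt (by simpa using h2)))

theorem inv_wordPerm_le {n : ℕ} (l : List (Fin (n - 1))) : inv (wordPerm l) ≤ l.length := by
  induction l using List.reverseRecOn with
  | nil => exact inv_refl.le
  | append_singleton l i ih =>
    rw [wordPerm_append_singleton, List.length_append, List.length_singleton]
    rcases symm_lt_or_gt (wordPerm l) i with h | h
    · rw [inv_trans_of_lt h]; omega
    · have := inv_trans_of_gt h; omega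

theorem exists_descent {n : ℕ} {v : Equiv.Perm (Fin n)} (h : v ≠ Equiv.refl _) :
    ∃ i, v.symm (hi i) < v.symm (lo i) := by
  by_contra hc
  push Not at hc
  apply h
  have : v.symm = Equiv.refl _ := eq_refl_of_lo_lt_hi fun i =>
    (symm_lt_or_gt v i).resolve_right (not_lt.2 (hc i))
  rw [← Equiv.symm_symm v, this]; rfl

/-- Induction on permutations, appending simple transpositions that increase the length. -/
theorem perm_induction {n : ℕ} {P : Equiv.Perm (Fin n) → Prop} (h1 : P (Equiv.refl _))
    (h2 : ∀ (v : Equiv.Perm (Fin n)) (i : Fin (n - 1)), v.symm (lo i) < v.symm (hi i) → P v →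
      P (v.trans (simpleTransposition i))) (v : Equiv.Perm (Fin n)) : P v := by
  induction hk : inv v using Nat.strong_induction_on generalizing v with
  | _ k ih =>
    by_cases hv : v = Equiv.refl _
    · exact hv ▸ h1
    · obtain ⟨i, hi'⟩ := exists_descent hv
      have := inv_trans_of_gt hi'
      rw [← trans_simple_simple v i]
      exact h2 _ i (by simpa using hi') (ih _ (by omega) _ rfl)

theorem exists_word_inv {n : ℕ} (v : Equiv.Perm (Fin n)) :
    ∃ l : List (Fin (n - 1)), wordPerm l = v ∧ l.length = inv v := by
  induction v using perm_induction with
  | h1 => exact ⟨[], rfl, inv_refl.symm⟩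
  | h2 v i h ih =>
    obtain ⟨l, rfl, hl⟩ := ih
    exact ⟨l ++ [i], wordPerm_append_singleton l i, by
      rw [inv_trans_of_lt h, ← hl, List.length_append, List.length_singleton]⟩

/-- A letter changes the inversion number by exactly one, so no expression is shorter than `inv v`;
removing descents one at a time produces an expression of that length. -/
theorem permLength_eq_inv {n : ℕ} (v : Equiv.Perm (Fin n)) : permLength v = inv v := by
  apply le_antisymm
  · exact Nat.sInf_le (exists_word_inv v)
  · obtain ⟨l, rfl, hl⟩ := exists_reducedWord v
    rw [← hl]
    exact inv_wordPerm_le l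

/-! ### Coxeter relations and Matsumoto's theorem. -/

theorem simple_comm {n : ℕ} {i j : Fin (n - 1)} (h : (i : ℕ) + 1 < j ∨ (j : ℕ) + 1 < i) :
    (simpleTransposition i).trans (simpleTransposition j) =
      (simpleTransposition j).trans (simpleTransposition i) := by
  have h1 : lo i ≠ lo j := by simp only [lo, ne_eq, Fin.ext_iff]; omega
  have h2 : lo i ≠ hi j := by simp only [lo, hi, ne_eq, Fin.ext_iff]; omega
  have h3 : hi i ≠ lo j := by simp only [lo, hi, ne_eq, Fin.ext_iff]; omega
  have h4 : hi i ≠ hi j := by simp only [hi, ne_eq, Fin.ext_iff]; omega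
  ext k
  simp only [Equiv.trans_apply]
  by_cases k1 : k = lo i
  · rw [k1, simpleTransposition_lo, simpleTransposition_of_ne j h3 h4,
      simpleTransposition_of_ne j h1 h2, simpleTransposition_lo]
  by_cases k2 : k = hi i
  · rw [k2, simpleTransposition_hi, simpleTransposition_of_ne j h1 h2,
      simpleTransposition_of_ne j h3 h4, simpleTransposition_hi]
  rw [simpleTransposition_of_ne i k1 k2, simpleTransposition_of_ne i]
  · intro h; rw [← h] at h1 h2
    have := simpleTransposition_of_ne j h1 h2
    simp only [simpleTransposition_simpleTransposition] at this
    exact k1 (this.trans h)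
  · intro h; rw [← h] at h3 h4
    have := simpleTransposition_of_ne j h3 h4
    simp only [simpleTransposition_simpleTransposition] at this
    exact k2 (this.trans h)

theorem simple_braid {n : ℕ} {i j : Fin (n - 1)} (h : (i : ℕ) + 1 = j) :
    ((simpleTransposition i).trans (simpleTransposition j)).trans (simpleTransposition i) =
    ((simpleTransposition j).trans (simpleTransposition i)).trans (simpleTransposition j) := by
  have hij : lo j = hi i := Fin.ext (by simp [lo, hi, h])
  ext k
  by_cases h1 : k = lo i
  · have h2 : lo i ≠ lo j := by simp [lo, Fin.ext_iff]; omega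
    have h3 : lo i ≠ hi j := by simp [lo, hi, Fin.ext_iff]; omega
    have h4 : hi j ≠ lo i := h3.symm
    have h5 : hi j ≠ hi i := by simp [hi, Fin.ext_iff]; omega
    subst h1
    simp only [Equiv.trans_apply, simpleTransposition_lo, simpleTransposition_of_ne j h2 h3]
    rw [← hij]
    simp only [simpleTransposition_lo]
    rw [simpleTransposition_of_ne i h4 (hij ▸ h5)]
  by_cases h2 : k = hi i
  · have h2' : lo i ≠ lo j := by simp [lo, Fin.ext_iff]; omega
    have h3 : lo i ≠ hi j := by simp [lo, hi, Fin.ext_iff]; omega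
    have h4 : hi j ≠ lo i := h3.symm
    have h5 : hi j ≠ hi i := by simp [hi, Fin.ext_iff]; omega
    subst h2
    simp only [Equiv.trans_apply, simpleTransposition_hi, simpleTransposition_of_ne j h2' h3]
    simp only [simpleTransposition_lo]
    rw [← hij]
    simp only [simpleTransposition_lo]
    rw [simpleTransposition_of_ne i h4 (hij ▸ h5)]
    simp
  by_cases h3 : k = hi j
  · have h4 : hi j ≠ lo i := by simp [lo, hi, Fin.ext_iff]; omega
    have h5 : hi j ≠ hi i := by simp [hi, Fin.ext_iff]; omega
    have h2' : lo i ≠ lo j := by simp [lo, Fin.ext_iff]; omega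
    subst h3
    simp only [Equiv.trans_apply, simpleTransposition_hi, simpleTransposition_of_ne i h4 h5]
    rw [hij]
    simp only [simpleTransposition_hi]
    rw [simpleTransposition_of_ne j h2' (Ne.symm h4)]
  · simp only [Equiv.trans_apply]
    rw [simpleTransposition_of_ne i h1 h2, simpleTransposition_of_ne j (hij ▸ h2) h3,
      simpleTransposition_of_ne i h1 h2, simpleTransposition_of_ne j (hij ▸ h2) h3]

theorem trans_simple_lt_iff {n : ℕ} (v : Equiv.Perm (Fin n)) (i : Fin (n - 1)) (a b : Fin n) :
    (v.trans (simpleTransposition i)).symm a < (v.trans (simpleTransposition i)).symm b ↔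
      v.symm (simpleTransposition i a) < v.symm (simpleTransposition i b) := by
  rw [trans_simple_symm]; rfl

/-- Matsumoto's theorem for the symmetric group. -/
theorem prod_eq_of_wordPerm_eq {n : ℕ} {A : Type*} [Monoid A] (f : Fin (n - 1) → A)
    (hcomm : ∀ i j : Fin (n - 1), (i : ℕ) + 1 < j ∨ (j : ℕ) + 1 < i → f i * f j = f j * f i)
    (hbraid : ∀ i j : Fin (n - 1), (i : ℕ) + 1 = j → f i * f j * f i = f j * f i * f j) :
    ∀ l l' : List (Fin (n - 1)), wordPerm l = wordPerm l' → l.length = inv (wordPerm l) →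
      l'.length = inv (wordPerm l) → (l.map f).prod = (l'.map f).prod := by
  intro l
  induction hN : l.length using Nat.strong_induction_on generalizing l with
  | _ N ih =>
  -- The last letter of a reduced word is a descent, and deleting it leaves a reduced word.
  have descent : ∀ (l : List (Fin (n - 1))) (i : Fin (n - 1)),
      l.length + 1 = inv (wordPerm (l ++ [i])) →
      (wordPerm (l ++ [i])).symm (hi i) < (wordPerm (l ++ [i])).symm (lo i) ∧
      inv (wordPerm l) = l.length := by
    intro l i h
    rw [wordPerm_append_singleton] at h ⊢
    have h1 := inv_wordPerm_le l
    rcases symm_lt_or_gt (wordPerm l) i with h2 | h2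
    · have := inv_trans_of_lt h2
      refine ⟨by simpa using h2, by omega⟩
    · have := inv_trans_of_gt h2
      omega
  intro l' hw hl hl'
  rcases List.eq_nil_or_concat l with rfl | ⟨a, i, rfl⟩
  · have : l' = [] := List.eq_nil_of_length_eq_zero (by rw [hl', ← hl, ← hN]; rfl)
    rw [this]
  rcases List.eq_nil_or_concat l' with rfl | ⟨b, j, rfl⟩
  · have h1 := hl'.trans hl.symm
    rw [← hN] at h1
    simp at h1
  simp only [List.concat_eq_append] at *
  have hlen : (a ++ [i]).length = a.length + 1 := by simp
  have hlen' : (b ++ [j]).length = b.length + 1 := by simp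
  obtain ⟨hdi, hia⟩ := descent a i (by omega)
  obtain ⟨hdj, hjb⟩ := descent b j (by rw [← hw]; omega)
  rw [← hw] at hdj
  set w := wordPerm (a ++ [i]) with hwdef
  have hwa : wordPerm a = w.trans (simpleTransposition i) := by
    rw [hwdef, wordPerm_append_singleton, trans_simple_simple]
  have hwb : wordPerm b = w.trans (simpleTransposition j) := by
    rw [hw, wordPerm_append_singleton, trans_simple_simple]
  have hinva := inv_trans_of_gt hdi
  have hinvb := inv_trans_of_gt hdj
  simp only [List.map_append, List.prod_append, List.map_cons, List.map_nil, List.prod_singleton]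
  -- With descents at the neighbours `i` and `j`, `w` factors with adding lengths as `c s_i s_j s_i
  -- = c s_j s_i s_j`. By induction the two given words may be replaced by `c i j i` and `c j i j`,
  -- which differ by one braid relation.
  have braid_case : ∀ (a b : List (Fin (n - 1))) (i j : Fin (n - 1)), (i : ℕ) + 1 = j →
      a.length + 1 = N → b.length + 1 = N → inv w = N →
      wordPerm a = w.trans (simpleTransposition i) →
      wordPerm b = w.trans (simpleTransposition j) →
      w.symm (hi i) < w.symm (lo i) → w.symm (hi j) < w.symm (lo j) →
      (a.map f).prod * f i = (b.map f).prod * f j := by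
    intro a b i j hij ha hb hN' hwa hwb hdi hdj
    have hlh : lo j = hi i := Fin.ext (by simp [lo, hi, hij])
    have h3 : lo i ≠ hi j := by simp [lo, hi, Fin.ext_iff]; omega
    have h5 : hi j ≠ hi i := by simp [hi, Fin.ext_iff]; omega
    have h6 : lo i ≠ lo j := by simp [lo, Fin.ext_iff]; omega
    have hinva := inv_trans_of_gt hdi
    have hinvb := inv_trans_of_gt hdj
    have d2 : (w.trans (simpleTransposition i)).symm (hi j) <
        (w.trans (simpleTransposition i)).symm (lo j) := by
      rw [trans_simple_lt_iff, hlh, simpleTransposition_hi,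
        simpleTransposition_of_ne i h3.symm h5]
      rw [hlh] at hdj
      exact hdj.trans hdi
    have hinv2 := inv_trans_of_gt d2
    have d3 : ((w.trans (simpleTransposition i)).trans (simpleTransposition j)).symm (hi i) <
        ((w.trans (simpleTransposition i)).trans (simpleTransposition j)).symm (lo i) := by
      rw [trans_simple_lt_iff, trans_simple_lt_iff, ← hlh, simpleTransposition_lo,
        simpleTransposition_of_ne j h6 h3, simpleTransposition_lo,
        simpleTransposition_of_ne i h3.symm h5, ← hlh]
      exact hdj
    have hinv3 := inv_trans_of_gt d3
    obtain ⟨c, hc, hc'⟩ := exists_word_inv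
      (((w.trans (simpleTransposition i)).trans (simpleTransposition j)).trans
        (simpleTransposition i))
    have e1 : wordPerm (c ++ [i] ++ [j]) = w.trans (simpleTransposition i) := by
      rw [wordPerm_append_singleton, wordPerm_append_singleton, hc, trans_simple_simple,
        trans_simple_simple]
    have e2 : wordPerm (c ++ [j] ++ [i]) = w.trans (simpleTransposition j) := by
      rw [wordPerm_append_singleton, wordPerm_append_singleton, hc]
      have := congrArg (fun x => w.trans x) (simple_braid hij)
      simp only [← Equiv.trans_assoc] at this
      rw [this, trans_simple_simple, trans_simple_simple]
    have l1 : (c ++ [i] ++ [j]).length = c.length + 2 := by simp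
    have l2 : (c ++ [j] ++ [i]).length = c.length + 2 := by simp
    have p1 := ih a.length (by omega) a rfl (c ++ [i] ++ [j]) (by rw [hwa, e1])
      (by rw [hwa]; omega) (by rw [hwa]; omega)
    have p2 := ih b.length (by omega) b rfl (c ++ [j] ++ [i]) (by rw [hwb, e2])
      (by rw [hwb]; omega) (by rw [hwb]; omega)
    rw [p1, p2]
    simp only [List.map_append, List.prod_append, List.map_cons, List.map_nil,
      List.prod_singleton]
    have := hbraid i j hij
    rw [mul_assoc, mul_assoc, ← mul_assoc (f i), this]
    simp only [mul_assoc]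
  have hNa : a.length + 1 = N := by omega
  have hNb : b.length + 1 = N := by omega
  have hNw : inv w = N := by omega
  by_cases hij : i = j
  · subst hij
    rw [ih a.length (by omega) a rfl b (by rw [hwa, hwb]) hia.symm (by rw [hwa]; omega)]
  have hij' : (i : ℕ) ≠ j := fun h => hij (Fin.ext h)
  by_cases h1 : (i : ℕ) + 1 = j
  · exact braid_case a b i j h1 hNa hNb hNw hwa hwb hdi hdj
  by_cases h2 : (j : ℕ) + 1 = i
  · exact (braid_case b a j i h2 hNb hNa hNw hwb hwa hdj hdi).symm
  -- Two distant descents give `w = c s_j s_i = c s_i s_j`, and a commutation relation connects the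
  -- two words.
  have hfar : (i : ℕ) + 1 < j ∨ (j : ℕ) + 1 < i := by omega
  have d2 : (w.trans (simpleTransposition i)).symm (hi j) <
      (w.trans (simpleTransposition i)).symm (lo j) := by
    rw [trans_simple_lt_iff, simpleTransposition_of_ne i, simpleTransposition_of_ne i]
    · exact hdj
    all_goals simp only [lo, hi, ne_eq, Fin.ext_iff]; omega
  have hinv2 := inv_trans_of_gt d2
  obtain ⟨c, hc, hc'⟩ := exists_word_inv
    ((w.trans (simpleTransposition i)).trans (simpleTransposition j))
  have e1 : wordPerm (c ++ [j]) = w.trans (simpleTransposition i) := by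
    rw [wordPerm_append_singleton, hc, trans_simple_simple]
  have e2 : wordPerm (c ++ [i]) = w.trans (simpleTransposition j) := by
    rw [wordPerm_append_singleton, hc, Equiv.trans_assoc, ← simple_comm hfar, ← Equiv.trans_assoc,
      trans_simple_simple]
  have p1 := ih a.length (by omega) a rfl (c ++ [j]) (by rw [hwa, e1])
    (by rw [hwa]; omega) (by simp only [List.length_append, List.length_singleton]; rw [hwa]; omega)
  have p2 := ih b.length (by omega) b rfl (c ++ [i]) (by rw [hwb, e2])
    (by rw [hwb]; omega) (by simp only [List.length_append, List.length_singleton]; rw [hwb]; omega)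
  rw [p1, p2]
  simp only [List.map_append, List.prod_append, List.map_cons, List.map_nil, List.prod_singleton,
    mul_assoc]
  rw [hcomm i j hfar]

/-! ## The standard basis elements of the Hecke algebra -/

namespace Hecke

variable {R : Type*} [CommRing R] (q : Rˣ) {n : ℕ}

/-- By Matsumoto's theorem the choice of reduced word hidden in `T` is immaterial. -/
theorem T_wordPerm {l : List (Fin (n - 1))} (h : l.length = inv (wordPerm l)) :
    T q (wordPerm l) = (l.map (gen q)).prod := by
  have hs := (exists_reducedWord (wordPerm l)).choose_spec
  exact prod_eq_of_wordPerm_eq (gen q) (gen_comm q) (gen_braid q) (reducedWord (wordPerm l)) l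
    hs.1 (by rw [← permLength_eq_inv]; exact hs.2.trans (by
      congr 1; exact hs.1.symm)) (by rw [h]; congr 1; exact hs.1.symm)

theorem T_refl : T q (Equiv.refl (Fin n)) = 1 :=
  T_wordPerm q (l := []) inv_refl.symm

theorem T_mul_gen_of_lt {v : Equiv.Perm (Fin n)} {i : Fin (n - 1)}
    (h : v.symm (lo i) < v.symm (hi i)) :
    T q v * gen q i = T q (v.trans (simpleTransposition i)) := by
  obtain ⟨l, rfl, hl⟩ := exists_word_inv v
  rw [T_wordPerm q hl, ← wordPerm_append_singleton, T_wordPerm q]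
  · simp
  · rw [wordPerm_append_singleton, inv_trans_of_lt h, ← hl]; simp

theorem gen_mul_gen (i : Fin (n - 1)) :
    gen q i * gen q i = ((q : R) - ((q⁻¹ : Rˣ) : R)) • gen q i + 1 := by
  have h := gen_quad q i
  simp only [Algebra.algebraMap_eq_smul_one] at h
  rw [sub_mul, mul_add, mul_add] at h
  simp only [smul_mul_assoc, mul_smul_comm, one_mul, mul_one, smul_smul, Units.inv_mul,
    one_smul] at h
  rw [sub_smul, ← sub_eq_zero, ← h]
  abel

theorem T_mul_gen_of_gt {v : Equiv.Perm (Fin n)} {i : Fin (n - 1)}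
    (h : v.symm (hi i) < v.symm (lo i)) :
    T q v * gen q i = T q (v.trans (simpleTransposition i)) +
      ((q : R) - ((q⁻¹ : Rˣ) : R)) • T q v := by
  have h' : (v.trans (simpleTransposition i)).symm (lo i) <
      (v.trans (simpleTransposition i)).symm (hi i) := by simpa using h
  have h1 := T_mul_gen_of_lt q h'
  rw [trans_simple_simple] at h1
  rw [← h1, mul_assoc, gen_mul_gen, mul_add, mul_smul_comm, mul_one, add_comm]

@[elab_as_elim]
theorem induction_gen {P : Hecke q n → Prop} (h1 : ∀ r : R, P (algebraMap R _ r))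
    (hgen : ∀ i, P (gen q i)) (hadd : ∀ a b, P a → P b → P (a + b))
    (hmul : ∀ a b, P a → P b → P (a * b)) (x : Hecke q n) : P x := by
  obtain ⟨y, rfl⟩ := RingQuot.mkAlgHom_surjective R (HeckeRel q n) x
  induction y using FreeAlgebra.induction with
  | grade0 r => rw [AlgHom.commutes]; exact h1 r
  | grade1 i => exact hgen i
  | add a b ha hb => rw [map_add]; exact hadd _ _ ha hb
  | mul a b ha hb => rw [map_mul]; exact hmul _ _ ha hb

theorem span_T : Submodule.span R (Set.range (T q (n := n))) = ⊤ := by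
  rw [eq_top_iff]
  have key : ∀ a : Hecke q n, ∀ x ∈ Submodule.span R (Set.range (T q (n := n))),
      x * a ∈ Submodule.span R (Set.range (T q (n := n))) := by
    intro a
    induction a using induction_gen with
    | h1 r =>
      intro x hx
      rw [← Algebra.commutes, ← Algebra.smul_def]
      exact Submodule.smul_mem _ _ hx
    | hgen i =>
      intro x hx
      induction hx using Submodule.span_induction with
      | zero => simp
      | add x y _ _ hx hy => rw [add_mul]; exact add_mem hx hy
      | smul r x _ hx => rw [smul_mul_assoc]; exact Submodule.smul_mem _ _ hx
      | mem x hx =>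
        obtain ⟨v, rfl⟩ := hx
        rcases symm_lt_or_gt v i with h | h
        · rw [T_mul_gen_of_lt q h]; exact Submodule.subset_span ⟨_, rfl⟩
        · rw [T_mul_gen_of_gt q h]
          exact add_mem (Submodule.subset_span ⟨_, rfl⟩)
            (Submodule.smul_mem _ _ (Submodule.subset_span ⟨_, rfl⟩))
    | hadd a b ha hb => intro x hx; rw [mul_add]; exact add_mem (ha x hx) (hb x hx)
    | hmul a b ha hb => intro x hx; rw [← mul_assoc]; exact hb _ (ha x hx)
  intro x _
  have := key x 1 (Submodule.subset_span ⟨Equiv.refl _, T_refl q⟩)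
  rwa [one_mul] at this

/-- The involution `*`, as a linear map. -/
def st : Hecke q n →ₗ[R] Hecke q n where
  toFun x := (star q n x).unop
  map_add' x y := by simp
  map_smul' r x := by simp

theorem st_apply (x : Hecke q n) : st q x = (star q n x).unop := rfl

@[simp] theorem st_mul (x y : Hecke q n) : st q (x * y) = st q y * st q x := by
  simp [st_apply]

@[simp] theorem st_one : st q (1 : Hecke q n) = 1 := by simp [st_apply]

@[simp] theorem st_gen (i : Fin (n - 1)) : st q (gen q i) = gen q i := by
  rw [st_apply, star, lift_gen]; rfl

theorem st_algebraMap (r : R) : st q (algebraMap R (Hecke q n) r) = algebraMap R _ r := by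
  rw [st_apply, AlgHom.commutes]; rfl

@[simp] theorem st_st (x : Hecke q n) : st q (st q x) = x := by
  induction x using induction_gen with
  | h1 r => rw [st_algebraMap, st_algebraMap]
  | hgen i => simp
  | hadd a b ha hb => rw [map_add, map_add, ha, hb]
  | hmul a b ha hb => rw [st_mul, st_mul, ha, hb]

end Hecke

theorem wordPerm_reverse {n : ℕ} (l : List (Fin (n - 1))) :
    wordPerm l.reverse = (wordPerm l).symm := by
  induction l with
  | nil => rfl
  | cons i l ih =>
    rw [List.reverse_cons, wordPerm_append_singleton, ih, wordPerm]
    ext k; simp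

theorem inv_symm {n : ℕ} (v : Equiv.Perm (Fin n)) : inv v.symm = inv v := by
  have key : ∀ v : Equiv.Perm (Fin n), inv v.symm ≤ inv v := by
    intro v
    obtain ⟨l, rfl, hl⟩ := exists_word_inv v
    rw [← wordPerm_reverse, ← hl, ← List.length_reverse]
    exact inv_wordPerm_le _
  exact le_antisymm (key v) (key v.symm)

theorem Hecke.st_T {R : Type*} [CommRing R] (q : Rˣ) {n : ℕ} (v : Equiv.Perm (Fin n)) :
    st q (T q v) = T q v.symm := by
  obtain ⟨l, rfl, hl⟩ := exists_word_inv v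
  rw [← wordPerm_reverse, T_wordPerm q hl, T_wordPerm q]
  · clear hl
    induction l with
    | nil => simp
    | cons i l ih => simp [ih]
  · rw [wordPerm_reverse, inv_symm, List.length_reverse, hl]

end HeckeCell

end


noncomputable section

namespace HeckeCell

/-! ## The Hecke algebra acting on words -/

theorem comp_simple_of_eq {n : ℕ} {A : Type*} {w : Fin n → A} {i : Fin (n - 1)}
    (h : w (lo i) = w (hi i)) : w ∘ simpleTransposition i = w := by
  ext k
  by_cases h1 : k = lo i
  · simp [h1, h]
  by_cases h2 : k = hi i
  · simp [h2, h]
  simp [simpleTransposition_of_ne i h1 h2]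

theorem comp_simple_simple {n : ℕ} {A : Type*} (w : Fin n → A) (i : Fin (n - 1)) :
    (w ∘ simpleTransposition i) ∘ simpleTransposition i = w := by
  ext k; simp

/-- The free module on words of length `n` in the letters `0, 1, 2, …`. -/
abbrev Words (R : Type*) [CommRing R] (n : ℕ) : Type _ := (Fin n → ℕ) →₀ R

section Words

variable {R : Type*} [CommRing R] (q : Rˣ) {n : ℕ}

variable (R) in
/-- The basis element of the module of words given by the word `w`. -/
abbrev word (w : Fin n → ℕ) : Words R n := Finsupp.single w 1

theorem Words.hom_ext {M : Type*} [AddCommMonoid M] [Module R M] {f g : Words R n →ₗ[R] M}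
    (h : ∀ w, f (word R w) = g (word R w)) : f = g :=
  Finsupp.lhom_ext' fun w => LinearMap.ext_ring (h w)

/-- Right multiplication by `T_i` on words. -/
def opT (i : Fin (n - 1)) : Words R n →ₗ[R] Words R n :=
  Finsupp.linearCombination R fun w =>
    if w (lo i) < w (hi i) then word R (w ∘ simpleTransposition i)
    else if w (lo i) = w (hi i) then (q : R) • word R w
    else word R (w ∘ simpleTransposition i) + ((q : R) - ((q⁻¹ : Rˣ) : R)) • word R w

theorem opT_lt {i : Fin (n - 1)} {w : Fin n → ℕ} (h : w (lo i) < w (hi i)) :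
    opT q i (word R w) = word R (w ∘ simpleTransposition i) := by
  simp [opT, h]

theorem opT_eq {i : Fin (n - 1)} {w : Fin n → ℕ} (h : w (lo i) = w (hi i)) :
    opT q i (word R w) = (q : R) • word R w := by
  simp [opT, h]

theorem opT_gt {i : Fin (n - 1)} {w : Fin n → ℕ} (h : w (hi i) < w (lo i)) :
    opT q i (word R w) =
      word R (w ∘ simpleTransposition i) + ((q : R) - ((q⁻¹ : Rˣ) : R)) • word R w := by
  simp [opT, h.not_gt, h.ne']

theorem mul_self_eq : (q : R) * q = ((q : R) - ((q⁻¹ : Rˣ) : R)) * q + 1 := by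
  rw [sub_mul, Units.inv_mul]; ring

theorem opT_opT (i : Fin (n - 1)) (x : Words R n) :
    opT q i (opT q i x) = ((q : R) - ((q⁻¹ : Rˣ) : R)) • opT q i x + x := by
  suffices h : opT q i ∘ₗ opT q i = ((q : R) - ((q⁻¹ : Rˣ) : R)) • opT q i + LinearMap.id from
    LinearMap.congr_fun h x
  apply Words.hom_ext
  intro w
  simp only [LinearMap.comp_apply, LinearMap.add_apply, LinearMap.smul_apply, LinearMap.id_apply]
  rcases lt_trichotomy (w (lo i)) (w (hi i)) with h | h | h
  · rw [opT_lt q h, opT_gt, comp_simple_simple, add_comm]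
    simpa using h
  · rw [opT_eq q h, map_smul, opT_eq q h, smul_smul, smul_smul, mul_self_eq, add_smul, one_smul]
  · rw [opT_gt q h, map_add, map_smul, opT_lt q (w := w ∘ simpleTransposition i),
      comp_simple_simple, opT_gt q h, add_comm]
    simpa using h

theorem opT_comm {i j : Fin (n - 1)} (h : (i : ℕ) + 1 < j ∨ (j : ℕ) + 1 < i) (x : Words R n) :
    opT q i (opT q j x) = opT q j (opT q i x) := by
  suffices h : opT q i ∘ₗ opT q j = opT q j ∘ₗ opT q i from LinearMap.congr_fun h x
  have h1 : lo i ≠ lo j := by simp only [lo, ne_eq, Fin.ext_iff]; omega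
  have h2 : lo i ≠ hi j := by simp only [lo, hi, ne_eq, Fin.ext_iff]; omega
  have h3 : hi i ≠ lo j := by simp only [lo, hi, ne_eq, Fin.ext_iff]; omega
  have h4 : hi i ≠ hi j := by simp only [hi, ne_eq, Fin.ext_iff]; omega
  apply Words.hom_ext
  intro w
  have a1 := simpleTransposition_of_ne j h1 h2
  have a2 := simpleTransposition_of_ne j h3 h4
  have a3 := simpleTransposition_of_ne i h1.symm h3.symm
  have a4 := simpleTransposition_of_ne i h2.symm h4.symm
  have hc : (w ∘ simpleTransposition i) ∘ simpleTransposition j =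
      (w ∘ simpleTransposition j) ∘ simpleTransposition i := by
    have := congrArg (fun e : Equiv.Perm (Fin n) => w ∘ e) (simple_comm h)
    simp only [Equiv.coe_trans] at this
    exact this.symm
  simp only [LinearMap.comp_apply]
  rcases lt_trichotomy (w (lo i)) (w (hi i)) with h5 | h5 | h5 <;>
  rcases lt_trichotomy (w (lo j)) (w (hi j)) with h6 | h6 | h6 <;>
  simp only [opT, Finsupp.linearCombination_single, one_smul, h5, h6, if_true, if_false,
    lt_irrefl, not_lt_of_gt, ne_of_gt, map_add, map_smul, Function.comp_apply, a1, a2, a3, a4,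
    hc] <;> module

theorem opT_braid {i j : Fin (n - 1)} (h : (i : ℕ) + 1 = j) (x : Words R n) :
    opT q i (opT q j (opT q i x)) = opT q j (opT q i (opT q j x)) := by
  suffices h : opT q i ∘ₗ opT q j ∘ₗ opT q i = opT q j ∘ₗ opT q i ∘ₗ opT q j from
    LinearMap.congr_fun h x
  have hij : lo j = hi i := Fin.ext (by simp [lo, hi, h])
  have h1 : lo i ≠ lo j := by simp only [lo, ne_eq, Fin.ext_iff]; omega
  have h2 : lo i ≠ hi j := by simp only [lo, hi, ne_eq, Fin.ext_iff]; omega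
  have h4 : hi j ≠ hi i := by simp only [hi, ne_eq, Fin.ext_iff]; omega
  have a1 := simpleTransposition_of_ne j h1 h2
  have a2 := simpleTransposition_of_ne i h2.symm h4
  have a3 : simpleTransposition j (hi i) = hi j := by rw [← hij]; simp
  apply Words.hom_ext
  intro w
  have hc : ((w ∘ simpleTransposition i) ∘ simpleTransposition j) ∘ simpleTransposition i =
      ((w ∘ simpleTransposition j) ∘ simpleTransposition i) ∘ simpleTransposition j := by
    have := congrArg (fun e : Equiv.Perm (Fin n) => w ∘ e) (simple_braid h)
    simp only [Equiv.coe_trans] at this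
    exact this
  have hq := mul_self_eq q
  simp only [LinearMap.comp_apply]
  rcases lt_trichotomy (w (lo i)) (w (hi i)) with h5 | h5 | h5 <;>
  rcases lt_trichotomy (w (hi i)) (w (hi j)) with h6 | h6 | h6 <;>
  rcases lt_trichotomy (w (lo i)) (w (hi j)) with h7 | h7 | h7 <;>
  -- Of the 27 sign patterns the inconsistent ones fall to `omega`. The others are identities
  -- between coefficients, which hold modulo `q² = (q - q⁻¹) q + 1`.
  first
  | omega
  | simp only [opT, Finsupp.linearCombination_single, one_smul, h5, h6, h7, if_true, if_false,
      lt_irrefl, not_lt_of_gt, ne_of_gt, ne_of_lt, map_add, map_smul, Function.comp_apply, a1, a2,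
      a3, hij, simpleTransposition_lo, simpleTransposition_hi, hc, comp_simple_simple] <;>
    match_scalars <;> (generalize (q : R) - ((q⁻¹ : Rˣ) : R) = c at hq ⊢) <;>
    first | ring1 | linear_combination c * hq | linear_combination - c * hq

variable (R n) in
/-- The right action of the Hecke algebra on words. -/
def act : Hecke q n →ₐ[R] (Module.End R (Words R n))ᵐᵒᵖ :=
  Hecke.lift q (fun i => MulOpposite.op (opT q i))
    (fun i j h => MulOpposite.unop_injective (LinearMap.ext fun x => (opT_comm q h x).symm))
    (fun i j h => MulOpposite.unop_injective (LinearMap.ext fun x => opT_braid q h x))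
    (fun i => MulOpposite.unop_injective (LinearMap.ext fun x => by
      have := opT_opT q i x
      simp only [MulOpposite.unop_mul, MulOpposite.unop_add, MulOpposite.unop_sub,
        MulOpposite.unop_op, MulOpposite.algebraMap_apply, Module.End.mul_apply,
        LinearMap.add_apply, LinearMap.sub_apply, Module.algebraMap_end_apply, map_sub, map_smul,
        this, MulOpposite.unop_zero, LinearMap.zero_apply]
      match_scalars <;> first | ring1 | linear_combination -q.mul_inv))

/-- Right multiplication of words by an element of the Hecke algebra. -/
def rmul (h : Hecke q n) : Words R n →ₗ[R] Words R n := (act R q n h).unop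

theorem rmul_gen (i : Fin (n - 1)) : rmul q (Hecke.gen q i) = opT q i := by
  rw [rmul, act, Hecke.lift_gen]; rfl

theorem rmul_mul (a b : Hecke q n) (x : Words R n) :
    rmul q (a * b) x = rmul q b (rmul q a x) := by
  simp [rmul]

theorem rmul_one (x : Words R n) : rmul q 1 x = x := by simp [rmul]

theorem rmul_add (a b : Hecke q n) (x : Words R n) :
    rmul q (a + b) x = rmul q a x + rmul q b x := by simp [rmul]

theorem rmul_smul (r : R) (a : Hecke q n) (x : Words R n) :
    rmul q (r • a) x = r • rmul q a x := by simp [rmul]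

theorem rmul_algebraMap (r : R) (x : Words R n) :
    rmul q (algebraMap R (Hecke q n) r) x = r • x := by
  rw [Algebra.algebraMap_eq_smul_one, rmul_smul, rmul_one]

/-- `f` is increasing on the fibres of `c`. -/
def IncrOn {n : ℕ} (c : Fin n → ℕ) (f : Fin n → Fin n) : Prop :=
  ∀ a b, a < b → c a = c b → f a < f b

/-- For monotone `c` the fibres are intervals, and `a ↦ (c a, f a)` is lexicographically increasing
as soon as it is so on neighbours. -/
theorem incrOn_of_adjacent {n : ℕ} {c : Fin n → ℕ} (hc : Monotone c) {f : Fin n → Fin n}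
    (h : ∀ i, c (lo i) = c (hi i) → f (lo i) < f (hi i)) : IncrOn c f := by
  have hm : StrictMono fun a => toLex (c a, f a) := strictMono_of_lo_lt_hi fun i => by
    rw [Prod.Lex.toLex_lt_toLex]
    rcases (hc (lo_lt_hi i).le).lt_or_eq with h1 | h1
    · exact Or.inl h1
    · exact Or.inr ⟨h1, h i h1⟩
  intro a b hab hcab
  have := hm hab
  rw [Prod.Lex.toLex_lt_toLex] at this
  rcases this with h1 | h1
  · exact absurd hcab h1.ne
  · exact h1.2

/-- A permutation increasing on the fibres of `c` is the shortest in its coset of the stabilizer.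
Along a reduced word each generator then meets two letters in strictly increasing order, where `opT`
merely permutes places. -/
theorem rmul_T_word {c : Fin n → ℕ} (hc : Monotone c) (v : Equiv.Perm (Fin n))
    (hv : IncrOn c v) : rmul q (Hecke.T q v) (word R c) = word R (c ∘ v.symm) := by
  induction v using perm_induction with
  | h1 => rw [Hecke.T_refl, rmul_one]; rfl
  | h2 v i h ih =>
    have hv' : IncrOn c v := by
      intro a b hab hcab
      have h1 := simpleTransposition_lt i (hv a b hab hcab) (by
        simp only [Equiv.trans_apply]
        rintro ⟨h1, h2⟩
        have e1 : v a = hi i := by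
          rw [← simpleTransposition_simpleTransposition i (v a), h1, simpleTransposition_lo]
        have e2 : v b = lo i := by
          rw [← simpleTransposition_simpleTransposition i (v b), h2, simpleTransposition_hi]
        rw [← e1, ← e2, Equiv.symm_apply_apply, Equiv.symm_apply_apply] at h
        exact absurd h hab.not_gt)
      simpa using h1
    have hlt : c (v.symm (lo i)) < c (v.symm (hi i)) := by
      refine lt_of_le_of_ne (hc h.le) fun heq => ?_
      have := hv _ _ h heq
      simp at this
      exact absurd this (lo_lt_hi i).not_gt
    rw [← Hecke.T_mul_gen_of_lt q h, rmul_mul, ih hv', rmul_gen, opT_lt q (by exact hlt),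
      trans_simple_symm]
    rfl

/-- The elements `T_v` form a basis of the Hecke algebra. -/
def TBasis : Module.Basis (Equiv.Perm (Fin n)) R (Hecke q n) :=
  Module.Basis.mk (v := Hecke.T q (n := n)) (by
    -- On the word `0 1 ⋯ n-1` with distinct letters, different `T_v` produce different words; this
    -- detects linear independence.
    let L : Hecke q n →ₗ[R] Words R n :=
      { toFun := fun h => rmul q h (word R fun k => (k : ℕ))
        map_add' := fun a b => rmul_add q a b _
        map_smul' := fun r a => rmul_smul q r a _ }
    apply LinearIndependent.of_comp L
    have : (L ∘ Hecke.T q : Equiv.Perm (Fin n) → Words R n) =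
        (fun w => Finsupp.single w 1) ∘ fun v : Equiv.Perm (Fin n) => fun k => (v.symm k : ℕ) := by
      ext1 v
      exact rmul_T_word q (fun a b h => h) v fun a b hab h => absurd (Fin.ext h) hab.ne
    rw [this]
    refine (Finsupp.linearIndependent_single_one R (Fin n → ℕ)).comp _ fun v v' h => ?_
    have : v.symm = v'.symm := Equiv.ext fun k => Fin.ext (congrFun h k)
    rw [← Equiv.symm_symm v, this, Equiv.symm_symm]) (Hecke.span_T q).ge

theorem TBasis_apply (v : Equiv.Perm (Fin n)) : TBasis q v = Hecke.T q v := by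
  simp [TBasis]

/-! ## Embedding permutation modules in the Hecke algebra -/

open Classical in
/-- The homomorphism from words to the Hecke algebra that maps the monotone word `c` to the
symmetrizer of its stabilizer. -/
def theta (c : Fin n → ℕ) : Words R n →ₗ[R] Hecke q n :=
  Finsupp.linearCombination R fun w => ∑ v : Equiv.Perm (Fin n) with c ∘ v.symm = w,
    ((q : R) ^ (inversions c v.symm).card) • Hecke.T q v

open Classical in
theorem theta_word (c w : Fin n → ℕ) : theta q c (word R w) =
    ∑ v : Equiv.Perm (Fin n) with c ∘ v.symm = w,
      ((q : R) ^ (inversions c v.symm).card) • Hecke.T q v := by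
  simp [theta]

/-- Right multiplication by `s_i` is a bijection between the two cosets. It raises lengths, because
`c` is monotone, and it leaves the exponent alone, because the exchanged letters lie in different
fibres. -/
theorem theta_opT_of_lt {c : Fin n → ℕ} (hc : Monotone c) {i : Fin (n - 1)} {w : Fin n → ℕ}
    (h : w (lo i) < w (hi i)) :
    theta q c (word R (w ∘ simpleTransposition i)) = theta q c (word R w) * Hecke.gen q i := by
  classical
  rw [theta_word, theta_word, Finset.sum_mul]
  symm
  refine Finset.sum_bij' (fun v _ => v.trans (simpleTransposition i))
    (fun v _ => v.trans (simpleTransposition i)) ?_ ?_ ?_ ?_ ?_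
  · intro v hv
    simp only [Finset.mem_filter, Finset.mem_univ, true_and] at hv ⊢
    rw [trans_simple_symm, ← hv]; rfl
  · intro v hv
    simp only [Finset.mem_filter, Finset.mem_univ, true_and] at hv ⊢
    rw [trans_simple_symm, ← Function.comp_assoc, hv, comp_simple_simple]
  · intro v _; exact trans_simple_simple v i
  · intro v _; exact trans_simple_simple v i
  · intro v hv
    simp only [Finset.mem_filter, Finset.mem_univ, true_and] at hv
    have h1 : c (v.symm (lo i)) < c (v.symm (hi i)) := by rw [← hv] at h; exact h
    have h2 : v.symm (lo i) < v.symm (hi i) := hc.reflect_lt h1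
    rw [smul_mul_assoc, Hecke.T_mul_gen_of_lt q h2, trans_simple_symm,
      card_inversions_swap _ _ _ h2, if_neg h1.ne, add_zero]

/-- Here the coset is stable under `v ↦ v s_i`. Pairing `v` with `v s_i` makes `1 + q T_i` a right
factor of the sum, and `(1 + q T_i) T_i = q (1 + q T_i)`. -/
theorem theta_opT_of_eq {c : Fin n → ℕ} {i : Fin (n - 1)} {w : Fin n → ℕ}
    (h : w (lo i) = w (hi i)) :
    theta q c (word R w) * Hecke.gen q i = (q : R) • theta q c (word R w) := by
  classical
  have key : theta q c (word R w) =
      (∑ v : Equiv.Perm (Fin n) with c ∘ v.symm = w ∧ v.symm (lo i) < v.symm (hi i),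
        ((q : R) ^ (inversions c v.symm).card) • Hecke.T q v) *
          (1 + (q : R) • Hecke.gen q i) := by
    rw [theta_word, mul_add, mul_one, ← Finset.sum_filter_add_sum_filter_not _
      (fun v : Equiv.Perm (Fin n) => v.symm (lo i) < v.symm (hi i)), Finset.filter_filter,
      Finset.filter_filter]
    congr 1
    rw [Finset.sum_mul]
    refine Finset.sum_bij' (fun v _ => v.trans (simpleTransposition i))
      (fun v _ => v.trans (simpleTransposition i)) ?_ ?_ ?_ ?_ ?_
    · intro v hv
      simp only [Finset.mem_filter, Finset.mem_univ, true_and] at hv ⊢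
      rw [trans_simple_symm, ← Function.comp_assoc, hv.1, comp_simple_of_eq h]
      exact ⟨rfl, by simpa using (symm_lt_or_gt v i).resolve_left hv.2⟩
    · intro v hv
      simp only [Finset.mem_filter, Finset.mem_univ, true_and] at hv ⊢
      rw [trans_simple_symm, ← Function.comp_assoc, hv.1, comp_simple_of_eq h]
      exact ⟨rfl, by simpa using hv.2.le⟩
    · intro v _; exact trans_simple_simple v i
    · intro v _; exact trans_simple_simple v i
    · intro v hv
      simp only [Finset.mem_filter, Finset.mem_univ, true_and] at hv
      have h2 : v.symm (hi i) < v.symm (lo i) := (symm_lt_or_gt v i).resolve_left hv.2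
      have h3 : (v.trans (simpleTransposition i)).symm (lo i) <
        (v.trans (simpleTransposition i)).symm (hi i) := by simpa using h2
      have h1 : c ((v.trans (simpleTransposition i)).symm (lo i)) =
          c ((v.trans (simpleTransposition i)).symm (hi i)) := by
        have e1 := congrFun hv.1 (lo i)
        have e2 := congrFun hv.1 (hi i)
        simp only [Function.comp_apply] at e1 e2
        simp [e1, e2, h]
      have h4 := card_inversions_swap c _ i h3
      rw [if_pos h1, ← trans_simple_symm, trans_simple_simple] at h4
      rw [h4, smul_mul_assoc, mul_smul_comm, Hecke.T_mul_gen_of_lt q h3, trans_simple_simple,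
        smul_smul, pow_succ]
  rw [key, mul_assoc, ← mul_smul_comm]
  congr 1
  rw [add_mul, one_mul, smul_mul_assoc, Hecke.gen_mul_gen, smul_add, smul_smul, smul_add,
    smul_smul]
  have := mul_self_eq q
  rw [this]
  module

theorem theta_opT {c : Fin n → ℕ} (hc : Monotone c) (i : Fin (n - 1)) (x : Words R n) :
    theta q c (opT q i x) = theta q c x * Hecke.gen q i := by
  suffices h : theta q c ∘ₗ opT q i = LinearMap.mulRight R (Hecke.gen q i) ∘ₗ theta q c from
    LinearMap.congr_fun h x
  apply Words.hom_ext
  intro w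
  simp only [LinearMap.comp_apply, LinearMap.mulRight_apply]
  rcases lt_trichotomy (w (lo i)) (w (hi i)) with h | h | h
  · rw [opT_lt q h, theta_opT_of_lt q hc h]
  · rw [opT_eq q h, map_smul, theta_opT_of_eq q h]
  · have h' : (w ∘ simpleTransposition i) (lo i) < (w ∘ simpleTransposition i) (hi i) := by
      simpa using h
    have h1 := theta_opT_of_lt q hc h'
    rw [comp_simple_simple] at h1
    rw [opT_gt q h, map_add, map_smul, h1, mul_assoc, Hecke.gen_mul_gen, mul_add, mul_one,
      mul_smul_comm, add_comm]

theorem theta_rmul {c : Fin n → ℕ} (hc : Monotone c) (h : Hecke q n) (x : Words R n) :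
    theta q c (rmul q h x) = theta q c x * h := by
  induction h using Hecke.induction_gen generalizing x with
  | h1 r => rw [rmul_algebraMap, map_smul, ← Algebra.commutes, Algebra.smul_def]
  | hgen i => rw [rmul_gen, theta_opT q hc]
  | hadd a b ha hb => rw [rmul_add, map_add, ha, hb, mul_add]
  | hmul a b ha hb => rw [rmul_mul, hb, ha, mul_assoc]

/-! ## Symmetrizers -/

open Classical in
/-- The symmetrizer of the stabilizer of `c`. -/
def symmetrizer (c : Fin n → ℕ) : Hecke q n :=
  ∑ v ∈ Finset.univ.filter fun v : Equiv.Perm (Fin n) => c ∘ v = c, ((q : R) ^ inv v) • Hecke.T q v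

theorem comp_symm_eq_self {A : Type*} {c : Fin n → A} {v : Equiv.Perm (Fin n)} :
    c ∘ v.symm = c ↔ c ∘ v = c := by
  constructor <;> intro h <;> funext k
  · have := congrFun h (v k); simpa using this.symm
  · have := congrFun h (v.symm k); simpa using this.symm

/-- For `v` in the stabilizer of a monotone word all inversions occur inside fibres, so the exponent
in `theta` is the full length. -/
theorem theta_self {c : Fin n → ℕ} (hc : Monotone c) :
    theta q c (word R c) = symmetrizer q c := by
  classical
  rw [theta_word, symmetrizer]
  refine Finset.sum_congr (Finset.filter_congr fun v _ => comp_symm_eq_self) fun v hv => ?_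
  simp only [Finset.mem_filter, Finset.mem_univ, true_and] at hv
  congr 2
  unfold inv inversions
  congr 1
  refine Finset.filter_congr fun p _ => ?_
  have hs : ∀ k, c (v.symm k) = c k := fun k => congrFun (comp_symm_eq_self.2 hv) k
  constructor
  · rintro ⟨h1, h2, -⟩; exact ⟨h1, h2, rfl⟩
  · rintro ⟨h1, h2, -⟩
    refine ⟨h1, h2, le_antisymm ?_ (hc h2.le)⟩
    rw [hs, hs]
    exact hc h1.le

theorem theta_comp_symm {c : Fin n → ℕ} (hc : Monotone c) (v : Equiv.Perm (Fin n))
    (hv : IncrOn c v) : theta q c (word R (c ∘ v.symm)) = symmetrizer q c * Hecke.T q v := by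
  rw [← rmul_T_word q hc v hv, theta_rmul q hc, theta_self q hc]

theorem st_symmetrizer (c : Fin n → ℕ) :
    Hecke.st q (symmetrizer q c) = symmetrizer q c := by
  classical
  rw [symmetrizer, map_sum]
  refine Finset.sum_bij' (fun v _ => v.symm) (fun v _ => v.symm) ?_ ?_ ?_ ?_ ?_
  · intro v hv; simpa [comp_symm_eq_self] using hv
  · intro v hv; simpa [comp_symm_eq_self] using hv
  · intro v _; rfl
  · intro v _; rfl
  · intro v _; rw [map_smul, Hecke.st_T, inv_symm]

set_option maxHeartbeats 1000000 in
/-- The elements on which the stabilizer of `c` acts from the right by the trivial character are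
left multiples of the symmetrizer. -/
theorem mem_span_symmetrizer {c : Fin n → ℕ} (hc : Monotone c) (x : Hecke q n)
    (hx : ∀ i, c (lo i) = c (hi i) → x * Hecke.gen q i = (q : R) • x) :
    x ∈ Ideal.span {symmetrizer q c} := by
  classical
  set f := (TBasis q).repr x with hf
  have hxf : ∑ v, f v • Hecke.T q v = x := by
    have := (TBasis q).sum_repr x
    simpa only [TBasis_apply] using this
  have hT : ∀ v u : Equiv.Perm (Fin n),
      (TBasis q).repr (Hecke.T q v) u = if v = u then 1 else 0 := by
    intro v u
    rw [← TBasis_apply, Module.Basis.repr_self, Finsupp.single_apply]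
  -- Comparison of the coefficients of `T_v` in `x T_i = q x`: as `v s_i` is longer than `v`, only
  -- the term of `v s_i` contributes `T_v` on the left.
  have hstep : ∀ (v : Equiv.Perm (Fin n)) (i : Fin (n - 1)), c (lo i) = c (hi i) →
      v.symm (lo i) < v.symm (hi i) → f (v.trans (simpleTransposition i)) = q * f v := by
    intro v i hci hv
    have h1 := congrArg (fun y => (TBasis q).repr y v) (hx i hci)
    simp only [map_smul, Finsupp.smul_apply, smul_eq_mul] at h1
    rw [← hf] at h1
    rw [← h1]
    conv_rhs => rw [← hxf, Finset.sum_mul, map_sum, Finsupp.finsetSum_apply]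
    rw [Finset.sum_eq_single (v.trans (simpleTransposition i))]
    · rw [smul_mul_assoc, Hecke.T_mul_gen_of_gt q (by simpa using hv), trans_simple_simple,
        map_smul, map_add, map_smul]
      have hne : v.trans (simpleTransposition i) ≠ v := by
        intro h
        have := inv_trans_of_lt hv
        rw [h] at this
        omega
      simp [hT, hne]
    · intro u _ hu
      have hne : u.trans (simpleTransposition i) ≠ v := by
        rintro rfl
        exact hu (trans_simple_simple u i).symm
      rw [smul_mul_assoc, map_smul]
      rcases symm_lt_or_gt u i with h | h
      · rw [Hecke.T_mul_gen_of_lt q h]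
        simp [hT, hne]
      · have hne' : u ≠ v := by
          rintro rfl
          exact absurd h hv.not_gt
        rw [Hecke.T_mul_gen_of_gt q h]
        simp [hT, hne, hne']
    · simp
  -- The fibres of `v ↦ c ∘ v` are the cosets of the stabilizer of `c`; each coset sum is shown to
  -- be a left multiple of the symmetrizer.
  have hfib := Finset.sum_fiberwise_of_maps_to (s := Finset.univ)
    (t := Finset.univ.image fun v : Equiv.Perm (Fin n) => c ∘ v)
    (g := fun v : Equiv.Perm (Fin n) => c ∘ v)
    (fun v _ => Finset.mem_image_of_mem _ (Finset.mem_univ v)) (fun v => f v • Hecke.T q v)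
  rw [← hxf, ← hfib]
  refine Ideal.sum_mem _ fun u hu => ?_
  rw [Finset.mem_image] at hu
  obtain ⟨v0, -, rfl⟩ := hu
  obtain ⟨d, hd, hmin⟩ := Finset.exists_min_image
    (Finset.univ.filter fun v : Equiv.Perm (Fin n) => c ∘ v = c ∘ v0) inv ⟨v0, by simp⟩
  simp only [Finset.mem_filter, Finset.mem_univ, true_and] at hd hmin
  -- Minimality of `d` makes its inverse increasing on the fibres of `c`. Lengths therefore add in
  -- `d x` for `x` in the stabilizer, so `T_d T_x = T_{dx}`, and `hstep` gives `f (d x) = q^{l(x)} f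
  -- d`.
  have hup : IncrOn c d.symm := incrOn_of_adjacent hc fun i hci => by
    rcases symm_lt_or_gt d i with h | h
    · exact h
    · have h1 := inv_trans_of_gt h
      have h2 := hmin (d.trans (simpleTransposition i)) (by
        rw [← hd, Equiv.coe_trans, ← Function.comp_assoc, comp_simple_of_eq hci])
      omega
  have hmulT : ∀ x : Equiv.Perm (Fin n), c ∘ x = c →
      Hecke.T q d * Hecke.T q x = Hecke.T q (d.trans x) ∧
        f (d.trans x) = (q : R) ^ inv x * f d := by
    intro x
    induction x using perm_induction with
    | h1 => intro _; simp [Hecke.T_refl, inv_refl]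
    | h2 x i h ih =>
      intro hxc
      have hs : ∀ k, c ((x.trans (simpleTransposition i)).symm k) = c k :=
        fun k => congrFun (comp_symm_eq_self.2 hxc) k
      have hci : c (lo i) = c (hi i) := by
        refine le_antisymm (hc (lo_lt_hi i).le) ?_
        rw [← hs (hi i), ← hs (lo i)]
        exact hc (by simpa using h.le)
      have hxc' : c ∘ x = c := by
        rw [Equiv.coe_trans, ← Function.comp_assoc, comp_simple_of_eq hci] at hxc
        exact hxc
      obtain ⟨h1, h2⟩ := ih hxc'
      have hs' : ∀ k, c (x.symm k) = c k := fun k => congrFun (comp_symm_eq_self.2 hxc') k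
      have h3 : (d.trans x).symm (lo i) < (d.trans x).symm (hi i) :=
        hup _ _ h (by rw [hs', hs', hci])
      rw [← Hecke.T_mul_gen_of_lt q h, ← mul_assoc, h1, Hecke.T_mul_gen_of_lt q h3,
        inv_trans_of_lt h, ← Equiv.trans_assoc, hstep _ i hci h3, h2, pow_succ]
      exact ⟨rfl, by ring⟩
  have : ∑ v ∈ Finset.univ.filter fun v : Equiv.Perm (Fin n) => c ∘ v = c ∘ v0, f v • Hecke.T q v =
      (f d • Hecke.T q d) * symmetrizer q c := by
    rw [symmetrizer, Finset.mul_sum]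
    refine Finset.sum_bij' (fun v _ => d.symm.trans v) (fun v _ => d.trans v) ?_ ?_ ?_ ?_ ?_
    · intro v hv
      simp only [Finset.mem_filter, Finset.mem_univ, true_and] at hv ⊢
      rw [Equiv.coe_trans, ← Function.comp_assoc, hv, ← hd]
      ext k; simp
    · intro v hv
      simp only [Finset.mem_filter, Finset.mem_univ, true_and] at hv ⊢
      rw [Equiv.coe_trans, ← Function.comp_assoc, hv, hd]
    · intro v _; ext k; simp
    · intro v _; ext k; simp
    · intro v hv
      simp only [Finset.mem_filter, Finset.mem_univ, true_and] at hv
      have hs : c ∘ (d.symm.trans v) = c := by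
        rw [Equiv.coe_trans, ← Function.comp_assoc, hv, ← hd]
        ext k; simp
      obtain ⟨h1, h2⟩ := hmulT _ hs
      have h3 : d.trans (d.symm.trans v) = v := by ext k; simp
      rw [h3] at h1 h2
      rw [smul_mul_assoc, mul_smul_comm, h1, h2, smul_smul, mul_comm (f d)]
  rw [this]
  exact Ideal.mul_mem_left _ _ (Ideal.subset_span rfl)

end Words

end HeckeCell

end


noncomputable section

namespace HeckeCell

/-! ## Appending letters -/

/-- The number of occurrences of the letter `l` in the word `w`. -/
def cnt {n : ℕ} (w : Fin n → ℕ) (l : ℕ) : ℕ := (Finset.univ.filter fun k => w k = l).card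

/-- Append the letter `l` to the word `u`. -/
def snoc {n : ℕ} (u : Fin n → ℕ) (l : ℕ) : Fin (n + 1) → ℕ := Fin.snoc (α := fun _ => ℕ) u l

@[simp] theorem snoc_castSucc {n : ℕ} (u : Fin n → ℕ) (l : ℕ) (k : Fin n) :
    snoc u l k.castSucc = u k := Fin.snoc_castSucc (α := fun _ => ℕ) _ _ _

@[simp] theorem snoc_last {n : ℕ} (u : Fin n → ℕ) (l : ℕ) : snoc u l (Fin.last n) = l :=
  Fin.snoc_last (α := fun _ => ℕ) _ _

theorem snoc_init {n : ℕ} (w : Fin (n + 1) → ℕ) :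
    snoc (fun k => w k.castSucc) (w (Fin.last n)) = w := by
  ext k
  induction k using Fin.lastCases with
  | last => simp
  | cast k => simp

theorem cnt_snoc {n : ℕ} (u : Fin n → ℕ) (l j : ℕ) :
    cnt (snoc u l) j = cnt u j + if l = j then 1 else 0 := by
  unfold cnt
  rw [Finset.card_filter, Fin.sum_univ_castSucc, Finset.card_filter]
  simp

theorem cnt_pos {n : ℕ} (w : Fin n → ℕ) (k : Fin n) : 0 < cnt w (w k) :=
  Finset.card_pos.2 ⟨k, by simp⟩

theorem exists_of_cnt_pos {n : ℕ} {w : Fin n → ℕ} {l : ℕ} (h : 0 < cnt w l) : ∃ k, w k = l := by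
  obtain ⟨k, hk⟩ := Finset.card_pos.1 h
  exact ⟨k, by simpa using hk⟩

theorem cnt_comp_equiv {n : ℕ} (w : Fin n → ℕ) (e : Equiv.Perm (Fin n)) (l : ℕ) :
    cnt (w ∘ e) l = cnt w l := by
  unfold cnt
  rw [← Finset.card_map e.toEmbedding]
  congr 1
  ext k
  simp only [Finset.mem_map, Finset.mem_filter, Finset.mem_univ, true_and]
  constructor
  · rintro ⟨a, ha, rfl⟩; exact ha
  · intro h; exact ⟨e.symm k, by simpa using h, by simp⟩

section Words

variable {R : Type*} [CommRing R] (q : Rˣ) {n : ℕ}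

/-- Append the letter `l` to words. -/
def app (l : ℕ) : Words R n →ₗ[R] Words R (n + 1) := Finsupp.lmapDomain R R fun u => snoc u l

@[simp] theorem app_word (l : ℕ) (u : Fin n → ℕ) : app l (word R u) = word R (snoc u l) := by
  simp [app]

theorem Words.hom_ext_app {M : Type*} [AddCommMonoid M] [Module R M]
    {f g : Words R (n + 1) →ₗ[R] M} (h : ∀ l x, f (app l x) = g (app l x)) : f = g :=
  Words.hom_ext fun w => by rw [← snoc_init w, ← app_word, h]

/-- Multiply words by `q` to the number of occurrences of `j`. -/
def weightOp (j : ℕ) : Words R n →ₗ[R] Words R n :=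
  Finsupp.linearCombination R fun w => ((q : R) ^ cnt w j) • word R w

theorem weightOp_word (j : ℕ) (w : Fin n → ℕ) :
    weightOp q j (word R w) = ((q : R) ^ cnt w j) • word R w := by simp [weightOp]

theorem weightOp_app (j l : ℕ) (x : Words R n) :
    weightOp q j (app l x) = (if l = j then (q : R) else 1) • app l (weightOp q j x) := by
  suffices h : weightOp q j ∘ₗ app l = (if l = j then (q : R) else 1) • app l ∘ₗ weightOp q j from
    LinearMap.congr_fun h x
  apply Words.hom_ext
  intro w
  simp only [LinearMap.comp_apply, LinearMap.smul_apply, app_word, weightOp_word, map_smul,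
    cnt_snoc, smul_smul]
  congr 1
  split_ifs <;> ring

theorem weightOp_opT (j : ℕ) (i : Fin (n - 1)) (x : Words R n) :
    weightOp q j (opT q i x) = opT q i (weightOp q j x) := by
  suffices h : weightOp q j ∘ₗ opT q i = opT q i ∘ₗ weightOp q j from LinearMap.congr_fun h x
  apply Words.hom_ext
  intro w
  simp only [LinearMap.comp_apply, weightOp_word, map_smul]
  rcases lt_trichotomy (w (lo i)) (w (hi i)) with h | h | h
  · rw [opT_lt q h, weightOp_word, cnt_comp_equiv]
  · rw [opT_eq q h, map_smul, weightOp_word, smul_comm]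
  · rw [opT_gt q h, map_add, map_smul, weightOp_word, weightOp_word, cnt_comp_equiv, smul_add]
    module

/-- The generator of `H_{n+1}` with the index `i < n - 1` of a generator of `H_n`. -/
abbrev liftIdx (i : Fin (n - 1)) : Fin (n + 1 - 1) := Fin.castLE (by omega) i

theorem lo_liftIdx (i : Fin (n - 1)) : lo (liftIdx i) = (lo i).castSucc := rfl

theorem hi_liftIdx (i : Fin (n - 1)) : hi (liftIdx i) = (hi i).castSucc := rfl

theorem simple_liftIdx_castSucc (i : Fin (n - 1)) (k : Fin n) :
    simpleTransposition (liftIdx i) k.castSucc = (simpleTransposition i k).castSucc := by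
  by_cases h1 : k = lo i
  · rw [h1, ← lo_liftIdx, simpleTransposition_lo, simpleTransposition_lo, hi_liftIdx]
  by_cases h2 : k = hi i
  · rw [h2, ← hi_liftIdx, simpleTransposition_hi, simpleTransposition_hi, lo_liftIdx]
  rw [simpleTransposition_of_ne i h1 h2, simpleTransposition_of_ne]
  · rw [lo_liftIdx]; exact fun h => h1 (Fin.castSucc_injective _ h)
  · rw [hi_liftIdx]; exact fun h => h2 (Fin.castSucc_injective _ h)

theorem simple_liftIdx_last (i : Fin (n - 1)) :
    simpleTransposition (liftIdx i) (Fin.last n) = Fin.last n := by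
  apply simpleTransposition_of_ne
  · rw [lo_liftIdx]; exact (Fin.castSucc_lt_last _).ne'
  · rw [hi_liftIdx]; exact (Fin.castSucc_lt_last _).ne'

theorem snoc_comp_simple (i : Fin (n - 1)) (u : Fin n → ℕ) (l : ℕ) :
    snoc u l ∘ simpleTransposition (liftIdx i) = snoc (u ∘ simpleTransposition i) l := by
  ext k
  induction k using Fin.lastCases with
  | last => simp only [Function.comp_apply, simple_liftIdx_last, snoc_last]
  | cast k => simp only [Function.comp_apply, simple_liftIdx_castSucc, snoc_castSucc]

theorem opT_app (i : Fin (n - 1)) (l : ℕ) (x : Words R n) :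
    opT q (liftIdx i) (app l x) = app l (opT q i x) := by
  suffices h : opT q (liftIdx i) ∘ₗ app l = app l ∘ₗ opT q i from LinearMap.congr_fun h x
  apply Words.hom_ext
  intro w
  have h1 : snoc w l (lo (liftIdx i)) = w (lo i) := by rw [lo_liftIdx, snoc_castSucc]
  have h2 : snoc w l (hi (liftIdx i)) = w (hi i) := by rw [hi_liftIdx, snoc_castSucc]
  simp only [LinearMap.comp_apply, app_word]
  rcases lt_trichotomy (w (lo i)) (w (hi i)) with h | h | h
  · rw [opT_lt q h, opT_lt q (by rwa [h1, h2]), snoc_comp_simple, app_word]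
  · rw [opT_eq q h, opT_eq q (by rwa [h1, h2]), map_smul, app_word]
  · rw [opT_gt q h, opT_gt q (by rwa [h1, h2]), snoc_comp_simple, map_add, map_smul, app_word,
      app_word]

/-- The subalgebra `H_n` of operators on words of length `n + 1` never touches the last letter. This
is how restriction becomes visible on words. -/
theorem rmul_incl_app (b : Hecke q n) (l : ℕ) (x : Words R n) :
    rmul q (Hecke.incl q n b) (app l x) = app l (rmul q b x) := by
  induction b using Hecke.induction_gen generalizing x with
  | h1 r => rw [AlgHom.commutes, rmul_algebraMap, rmul_algebraMap, map_smul]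
  | hgen i => rw [Hecke.incl, Hecke.lift_gen, rmul_gen, rmul_gen]; exact opT_app q i l x
  | hadd a b ha hb => rw [map_add, rmul_add, rmul_add, ha, hb, map_add]
  | hmul a b ha hb => rw [map_mul, rmul_mul, rmul_mul, ha, hb]

/-- The last generator of `H_{n+2}`. -/
abbrev lastIdx (n : ℕ) : Fin (n + 2 - 1) := ⟨n, by omega⟩

theorem snoc_snoc_lo (u : Fin n → ℕ) (l l' : ℕ) : snoc (snoc u l) l' (lo (lastIdx n)) = l := by
  have : lo (lastIdx n) = (Fin.last n).castSucc := rfl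
  rw [this, snoc_castSucc, snoc_last]

theorem snoc_snoc_hi (u : Fin n → ℕ) (l l' : ℕ) : snoc (snoc u l) l' (hi (lastIdx n)) = l' := by
  have : hi (lastIdx n) = Fin.last (n + 1) := rfl
  rw [this, snoc_last]

theorem snoc_snoc_comp (u : Fin n → ℕ) (l l' : ℕ) :
    snoc (snoc u l) l' ∘ simpleTransposition (lastIdx n) = snoc (snoc u l') l := by
  have e1 : lo (lastIdx n) = (Fin.last n).castSucc := rfl
  have e2 : hi (lastIdx n) = Fin.last (n + 1) := rfl
  ext k
  rw [Function.comp_apply]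
  induction k using Fin.lastCases with
  | last => rw [← e2, simpleTransposition_hi, snoc_snoc_lo, snoc_snoc_hi]
  | cast k =>
    induction k using Fin.lastCases with
    | last => rw [← e1, simpleTransposition_lo, snoc_snoc_lo, snoc_snoc_hi]
    | cast k =>
      rw [simpleTransposition_of_ne]
      · simp
      · rw [e1]; exact fun h => (Fin.castSucc_lt_last k).ne (Fin.castSucc_injective _ h)
      · rw [e2]; exact (Fin.castSucc_lt_last _).ne

theorem opT_app_app_lt {l l' : ℕ} (h : l < l') (x : Words R n) :
    opT q (lastIdx n) (app l' (app l x)) = app l (app l' x) := by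
  suffices h : opT q (lastIdx n) ∘ₗ app l' ∘ₗ app l = app l ∘ₗ app l' from LinearMap.congr_fun h x
  apply Words.hom_ext
  intro w
  simp only [LinearMap.comp_apply, app_word]
  rw [opT_lt q (by rwa [snoc_snoc_lo, snoc_snoc_hi]), snoc_snoc_comp]

theorem opT_app_app_self (l : ℕ) (x : Words R n) :
    opT q (lastIdx n) (app l (app l x)) = (q : R) • app l (app l x) := by
  suffices h : opT q (lastIdx n) ∘ₗ app l ∘ₗ app l = (q : R) • app l ∘ₗ app l from
    LinearMap.congr_fun h x
  apply Words.hom_ext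
  intro w
  simp only [LinearMap.comp_apply, LinearMap.smul_apply, app_word]
  rw [opT_eq q (by rw [snoc_snoc_lo, snoc_snoc_hi])]

theorem opT_app_app_gt {l l' : ℕ} (h : l' < l) (x : Words R n) :
    opT q (lastIdx n) (app l' (app l x)) =
      app l (app l' x) + ((q : R) - ((q⁻¹ : Rˣ) : R)) • app l' (app l x) := by
  suffices h : opT q (lastIdx n) ∘ₗ app l' ∘ₗ app l =
      app l ∘ₗ app l' + ((q : R) - ((q⁻¹ : Rˣ) : R)) • app l' ∘ₗ app l from
    LinearMap.congr_fun h x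
  apply Words.hom_ext
  intro w
  simp only [LinearMap.comp_apply, LinearMap.smul_apply, LinearMap.add_apply, app_word]
  rw [opT_gt q (by rwa [snoc_snoc_lo, snoc_snoc_hi]), snoc_snoc_comp]

/-! ## Divided powers -/

/-- The divided power operator that changes `k` letters `i` into `i + 1`, weighted by powers
of `q`. -/
def divPow (i : ℕ) : ∀ (n : ℕ), ℕ → (Words R n →ₗ[R] Words R n)
  | 0, k => if k = 0 then LinearMap.id else 0
  | n + 1, k => Finsupp.linearCombination R fun w =>
      if w (Fin.last n) = i then
        ((q : R) ^ k) • app i (divPow i n k (word R fun a => w a.castSucc)) +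
          app (i + 1) (if k = 0 then 0 else
            divPow i n (k - 1) (weightOp q (i + 1) (word R fun a => w a.castSucc)))
      else app (w (Fin.last n)) (divPow i n k (word R fun a => w a.castSucc))

/-- The coproduct of a divided power, read on the last tensor factor. A final `i` that is kept is
passed by all `k + 1` changes, at the cost of `q` each; a final `i` that is changed picks up `q` for
every letter `i + 1` before it. -/
theorem divPow_succ_app_self (i k : ℕ) (x : Words R n) :
    divPow q i (n + 1) (k + 1) (app i x) = ((q : R) ^ (k + 1)) • app i (divPow q i n (k + 1) x) +
      app (i + 1) (divPow q i n k (weightOp q (i + 1) x)) := by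
  suffices h : divPow q i (n + 1) (k + 1) ∘ₗ app i =
      ((q : R) ^ (k + 1)) • app i ∘ₗ divPow q i n (k + 1) +
        app (i + 1) ∘ₗ divPow q i n k ∘ₗ weightOp q (i + 1) from LinearMap.congr_fun h x
  apply Words.hom_ext
  intro w
  simp [divPow]

/-- Both coefficients are units. Modulo a divided power of the longer word, the term ending in `i`
and the term ending in `i + 1` can therefore be traded for each other. This exchange drives
`word_mem_divPowSpan`, `straightening` and `theta_app_divPow_mem`. -/
theorem divPow_succ_app_self_word (i k : ℕ) (w : Fin n → ℕ) :
    ((q : R) ^ cnt w (i + 1)) • app (i + 1) (divPow q i n k (word R w)) +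
      ((q : R) ^ (k + 1)) • app i (divPow q i n (k + 1) (word R w)) =
        divPow q i (n + 1) (k + 1) (word R (snoc w i)) := by
  rw [← app_word, divPow_succ_app_self, weightOp_word, map_smul, map_smul]
  exact add_comm _ _

theorem divPow_app_of_ne {i l : ℕ} (h : l ≠ i) (k : ℕ) (x : Words R n) :
    divPow q i (n + 1) k (app l x) = app l (divPow q i n k x) := by
  suffices h : divPow q i (n + 1) k ∘ₗ app l = app l ∘ₗ divPow q i n k from
    LinearMap.congr_fun h x
  apply Words.hom_ext
  intro w
  simp [divPow, h]

theorem divPow_zero (i : ℕ) (x : Words R n) : divPow q i n 0 x = x := by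
  induction n with
  | zero => rfl
  | succ n ih =>
    suffices h : divPow q i (n + 1) 0 = (LinearMap.id : Words R (n + 1) →ₗ[R] _) from
      LinearMap.congr_fun h x
    apply Words.hom_ext_app
    intro l y
    by_cases hl : l = i
    · subst hl
      suffices h : divPow q l (n + 1) 0 ∘ₗ app l = app l from LinearMap.congr_fun h y
      apply Words.hom_ext
      intro w
      simp [divPow, ih]
    · rw [divPow_app_of_ne q hl, ih]; rfl

/-- Divided powers are homomorphisms of right modules over the Hecke algebra. -/
theorem divPow_opT (i k : ℕ) (m : Fin (n - 1)) (x : Words R n) :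
    divPow q i n k (opT q m x) = opT q m (divPow q i n k x) := by
  induction n generalizing k with
  | zero => exact m.elim0
  | succ n ih =>
  rcases k with _ | k
  · rw [divPow_zero, divPow_zero]
  cases n with
  | zero => exact m.elim0
  | succ n =>
  -- A generator other than the last acts on the prefix, where induction applies. The last generator
  -- is checked by cases on the last two letters.
  rcases Nat.lt_succ_iff_lt_or_eq.1 (show (m : ℕ) < n + 1 from m.2) with hm | hm
  · obtain ⟨m', rfl⟩ : ∃ m' : Fin (n + 1 - 1), m = liftIdx m' := ⟨⟨m, hm⟩, rfl⟩
    suffices h : divPow q i (n + 2) (k + 1) ∘ₗ opT q (liftIdx m') =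
      opT q (liftIdx m') ∘ₗ divPow q i (n + 2) (k + 1) from LinearMap.congr_fun h x
    apply Words.hom_ext_app
    intro l y
    simp only [LinearMap.comp_apply]
    rw [opT_app]
    by_cases hl : l = i
    · subst hl
      rw [divPow_succ_app_self, divPow_succ_app_self, map_add, map_smul, opT_app, opT_app, ih,
        weightOp_opT, ih]
    · rw [divPow_app_of_ne q hl, divPow_app_of_ne q hl, opT_app, ih]
  · obtain rfl : m = lastIdx n := Fin.ext hm
    suffices h : divPow q i (n + 2) (k + 1) ∘ₗ opT q (lastIdx n) =
      opT q (lastIdx n) ∘ₗ divPow q i (n + 2) (k + 1) from LinearMap.congr_fun h x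
    apply Words.hom_ext_app
    intro l' y
    suffices h : (divPow q i (n + 2) (k + 1) ∘ₗ opT q (lastIdx n)) ∘ₗ app l' =
      (opT q (lastIdx n) ∘ₗ divPow q i (n + 2) (k + 1)) ∘ₗ app l' from LinearMap.congr_fun h y
    apply Words.hom_ext_app
    intro l y
    simp only [LinearMap.comp_apply]
    -- A uniform form of the recursion that includes `k = 0`, where the extra term vanishes. The
    -- value of `z` is irrelevant: it occurs only with `i + 1` appended twice, and there the last
    -- generator acts by `q`.
    have hF : ∀ (y : Words R n), ∃ z : Words R n,
        divPow q i (n + 1) k (app i y) = ((q : R) ^ k) • app i (divPow q i n k y) +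
          app (i + 1) z := by
      intro y
      rcases k with _ | k
      · exact ⟨0, by rw [divPow_zero, divPow_zero]; simp⟩
      · exact ⟨_, divPow_succ_app_self q i k y⟩
    have hi1 : i + 1 ≠ i := by omega
    have hi2 : i ≠ i + 1 := by omega
    have hq := mul_self_eq q
    by_cases h1 : l = i
    · subst h1
      obtain ⟨z, hz⟩ := hF (weightOp q (l + 1) y)
      by_cases h2 : l' = l
      · subst h2
        rw [opT_app_app_self, map_smul, divPow_succ_app_self, divPow_succ_app_self, weightOp_app,
          if_neg hi2, one_smul, hz]
        simp only [map_add, map_smul, opT_app_app_self, opT_app_app_lt q (Nat.lt_succ_self l'),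
          opT_app_app_gt q (Nat.lt_succ_self l')]
        generalize (q : R) - ((q⁻¹ : Rˣ) : R) = c at hq ⊢
        match_scalars
        · ring1
        · linear_combination (q : R) ^ k * hq
        · ring1
        · ring1
      by_cases h3 : l' = l + 1
      · subst h3
        rw [opT_app_app_lt q (Nat.lt_succ_self l), divPow_succ_app_self, divPow_app_of_ne q hi1,
          divPow_app_of_ne q hi1, divPow_succ_app_self, weightOp_app, if_pos rfl]
        simp only [map_add, map_smul, opT_app_app_self, opT_app_app_lt q (Nat.lt_succ_self l),
          divPow_app_of_ne q hi1]
      rw [divPow_app_of_ne q h2, divPow_succ_app_self]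
      rcases lt_or_gt_of_ne h2 with h4 | h4
      · rw [opT_app_app_gt q h4]
        simp only [map_add, map_smul, divPow_succ_app_self, divPow_app_of_ne q h2, weightOp_app,
          if_neg h3, one_smul, opT_app_app_gt q h4, opT_app_app_gt q (show l' < l + 1 by omega)]
        module
      · rw [opT_app_app_lt q h4]
        simp only [map_add, map_smul, divPow_succ_app_self, divPow_app_of_ne q h2, weightOp_app,
          if_neg h3, one_smul, opT_app_app_lt q h4, opT_app_app_lt q (show l + 1 < l' by omega)]
    by_cases h2 : l' = i
    · subst h2
      by_cases h3 : l = l' + 1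
      · subst h3
        rw [opT_app_app_gt q (Nat.lt_succ_self l')]
        simp only [map_add, map_smul, divPow_succ_app_self, divPow_app_of_ne q h1, weightOp_app,
          if_true, opT_app_app_self, opT_app_app_gt q (Nat.lt_succ_self l')]
        generalize (q : R) - ((q⁻¹ : Rˣ) : R) = c at hq ⊢
        match_scalars <;> first | ring1 | linear_combination -hq
      rw [divPow_succ_app_self]
      rcases lt_or_gt_of_ne h1 with h4 | h4
      · rw [opT_app_app_lt q h4]
        simp only [map_add, map_smul, divPow_succ_app_self, divPow_app_of_ne q h1, weightOp_app,
          if_neg h3, one_smul, opT_app_app_lt q h4, opT_app_app_lt q (show l < l' + 1 by omega)]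
      · rw [opT_app_app_gt q h4]
        simp only [map_add, map_smul, divPow_succ_app_self, divPow_app_of_ne q h1, weightOp_app,
          if_neg h3, one_smul, opT_app_app_gt q h4, opT_app_app_gt q (show l' + 1 < l by omega)]
        module
    · rw [divPow_app_of_ne q h2, divPow_app_of_ne q h1]
      rcases lt_trichotomy l l' with h4 | h4 | h4
      · rw [opT_app_app_lt q h4, opT_app_app_lt q h4, divPow_app_of_ne q h1, divPow_app_of_ne q h2]
      · subst h4
        rw [opT_app_app_self, opT_app_app_self, map_smul, divPow_app_of_ne q h1,
          divPow_app_of_ne q h1]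
      · rw [opT_app_app_gt q h4, opT_app_app_gt q h4, map_add, map_smul, divPow_app_of_ne q h1,
          divPow_app_of_ne q h2, divPow_app_of_ne q h2, divPow_app_of_ne q h1]

theorem divPow_rmul (i k : ℕ) (h : Hecke q n) (x : Words R n) :
    divPow q i n k (rmul q h x) = rmul q h (divPow q i n k x) := by
  induction h using Hecke.induction_gen generalizing x with
  | h1 r => rw [rmul_algebraMap, rmul_algebraMap, map_smul]
  | hgen m => rw [rmul_gen, divPow_opT]
  | hadd a b ha hb => rw [rmul_add, rmul_add, map_add, ha, hb]
  | hmul a b ha hb => rw [rmul_mul, rmul_mul, hb, ha]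

/-- Divided powers of words are combinations of words with the expected content. -/
theorem divPow_word_mem (i k : ℕ) (w : Fin n → ℕ) :
    divPow q i n k (word R w) ∈ Submodule.span R {x : Words R n | ∃ v : Fin n → ℕ,
      (∀ l, cnt v l + (if l = i then k else 0) = cnt w l + if l = i + 1 then k else 0) ∧
        x = word R v} := by
  induction n generalizing k with
  | zero =>
    simp only [divPow]
    split_ifs with hk
    · exact Submodule.subset_span ⟨w, by simp [hk], rfl⟩
    · exact zero_mem _
  | succ n ih =>
    rw [← snoc_init w, ← app_word]
    set u : Fin n → ℕ := fun k => w k.castSucc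
    set l := w (Fin.last n)
    have happ : ∀ (l' k' : ℕ), (∀ v : Fin n → ℕ,
        (∀ j, cnt v j + (if j = i then k' else 0) = cnt u j + if j = i + 1 then k' else 0) →
        (∀ j, cnt (snoc v l') j + (if j = i then k else 0) =
          cnt (snoc u l) j + if j = i + 1 then k else 0)) →
        app l' (divPow q i n k' (word R u)) ∈ Submodule.span R {x : Words R (n + 1) |
          ∃ v : Fin (n + 1) → ℕ, (∀ j, cnt v j + (if j = i then k else 0) =
            cnt (snoc u l) j + if j = i + 1 then k else 0) ∧ x = word R v} := by
      intro l' k' hcond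
      have := Submodule.mem_map_of_mem (f := app (R := R) l') (ih k' u)
      rw [Submodule.map_span] at this
      refine Submodule.span_mono ?_ this
      rintro _ ⟨_, ⟨v, hv, rfl⟩, rfl⟩
      exact ⟨snoc v l', hcond v hv, app_word _ _⟩
    have hsame : app l (divPow q i n k (word R u)) ∈ Submodule.span R {x : Words R (n + 1) |
          ∃ v : Fin (n + 1) → ℕ, (∀ j, cnt v j + (if j = i then k else 0) =
            cnt (snoc u l) j + if j = i + 1 then k else 0) ∧ x = word R v} := by
      refine happ l k fun v hv j => ?_
      have := hv j
      rw [cnt_snoc, cnt_snoc]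
      omega
    by_cases hl : l = i
    · rcases k with _ | k
      · rw [divPow_zero]
        rwa [divPow_zero] at hsame
      · clear_value l u
        subst hl
        rw [divPow_succ_app_self]
        refine add_mem (Submodule.smul_mem _ _ hsame) ?_
        rw [weightOp_word, map_smul, map_smul]
        refine Submodule.smul_mem _ _ (happ _ _ fun v hv j => ?_)
        have := hv j
        rw [cnt_snoc, cnt_snoc]
        split_ifs at this ⊢ <;> omega
    · rwa [divPow_app_of_ne q hl]

/-- The span of the `k`-th divided powers of words, for `k ≥ m`, in which the number of letters
`i + 1` exceeds the number of letters `i` by `D`. -/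
def divPowSpan (i L n m : ℕ) (D : ℤ) : Submodule R (Words R n) :=
  Submodule.span R {x | ∃ (k : ℕ) (w : Fin n → ℕ), m ≤ k ∧
    (cnt w (i + 1) : ℤ) - cnt w i + 2 * k = D ∧ (∀ p, w p < L) ∧ x = divPow q i n k (word R w)}

theorem mem_of_add_smul_mem {M : Type*} [AddCommGroup M] [Module R M] (S : Submodule R M)
    {r : R} (hr : IsUnit r) {x y z : M} (h : x + r • y = z) (hx : x ∈ S) (hz : z ∈ S) : y ∈ S := by
  rw [← Submodule.smul_mem_iff_of_isUnit S hr]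
  rw [show r • y = z - x by rw [← h, add_sub_cancel_left]]
  exact sub_mem hz hx

theorem lt_of_snoc_lt {n L : ℕ} {u : Fin n → ℕ} {l : ℕ} (h : ∀ p, snoc u l p < L) :
    (∀ p, u p < L) ∧ l < L :=
  ⟨fun p => by simpa using h p.castSucc, by simpa using h (Fin.last n)⟩

theorem snoc_lt {n L : ℕ} {u : Fin n → ℕ} {l : ℕ} (h : ∀ p, u p < L) (hl : l < L) :
    ∀ p, snoc u l p < L := by
  intro p
  induction p using Fin.lastCases with
  | last => simpa using hl
  | cast k => simpa using h k

theorem lt_of_content {n i L k : ℕ} {v w : Fin n → ℕ}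
    (h : ∀ l, cnt v l + (if l = i then k else 0) = cnt w l + if l = i + 1 then k else 0)
    (hi : i + 1 < L) (hw : ∀ p, w p < L) : ∀ p, v p < L := by
  intro p
  by_contra hp
  have h1 := h (v p)
  have h2 := cnt_pos v p
  rw [if_neg (show ¬ v p = i by omega), if_neg (show ¬ v p = i + 1 by omega)] at h1
  obtain ⟨p', hp'⟩ := exists_of_cnt_pos (w := w) (l := v p) (by omega)
  have := hw p'
  omega

theorem isUnit_pow_coe (k : ℕ) : IsUnit ((q : R) ^ k) := (q.isUnit).pow k

/-- A word with at least `m` more letters `i + 1` than `i` is in the span of the `k`-th divided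
powers with `k ≥ m`. -/
theorem word_mem_divPowSpan {i L : ℕ} (hiL : i + 1 < L) (m : ℕ) (w : Fin n → ℕ)
    (hw : ∀ p, w p < L) (hm : cnt w i + m ≤ cnt w (i + 1)) :
    word R w ∈ divPowSpan q i L n m ((cnt w (i + 1) : ℤ) - cnt w i) := by
  -- An integral `sl_2` fact about weight spaces. Only `m = 1` is needed later, but the induction on
  -- the last letter needs `m` free: deleting a final `i` asks for one more, deleting a final `i +
  -- 1` grants one less.
  induction n generalizing m with
  | zero =>
    have : m = 0 := by simpa [cnt] using hm
    subst this
    exact Submodule.subset_span ⟨0, w, le_rfl, by simp, hw, (divPow_zero q i _).symm⟩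
  | succ n ih =>
    rcases m with _ | m
    · exact Submodule.subset_span ⟨0, w, le_rfl, by simp, hw, (divPow_zero q i _).symm⟩
    rw [← snoc_init w] at hw hm ⊢
    generalize w (Fin.last n) = l at *
    generalize (fun k : Fin n => w k.castSucc) = u at *
    obtain ⟨hu, hl⟩ := lt_of_snoc_lt hw
    have hi1 : i + 1 ≠ i := by omega
    have hi2 : i ≠ i + 1 := by omega
    set D : ℤ := (cnt (snoc u l) (i + 1) : ℤ) - cnt (snoc u l) i with hD
    rw [← app_word]
    have up : ∀ x ∈ divPowSpan (R := R) q i L n (m + 1) (D - 1),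
        app (i + 1) x ∈ divPowSpan (R := R) q i L (n + 1) (m + 1) D := by
      intro x hx
      rw [divPowSpan] at hx
      induction hx using Submodule.span_induction with
      | zero => rw [map_zero]; exact zero_mem _
      | add x y _ _ hx hy => rw [map_add]; exact add_mem hx hy
      | smul r x _ hx => rw [map_smul]; exact Submodule.smul_mem _ _ hx
      | mem x hx =>
        obtain ⟨k, v, hk, hv, hvL, rfl⟩ := hx
        refine Submodule.subset_span ⟨k, snoc v (i + 1), hk, ?_, snoc_lt hvL hiL, ?_⟩
        · rw [cnt_snoc, cnt_snoc, if_pos rfl, if_neg hi1]; push_cast; omega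
        · rw [← app_word, divPow_app_of_ne q hi1]
    -- Appending `i` does not commute with divided powers. The exchange relation costs one step, so
    -- `k ≥ m + 2` before gives `k ≥ m + 1` after.
    have down : ∀ x ∈ divPowSpan (R := R) q i L n (m + 2) (D + 1),
        app i x ∈ divPowSpan (R := R) q i L (n + 1) (m + 1) D := by
      intro x hx
      rw [divPowSpan] at hx
      induction hx using Submodule.span_induction with
      | zero => rw [map_zero]; exact zero_mem _
      | add x y _ _ hx hy => rw [map_add]; exact add_mem hx hy
      | smul r x _ hx => rw [map_smul]; exact Submodule.smul_mem _ _ hx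
      | mem x hx =>
        obtain ⟨k, v, hk, hv, hvL, rfl⟩ := hx
        obtain ⟨k, rfl⟩ : ∃ k', k = k' + 1 := ⟨k - 1, by omega⟩
        have h1 := divPow_succ_app_self_word q i k v
        refine mem_of_add_smul_mem _ (isUnit_pow_coe q (k + 1)) h1 ?_ ?_
        · rw [← divPow_app_of_ne q hi1, app_word]
          refine Submodule.smul_mem _ _ (Submodule.subset_span
            ⟨k, snoc v (i + 1), by omega, ?_, snoc_lt hvL hiL, rfl⟩)
          rw [cnt_snoc, cnt_snoc, if_pos rfl, if_neg hi1]; push_cast at *; omega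
        · refine Submodule.subset_span ⟨k + 1, snoc v i, by omega, ?_, snoc_lt hvL (by omega), rfl⟩
          rw [cnt_snoc, cnt_snoc, if_pos rfl, if_neg hi2]; push_cast at *; omega
    rw [cnt_snoc, cnt_snoc] at hm hD
    by_cases h1 : l = i
    · subst h1
      rw [if_pos rfl, if_neg hi2] at hm hD
      have := ih (m + 2) u hu (by omega)
      rw [show (cnt u (l + 1) : ℤ) - cnt u l = D + 1 by push_cast at hD; omega] at this
      exact down _ this
    by_cases h2 : l = i + 1
    · subst h2
      rw [if_pos rfl, if_neg hi1] at hm hD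
      have h3 := ih m u hu (by omega)
      have hDm : (m : ℤ) + 1 ≤ D := by push_cast at hD; omega
      rw [show (cnt u (i + 1) : ℤ) - cnt u i = D - 1 by push_cast at hD; omega, divPowSpan] at h3
      clear hm hD
      generalize word R u = x at h3 ⊢
      induction h3 using Submodule.span_induction with
      | zero => rw [map_zero]; exact zero_mem _
      | add x y _ _ hx hy => rw [map_add]; exact add_mem hx hy
      | smul r x _ hx => rw [map_smul]; exact Submodule.smul_mem _ _ hx
      | mem x hx =>
        obtain ⟨k, v, hk, hv, hvL, rfl⟩ := hx
        rcases hk.lt_or_eq with hk | rfl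
        · exact up _ (Submodule.subset_span ⟨k, v, hk, hv, hvL, rfl⟩)
        -- Only `k = m` is too small. The exchange relation replaces this term by one ending in `i`
        -- whose prefix is made of words with excess `D + 1 ≥ m + 2`; for these the induction
        -- hypothesis and `down` apply.
        have h1 := divPow_succ_app_self_word q i m v
        refine mem_of_add_smul_mem _ (isUnit_pow_coe q _) ((add_comm _ _).trans h1) ?_ ?_
        · refine Submodule.smul_mem _ _ (down _ ?_)
          refine (Submodule.span_le.2 ?_) (divPow_word_mem q i (m + 1) v)
          rintro _ ⟨v', hv', rfl⟩
          have e1 := hv' i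
          have e2 := hv' (i + 1)
          rw [if_pos rfl, if_neg hi2] at e1
          rw [if_pos rfl, if_neg hi1] at e2
          have := ih (m + 2) v' (lt_of_content hv' hiL hvL) (by omega)
          rwa [show (cnt v' (i + 1) : ℤ) - cnt v' i = D + 1 by omega] at this
        · refine Submodule.subset_span ⟨m + 1, snoc v i, by omega, ?_, snoc_lt hvL (by omega), rfl⟩
          rw [cnt_snoc, cnt_snoc, if_pos rfl, if_neg hi2]; push_cast at *; omega
    · rw [if_neg h1, if_neg h2] at hm hD
      have h3 := ih (m + 1) u hu (by omega)
      rw [show (cnt u (i + 1) : ℤ) - cnt u i = D by push_cast at hD; omega, divPowSpan] at h3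
      clear hm hD
      generalize word R u = x at h3 ⊢
      induction h3 using Submodule.span_induction with
      | zero => rw [map_zero]; exact zero_mem _
      | add x y _ _ hx hy => rw [map_add]; exact add_mem hx hy
      | smul r x _ hx => rw [map_smul]; exact Submodule.smul_mem _ _ hx
      | mem x hx =>
        obtain ⟨k, v, hk, hv, hvL, rfl⟩ := hx
        rw [← divPow_app_of_ne q h1, app_word]
        refine Submodule.subset_span ⟨k, snoc v l, hk, ?_, snoc_lt hvL hl, rfl⟩
        rw [cnt_snoc, cnt_snoc, if_neg h1, if_neg h2]; push_cast; omega

/-! ## Straightening -/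

/-- Ballot words: in every prefix, the letter `i` occurs at least as often as `i + 1`. -/
def Ballot : ∀ {n : ℕ}, (Fin n → ℕ) → Prop
  | 0, _ => True
  | n + 1, w => Ballot (fun k : Fin n => w k.castSucc) ∧ ∀ i, cnt w (i + 1) ≤ cnt w i

theorem ballot_snoc {n : ℕ} {u : Fin n → ℕ} {l : ℕ} :
    Ballot (snoc u l) ↔ Ballot u ∧ ∀ i, cnt (snoc u l) (i + 1) ≤ cnt (snoc u l) i := by
  rw [Ballot]
  simp only [snoc_castSucc]

variable (n) in
/-- The span of the `k`-th divided powers of words with `k ≥ 1`. -/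
def garnirSpan (L : ℕ) : Submodule R (Words R n) :=
  Submodule.span R {x | ∃ (i k : ℕ) (w : Fin n → ℕ), 1 ≤ k ∧ i + 1 < L ∧ (∀ p, w p < L) ∧
    x = divPow q i n k (word R w)}

variable (R n) in
/-- The span of the ballot words in the letters less than `L`. -/
def ballotSpan (L : ℕ) : Submodule R (Words R n) :=
  Submodule.span R {x | ∃ w : Fin n → ℕ, Ballot w ∧ (∀ p, w p < L) ∧ x = word R w}

/-- Modulo divided powers, every word is a linear combination of ballot words. -/
theorem straightening {L : ℕ} (w : Fin n → ℕ) (hw : ∀ p, w p < L) :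
    word R w ∈ ballotSpan R n L ⊔ garnirSpan q n L := by
  induction n with
  | zero => exact Submodule.mem_sup_left (Submodule.subset_span ⟨w, trivial, hw, rfl⟩)
  | succ n ih =>
    -- For a fixed length, last letters are treated from the largest downwards, because the exchange
    -- relation turns a final `i` into a final `i + 1`.
    suffices h : ∀ d l : ℕ, L - l = d → l < L → ∀ u : Fin n → ℕ, (∀ p, u p < L) →
        app l (word R u) ∈ ballotSpan R (n + 1) L ⊔ garnirSpan q (n + 1) L by
      rw [← snoc_init w] at hw ⊢
      obtain ⟨hu, hl⟩ := lt_of_snoc_lt hw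
      rw [← app_word]
      exact h _ _ rfl hl _ hu
    intro d
    induction d using Nat.strong_induction_on with
    | _ d ihd =>
    intro l hd hl u hu
    have hle : ballotSpan R n L ⊔ garnirSpan q n L ≤
        (ballotSpan R (n + 1) L ⊔ garnirSpan q (n + 1) L).comap (app l) := by
      refine sup_le (Submodule.span_le.2 ?_) (Submodule.span_le.2 ?_)
      · rintro _ ⟨v, hv, hvL, rfl⟩
        rw [SetLike.mem_coe, Submodule.mem_comap, app_word]
        -- If the prefix is ballot and the word is not, then some `i + 1` outnumbers `i` in the
        -- whole word, which puts it in the span of divided powers with `k ≥ 1`.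
        by_cases hb : ∀ i, cnt (snoc v l) (i + 1) ≤ cnt (snoc v l) i
        · exact Submodule.mem_sup_left (Submodule.subset_span
            ⟨snoc v l, ballot_snoc.2 ⟨hv, hb⟩, snoc_lt hvL hl, rfl⟩)
        · push Not at hb
          obtain ⟨i, hi⟩ := hb
          obtain ⟨p, hp⟩ := exists_of_cnt_pos (w := snoc v l) (l := i + 1) (by omega)
          have hiL : i + 1 < L := hp ▸ snoc_lt hvL hl p
          refine Submodule.mem_sup_right (Submodule.span_mono ?_
            (word_mem_divPowSpan q hiL 1 (snoc v l) (snoc_lt hvL hl) hi))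
          rintro _ ⟨k, v', hk, -, hv', rfl⟩
          exact ⟨i, k, v', hk, hiL, hv', rfl⟩
      · rintro _ ⟨i, k, v, hk, hiL, hvL, rfl⟩
        rw [SetLike.mem_coe, Submodule.mem_comap]
        by_cases hli : l = i
        · subst hli
          obtain ⟨k, rfl⟩ : ∃ k', k = k' + 1 := ⟨k - 1, by omega⟩
          -- The only divided power of the prefix that does not pass through the last letter is the
          -- one at `i = l`; it is traded for words ending in `l + 1`, already treated.
          have h1 := divPow_succ_app_self_word q l k v
          refine mem_of_add_smul_mem _ (isUnit_pow_coe q (k + 1)) h1 ?_ ?_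
          · refine Submodule.smul_mem _ _ ?_
            rw [← Submodule.mem_comap]
            refine (Submodule.span_le.2 ?_) (divPow_word_mem q l k v)
            rintro _ ⟨v', hv', rfl⟩
            exact ihd (L - (l + 1)) (by omega) (l + 1) rfl hiL v' (lt_of_content hv' hiL hvL)
          · exact Submodule.mem_sup_right (Submodule.subset_span
              ⟨l, k + 1, snoc v l, hk, hiL, snoc_lt hvL hl, rfl⟩)
        · rw [← divPow_app_of_ne q hli, app_word]
          exact Submodule.mem_sup_right (Submodule.subset_span
              ⟨i, k, snoc v l, hk, hiL, snoc_lt hvL hl, rfl⟩)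
    exact hle (ih u hu)

end Words

end HeckeCell

end


noncomputable section

namespace HeckeCell

/-! ## Row words of tableaux -/

namespace Shape

variable {n : ℕ}

/-- The word whose `k`-th letter is the row of the entry `k` in the tableau `t`. -/
def rowWord (lam : Shape n) (t : lam.InjTableau) (k : Fin n) : ℕ := (t.symm k).1.1

/-- The row word of `t^lam`. -/
def rowFn (lam : Shape n) : Fin n → ℕ := lam.rowWord lam.rowTableau

theorem coe_rowTableau (lam : Shape n) (x : {x // x ∈ lam.diagram.cells}) :
    (lam.rowTableau x : ℕ) = lam.rowSum x.1.1 + x.1.2 := rfl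

theorem rowFn_monotone (lam : Shape n) : Monotone lam.rowFn := by
  intro a b hab
  obtain ⟨x, rfl⟩ := lam.rowTableau.surjective a
  obtain ⟨y, rfl⟩ := lam.rowTableau.surjective b
  simp only [rowFn, rowWord, Equiv.symm_apply_apply]
  by_contra h
  have h1 := lam.rowSum_mono (show y.1.1 + 1 ≤ x.1.1 by omega)
  have h2 := lam.rowEntry_lt y.2
  have h3 : (lam.rowTableau x : ℕ) ≤ lam.rowTableau y := hab
  rw [coe_rowTableau, coe_rowTableau] at h3
  omega

theorem cnt_rowWord (lam : Shape n) (t : lam.InjTableau) (r : ℕ) :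
    cnt (lam.rowWord t) r = lam.diagram.rowLen r := by
  rw [YoungDiagram.rowLen_eq_card]
  refine Finset.card_bij (fun k _ => (t.symm k).1) ?_ ?_ ?_
  · intro k hk
    rw [YoungDiagram.mem_row_iff]
    exact ⟨(t.symm k).2, (Finset.mem_filter.1 hk).2⟩
  · intro a _ b _ h
    exact t.symm.injective (Subtype.ext h)
  · intro x hx
    rw [YoungDiagram.mem_row_iff] at hx
    exact ⟨t ⟨x, hx.1⟩, Finset.mem_filter.2 ⟨Finset.mem_univ _, by simp [rowWord, hx.2]⟩, by simp⟩

theorem rowFn_comp_perm (lam : Shape n) (t : lam.InjTableau) :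
    lam.rowFn ∘ (lam.perm t).symm = lam.rowWord t := by
  ext k
  simp [rowFn, rowWord, perm]

/-- Row-standardness says that `w(t)` is the shortest element of its coset of the Young subgroup, so
that `theta` turns the row word of `t` into `m_λ T_{w(t)}`. -/
theorem incrOn_perm (lam : Shape n) (t : lam.Std) : IncrOn lam.rowFn (lam.perm t.1) := by
  intro a b hab h
  obtain ⟨x, rfl⟩ := lam.rowTableau.surjective a
  obtain ⟨y, rfl⟩ := lam.rowTableau.surjective b
  simp only [rowFn, rowWord, Equiv.symm_apply_apply] at h
  simp only [perm, Equiv.trans_apply, Equiv.symm_apply_apply]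
  refine t.2.1 x y h ?_
  have h3 : (lam.rowTableau x : ℕ) < lam.rowTableau y := hab
  rw [coe_rowTableau, coe_rowTableau, h] at h3
  omega

theorem cnt_rowFn (lam : Shape n) (r : ℕ) : cnt lam.rowFn r = lam.diagram.rowLen r :=
  lam.cnt_rowWord _ r

end Shape

theorem card_filter_le_le_of_ballot {n : ℕ} {w : Fin n → ℕ} (hw : Ballot w) (k : Fin n) (i : ℕ) :
    (Finset.univ.filter fun p => p ≤ k ∧ w p = i + 1).card ≤
      (Finset.univ.filter fun p => p ≤ k ∧ w p = i).card := by
  induction n with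
  | zero => exact k.elim0
  | succ n ih =>
    obtain ⟨h1, h2⟩ := hw
    induction k using Fin.lastCases with
    | last => simpa [Fin.le_last, cnt] using h2 i
    | cast k =>
      have := ih h1 k
      rw [Finset.card_filter, Finset.card_filter] at this ⊢
      rw [Fin.sum_univ_castSucc, Fin.sum_univ_castSucc]
      simpa [(Fin.castSucc_lt_last k).not_ge] using this

/-- Ballot words whose content is a partition are row words of standard tableaux. -/
theorem exists_std_of_ballot {n : ℕ} (lam : Shape n) {w : Fin n → ℕ} (hw : Ballot w)
    (hc : ∀ r, cnt w r = lam.diagram.rowLen r) : ∃ t : lam.Std, lam.rowWord t.1 = w := by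
  -- The entry `k` goes into row `w k`, and its column is the number of earlier occurrences of that
  -- letter.
  set pos : Fin n → ℕ := fun k => (Finset.univ.filter fun p => p < k ∧ w p = w k).card with hpos
  have hlt : ∀ {k l : Fin n}, k < l → w k = w l → pos k < pos l := by
    intro k l hkl h
    apply Finset.card_lt_card
    rw [Finset.ssubset_iff_of_subset]
    · exact ⟨k, by simp [hkl, h], by simp⟩
    · intro p
      simp only [Finset.mem_filter, Finset.mem_univ, true_and]
      exact fun hp => ⟨hp.1.trans hkl, hp.2.trans h⟩
  have hmem : ∀ k, (w k, pos k) ∈ lam.diagram.cells := by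
    intro k
    rw [YoungDiagram.mem_cells, YoungDiagram.mem_iff_lt_rowLen, ← hc]
    apply Finset.card_lt_card
    rw [Finset.ssubset_iff_of_subset]
    · exact ⟨k, by simp, by simp⟩
    · intro p
      simp only [Finset.mem_filter, Finset.mem_univ, true_and]
      exact fun hp => hp.2
  set g : Fin n → {x // x ∈ lam.diagram.cells} := fun k => ⟨(w k, pos k), hmem k⟩ with hg
  have hinj : Function.Injective g := by
    intro k l h
    have h1 : w k = w l ∧ pos k = pos l := by simpa [hg] using h
    rcases lt_trichotomy k l with h2 | h2 | h2
    · exact absurd h1.2 (hlt h2 h1.1).ne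
    · exact h2
    · exact absurd h1.2 (hlt h2 h1.1.symm).ne'
  have hbij : Function.Bijective g := (Fintype.bijective_iff_injective_and_card g).2
    ⟨hinj, by rw [Fintype.card_coe, Fintype.card_fin]; exact lam.card_eq.symm⟩
  have hbal : ∀ (k : Fin n) (a b : ℕ), a ≤ b →
      (Finset.univ.filter fun p => p ≤ k ∧ w p = b).card ≤
        (Finset.univ.filter fun p => p ≤ k ∧ w p = a).card := by
    intro k a b hab
    induction b, hab using Nat.le_induction with
    | base => exact le_rfl
    | succ b _ ih => exact (card_filter_le_le_of_ballot hw k b).trans ih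
  refine ⟨⟨(Equiv.ofBijective g hbij).symm, ?_, ?_⟩, ?_⟩
  · intro x y h h'
    obtain ⟨k, rfl⟩ := hbij.2 x
    obtain ⟨l, rfl⟩ := hbij.2 y
    rw [Equiv.ofBijective_symm_apply_apply, Equiv.ofBijective_symm_apply_apply]
    simp only [hg] at h h'
    by_contra hkl
    rcases (not_lt.1 hkl).lt_or_eq with h1 | h1
    · exact absurd (hlt h1 h.symm) h'.not_gt
    · rw [h1] at h'; exact lt_irrefl _ h'
  · intro x y h h'
    obtain ⟨k, rfl⟩ := hbij.2 x
    obtain ⟨l, rfl⟩ := hbij.2 y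
    rw [Equiv.ofBijective_symm_apply_apply, Equiv.ofBijective_symm_apply_apply]
    simp only [hg] at h h'
    by_contra hkl
    rcases (not_lt.1 hkl).lt_or_eq with h1 | h1
    · have h2 := hbal l _ _ h'.le
      have h3 : pos l < (Finset.univ.filter fun p => p ≤ l ∧ w p = w l).card := by
        apply Finset.card_lt_card
        rw [Finset.ssubset_iff_of_subset]
        · exact ⟨l, by simp, by simp⟩
        · intro p
          simp only [Finset.mem_filter, Finset.mem_univ, true_and]
          exact fun hp => ⟨hp.1.le, hp.2⟩
      have h4 : (Finset.univ.filter fun p => p ≤ l ∧ w p = w k).card ≤ pos k := by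
        apply Finset.card_le_card
        intro p
        simp only [Finset.mem_filter, Finset.mem_univ, true_and]
        exact fun hp => ⟨hp.1.trans_lt h1, hp.2⟩
      omega
    · rw [h1] at h'; exact lt_irrefl _ h'
  · rfl

/-! ## Sorting the content of a word -/

theorem exists_perm_of_cnt_eq {n : ℕ} {w w' : Fin n → ℕ} (h : ∀ l, cnt w l = cnt w' l) :
    ∃ e : Equiv.Perm (Fin n), w ∘ e = w' := by
  have hc : ∀ l, Nonempty ({k // w' k = l} ≃ {k // w k = l}) := fun l =>
    ⟨Fintype.equivOfCardEq (by
      rw [Fintype.card_subtype, Fintype.card_subtype]; exact (h l).symm)⟩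
  refine ⟨Equiv.ofFiberEquiv fun l => (hc l).some, ?_⟩
  ext k
  exact Equiv.ofFiberEquiv_map _ k

theorem sum_le_sum_range_of_antitone {s : ℕ → ℕ} (hs : Antitone s) (S : Finset ℕ) :
    ∑ l ∈ S, s l ≤ ∑ l ∈ Finset.range S.card, s l := by
  induction S using Finset.induction_on_max with
  | empty => simp
  | insert m S hm ih =>
    have hnot : m ∉ S := fun h => lt_irrefl _ (hm m h)
    rw [Finset.sum_insert hnot, Finset.card_insert_of_notMem hnot, Finset.sum_range_succ, add_comm]
    refine add_le_add ih (hs ?_)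
    have : S ⊆ Finset.range m := fun x hx => Finset.mem_range.2 (hm x hx)
    simpa using Finset.card_le_card this

theorem exists_shape_rowLen {n L : ℕ} {s : ℕ → ℕ} (hs : Antitone s) (hL : ∀ r, L ≤ r → s r = 0)
    (hn : ∑ r ∈ Finset.range L, s r = n) : ∃ μ : Shape n, ∀ r, μ.diagram.rowLen r = s r := by
  have hsn : ∀ r, s r ≤ n := fun r => by
    by_cases hr : r < L
    · rw [← hn]
      exact Finset.single_le_sum (f := s) (fun _ _ => Nat.zero_le _) (Finset.mem_range.2 hr)
    · rw [hL r (not_lt.1 hr)]; exact Nat.zero_le _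
  set D : YoungDiagram :=
    { cells := (Finset.range L ×ˢ Finset.range (n + 1)).filter fun x => x.2 < s x.1
      isLowerSet := by
        rintro ⟨i, j⟩ ⟨i', j'⟩ ⟨h1, h2⟩ h
        simp only [Finset.coe_filter, Finset.mem_product, Finset.mem_range,
          Set.mem_ofPred_eq] at h h1 h2 ⊢
        have := hs h1
        omega } with hD
  have hmem : ∀ i j, (i, j) ∈ D ↔ j < s i := by
    intro i j
    rw [← YoungDiagram.mem_cells, hD]
    simp only [Finset.mem_filter, Finset.mem_product, Finset.mem_range]
    constructor
    · exact fun h => h.2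
    · intro h
      have := hsn i
      have h' : i < L := by
        by_contra hi
        rw [hL i (not_lt.1 hi)] at h
        omega
      exact ⟨⟨h', by omega⟩, h⟩
  have hrow : ∀ r, D.rowLen r = s r := by
    intro r
    have := fun j =>
      (YoungDiagram.mem_iff_lt_rowLen (μ := D) (i := r) (j := j)).symm.trans (hmem r j)
    have h1 := this (s r)
    have h2 := this (D.rowLen r)
    omega
  refine ⟨⟨D, ?_⟩, hrow⟩
  change D.cells.card = n
  rw [hD, Finset.card_filter, Finset.sum_product, ← hn]
  refine Finset.sum_congr rfl fun i _ => ?_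
  rw [← Finset.card_filter]
  have : (Finset.range (n + 1)).filter (fun j => j < s i) = Finset.range (s i) := by
    ext j
    have := hsn i
    simp only [Finset.mem_filter, Finset.mem_range]
    omega
  simp only
  rw [hn, this, Finset.card_range]

theorem sum_cnt {n L : ℕ} {w : Fin n → ℕ} (hL : ∀ k, w k < L) :
    ∑ l ∈ Finset.range L, cnt w l = n := by
  have := Finset.card_eq_sum_card_fiberwise (s := (Finset.univ : Finset (Fin n)))
    (t := Finset.range L) (f := w) (fun k _ => by simpa using hL k)
  simpa [cnt] using this.symm

/-- Every word is a rearrangement of a word that is constant on the rows of a tableau `t^μ`,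
where `μ` is obtained by sorting the content of the word. -/
theorem exists_sorted {n : ℕ} (w : Fin n → ℕ) : ∃ (μ : Shape n) (κ : ℕ → ℕ)
    (e : Equiv.Perm (Fin n)), w ∘ e = κ ∘ μ.rowFn ∧
      ∀ S : Finset ℕ, ∑ l ∈ S, cnt w l ≤ μ.rowSum S.card := by
  obtain ⟨L, hL⟩ : ∃ L, ∀ k, w k < L :=
    ⟨Finset.univ.sup w + 1, fun k => Nat.lt_succ_of_le (Finset.le_sup (Finset.mem_univ k))⟩
  have hcnt0 : ∀ l, L ≤ l → cnt w l = 0 := by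
    intro l hl
    by_contra h
    obtain ⟨k, hk⟩ := exists_of_cnt_pos (Nat.pos_of_ne_zero h)
    have := hL k
    omega
  set σ : Equiv.Perm (Fin L) := Tuple.sort fun l : Fin L => OrderDual.toDual (cnt w l)
  have hσ : ∀ a b : Fin L, a ≤ b → cnt w (σ b) ≤ cnt w (σ a) := fun a b hab =>
    Tuple.monotone_sort (fun l : Fin L => OrderDual.toDual (cnt w l)) hab
  -- `κ` lists the letters by decreasing multiplicity; it is the identity from `L` on, which makes
  -- it a bijection of `ℕ`.
  set κ : ℕ → ℕ := fun r => if h : r < L then σ ⟨r, h⟩ else r with hκ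
  have hκlt : ∀ r, r < L ↔ κ r < L := by
    intro r
    simp only [hκ]
    split_ifs with h
    · simp [h]
    · simp [h]
  have hκinj : Function.Injective κ := by
    intro a b hab
    by_cases ha : a < L
    · have hb : b < L := by rw [hκlt, ← hab, ← hκlt]; exact ha
      simp only [hκ, dif_pos ha, dif_pos hb] at hab
      simpa using σ.injective (Fin.ext hab)
    · have hb : ¬ b < L := by rw [hκlt, ← hab, ← hκlt]; exact ha
      simpa only [hκ, dif_neg ha, dif_neg hb] using hab
  have hκsurj : Function.Surjective κ := by
    intro l
    by_cases hl : l < L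
    · exact ⟨σ.symm ⟨l, hl⟩, by simp [hκ]⟩
    · exact ⟨l, by simp [hκ, hl]⟩
  have hanti : Antitone fun r => cnt w (κ r) := by
    intro a b hab
    by_cases hb : b < L
    · have ha : a < L := hab.trans_lt hb
      simp only [hκ, dif_pos ha, dif_pos hb]
      exact hσ _ _ hab
    · have : cnt w (κ b) = 0 := hcnt0 _ (not_lt.1 fun h => hb ((hκlt b).2 h))
      simp [this]
  have hκrange : (Finset.range L).image κ = Finset.range L := by
    apply Finset.eq_of_subset_of_card_le
    · intro l hl
      obtain ⟨r, hr, rfl⟩ := Finset.mem_image.1 hl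
      exact Finset.mem_range.2 ((hκlt r).1 (Finset.mem_range.1 hr))
    · rw [Finset.card_image_of_injective _ hκinj]
  obtain ⟨μ, hμ⟩ := exists_shape_rowLen (n := n) hanti
    (fun r hr => hcnt0 _ (not_lt.1 fun h => absurd ((hκlt r).2 h) (not_lt.2 hr)))
    (by
      refine Eq.trans ?_ (sum_cnt hL)
      conv_rhs => rw [← hκrange, Finset.sum_image fun a _ b _ h => hκinj h])
  have hcnt : ∀ l, cnt w l = cnt (κ ∘ μ.rowFn) l := by
    intro l
    obtain ⟨r, rfl⟩ := hκsurj l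
    rw [← hμ, ← Shape.cnt_rowFn]
    unfold cnt
    congr 1
    ext k
    simp [hκinj.eq_iff]
  obtain ⟨e, he⟩ := exists_perm_of_cnt_eq hcnt
  refine ⟨μ, κ, e, he, fun S => ?_⟩
  have h1 : S = (S.preimage κ hκinj.injOn).image κ := by
    ext l
    simp only [Finset.mem_image, Finset.mem_preimage]
    constructor
    · intro hl
      obtain ⟨r, rfl⟩ := hκsurj l
      exact ⟨r, hl, rfl⟩
    · rintro ⟨r, hr, rfl⟩; exact hr
  rw [h1, Finset.sum_image fun a _ b _ h => hκinj h, Finset.card_image_of_injective _ hκinj]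
  refine (sum_le_sum_range_of_antitone hanti _).trans (le_of_eq ?_)
  exact Finset.sum_congr rfl fun r _ => (hμ r).symm

/-! ## Two-sided ideals -/

section Ideals

variable {R : Type*} [CommRing R] (q : Rˣ) {n : ℕ}

theorem m_eq_symmetrizer (lam : Shape n) : Hecke.m q lam = symmetrizer q lam.rowFn := by
  classical
  rw [Hecke.m, symmetrizer]
  refine Finset.sum_congr (Finset.filter_congr fun v _ => ?_) fun v _ => ?_
  · rw [funext_iff]; rfl
  · rw [permLength_eq_inv]

theorem theta_rowWord (lam : Shape n) (t : lam.Std) :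
    theta q lam.rowFn (word R (lam.rowWord t.1)) = Hecke.m q lam * Hecke.T q (lam.perm t.1) := by
  rw [← lam.rowFn_comp_perm, theta_comp_symm q lam.rowFn_monotone _ (lam.incrOn_perm t),
    m_eq_symmetrizer]

theorem st_m (lam : Shape n) : Hecke.st q (Hecke.m q lam) = Hecke.m q lam := by
  rw [m_eq_symmetrizer, st_symmetrizer]

/-- The two-sided ideal generated by `m_lam`. -/
def twoSided (lam : Shape n) : Submodule R (Hecke q n) :=
  Submodule.span R {x | ∃ a b, x = a * Hecke.m q lam * b}

theorem mul_mem_twoSided {lam : Shape n} (a b : Hecke q n) {x : Hecke q n}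
    (hx : x ∈ twoSided q lam) : a * x * b ∈ twoSided q lam := by
  unfold twoSided at hx
  induction hx using Submodule.span_induction with
  | zero => simp
  | add x y _ _ hx hy => rw [mul_add, add_mul]; exact add_mem hx hy
  | smul r x _ hx => rw [mul_smul_comm, smul_mul_assoc]; exact Submodule.smul_mem _ _ hx
  | mem x hx =>
    obtain ⟨c, d, rfl⟩ := hx
    exact Submodule.subset_span ⟨a * c, d * b, by simp only [mul_assoc]⟩

/-- Rearrangements of a word generate the same module, since `T_i` is invertible with inverse `T_i -
(q - q⁻¹)`. -/
theorem exists_rmul_word_eq (e : Equiv.Perm (Fin n)) (w : Fin n → ℕ) :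
    ∃ h, rmul q h (word R (w ∘ e)) = word R w := by
  induction e using perm_induction generalizing w with
  | h1 => exact ⟨1, rmul_one q _⟩
  | h2 v i _ ih =>
    obtain ⟨h, hh⟩ := ih (w ∘ simpleTransposition i)
    suffices h2 : ∃ h', rmul q h' (word R (w ∘ simpleTransposition i)) = word R w by
      obtain ⟨h', hh'⟩ := h2
      refine ⟨h * h', ?_⟩
      rw [rmul_mul, Equiv.coe_trans, ← Function.comp_assoc, hh, hh']
    rcases lt_trichotomy (w (lo i)) (w (hi i)) with h | h | h
    · refine ⟨Hecke.gen q i + (-((q : R) - ((q⁻¹ : Rˣ) : R))) • 1, ?_⟩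
      rw [rmul_add, rmul_gen, rmul_smul, rmul_one, opT_gt q (by simpa using h), comp_simple_simple]
      module
    · exact ⟨1, by rw [rmul_one, comp_simple_of_eq h]⟩
    · refine ⟨Hecke.gen q i, ?_⟩
      rw [rmul_gen, opT_lt q (by simpa using h), comp_simple_simple]

/-- A homomorphism from words to the Hecke algebra maps a word to the two-sided ideal generated by
`m_μ`, where `μ` is obtained by sorting the content of the word. -/
theorem hom_word_mem_twoSided (φ : Words R n →ₗ[R] Hecke q n)
    (hφ : ∀ h x, φ (rmul q h x) = φ x * h) {w : Fin n → ℕ} {μ : Shape n} {κ : ℕ → ℕ}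
    {e : Equiv.Perm (Fin n)} (he : w ∘ e = κ ∘ μ.rowFn) : φ (word R w) ∈ twoSided q μ := by
  obtain ⟨h, hh⟩ := exists_rmul_word_eq (R := R) q e w
  rw [← hh, hφ, he]
  -- The word `κ ∘ μ.rowFn` is constant on the rows of `t^μ`, so the generators of the Young
  -- subgroup scale it, and hence its image, by `q`.
  have h1 : φ (word R (κ ∘ μ.rowFn)) ∈ Ideal.span {symmetrizer q μ.rowFn} := by
    refine mem_span_symmetrizer q μ.rowFn_monotone _ fun i hi => ?_
    rw [← hφ, rmul_gen, opT_eq q (by simp [hi]), map_smul]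
  obtain ⟨a, ha⟩ := Ideal.mem_span_singleton'.1 h1
  rw [← ha, ← m_eq_symmetrizer]
  exact Submodule.subset_span ⟨a, h, rfl⟩

theorem theta_word_eq_zero {lam : Shape n} {w : Fin n → ℕ} {l : ℕ}
    (h : cnt w l ≠ lam.diagram.rowLen l) : theta q lam.rowFn (word R w) = 0 := by
  classical
  rw [theta_word]
  refine Finset.sum_eq_zero fun v hv => ?_
  simp only [Finset.mem_filter, Finset.mem_univ, true_and] at hv
  exact absurd (by rw [← hv, cnt_comp_equiv, Shape.cnt_rowFn]) h

/-- The image of a divided power in the Hecke algebra lies in the ideal of a more dominant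
partition. -/
theorem theta_divPow_mem (lam : Shape n) {i k : ℕ} (hk : 1 ≤ k) (w : Fin n → ℕ) :
    theta q lam.rowFn (divPow q i n k (word R w)) = 0 ∨
      ∃ μ, lam < μ ∧ theta q lam.rowFn (divPow q i n k (word R w)) ∈ twoSided q μ := by
  by_cases hz : theta q lam.rowFn (divPow q i n k (word R w)) = 0
  · exact Or.inl hz
  right
  obtain ⟨μ, κ, e, he, hdom⟩ := exists_sorted w
  refine ⟨μ, ?_, hom_word_mem_twoSided q (theta q lam.rowFn ∘ₗ divPow q i n k) (fun h x => by
    rw [LinearMap.comp_apply, divPow_rmul, theta_rmul q lam.rowFn_monotone]; rfl) he⟩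
  -- `theta` kills every word whose content is not λ. A nonzero value therefore forces the content
  -- of `w` to be λ with `k` nodes moved from row `i + 1` up to row `i`.
  have hcont : ∀ l, lam.diagram.rowLen l + (if l = i then k else 0) =
      cnt w l + if l = i + 1 then k else 0 := by
    by_contra hc
    apply hz
    have := Submodule.mem_map_of_mem (f := theta q lam.rowFn) (divPow_word_mem (R := R) q i k w)
    rw [Submodule.map_span] at this
    rw [← Submodule.mem_bot R]
    refine (Submodule.span_le.2 ?_) this
    rintro _ ⟨_, ⟨v, hv, rfl⟩, rfl⟩
    rw [SetLike.mem_coe, Submodule.mem_bot]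
    by_cases hl : ∀ l, cnt v l = lam.diagram.rowLen l
    · exact absurd (fun l => by rw [← hl]; exact hv l) hc
    · push Not at hl
      obtain ⟨l, hl⟩ := hl
      exact theta_word_eq_zero q hl
  have hsum : ∀ r, lam.rowSum r + (if i < r then k else 0) =
      (∑ l ∈ Finset.range r, cnt w l) + if i + 1 < r then k else 0 := by
    intro r
    have := Finset.sum_congr (rfl : Finset.range r = Finset.range r) fun l _ => hcont l
    rw [Finset.sum_add_distrib, Finset.sum_add_distrib, Finset.sum_ite_eq', Finset.sum_ite_eq']
      at this
    simpa [Shape.rowSum] using this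
  have hle : ∀ r, ∑ l ∈ Finset.range r, cnt w l ≤ μ.rowSum r := fun r => by
    simpa using hdom (Finset.range r)
  -- The partial sums of the content of `w` are at least those of λ and exceed the one at `i + 1` by
  -- `k ≥ 1`; sorting only increases partial sums.
  refine lt_of_le_not_ge (fun r => ?_) fun h => ?_
  · have h1 := hsum r
    have h2 := hle r
    split_ifs at h1 <;> omega
  · have h1 := hsum (i + 1)
    have h2 := hle (i + 1)
    have h3 : μ.rowSum (i + 1) ≤ lam.rowSum (i + 1) := h (i + 1)
    simp at h1
    omega

/-! ## The cellular structure -/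

theorem Shape.mem_range {lam : Shape n} {x : ℕ × ℕ} (hx : x ∈ lam.diagram.cells) :
    x.1 < n ∧ x.2 < n := by
  constructor
  · have h : (Finset.range (x.1 + 1)).image (fun i => (i, x.2)) ⊆ lam.diagram.cells := by
      intro y hy
      obtain ⟨i, hi, rfl⟩ := Finset.mem_image.1 hy
      have hi' : i ≤ x.1 := by simpa [Nat.lt_succ_iff] using hi
      exact lam.diagram.isLowerSet (show (i, x.2) ≤ x from ⟨hi', le_rfl⟩) hx
    have h' := Finset.card_le_card h
    rw [Finset.card_image_of_injective _ (fun a b h => by simpa using h), Finset.card_range] at h'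
    have : lam.diagram.cells.card = n := lam.card_eq
    omega
  · have h : (Finset.range (x.2 + 1)).image (fun i => (x.1, i)) ⊆ lam.diagram.cells := by
      intro y hy
      obtain ⟨i, hi, rfl⟩ := Finset.mem_image.1 hy
      have hi' : i ≤ x.2 := by simpa [Nat.lt_succ_iff] using hi
      exact lam.diagram.isLowerSet (show (x.1, i) ≤ x from ⟨le_rfl, hi'⟩) hx
    have h' := Finset.card_le_card h
    rw [Finset.card_image_of_injective _ (fun a b h => by simpa using h), Finset.card_range] at h'
    have : lam.diagram.cells.card = n := lam.card_eq
    omega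

instance : Finite (Shape n) := by
  let f : Shape n → ((Finset.range n ×ˢ Finset.range n).powerset : Finset (Finset (ℕ × ℕ))) :=
    fun lam => ⟨lam.diagram.cells, by
      rw [Finset.mem_powerset]
      intro x hx
      have := Shape.mem_range hx
      simpa using this⟩
  refine Finite.of_injective f fun lam μ h => ?_
  have h1 : lam.diagram.cells = μ.diagram.cells := congrArg Subtype.val h
  exact Shape.ext (YoungDiagram.ext h1)

instance (lam : Shape n) : Finite lam.Std :=
  inferInstanceAs (Finite {t : lam.InjTableau // lam.IsStandard t})

instance : WellFoundedGT (Shape n) := Finite.to_wellFoundedGT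

theorem murphy_eq (lam : Shape n) (s t : lam.Std) : Hecke.murphy q n lam s t =
    Hecke.st q (Hecke.T q (lam.perm s.1)) * Hecke.m q lam * Hecke.T q (lam.perm t.1) := rfl

theorem st_murphy (lam : Shape n) (s t : lam.Std) :
    Hecke.st q (Hecke.murphy q n lam s t) = Hecke.murphy q n lam t s := by
  simp [murphy_eq, st_m, mul_assoc]

theorem murphy_mem_twoSided (lam : Shape n) (s t : lam.Std) :
    Hecke.murphy q n lam s t ∈ twoSided q lam := Submodule.subset_span ⟨_, _, murphy_eq q lam s t⟩

/-- The span of the Murphy basis elements for partitions that dominate `lam`. -/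
def cellSpan (lam : Shape n) : Submodule R (Hecke q n) :=
  Submodule.span R {x | ∃ μ : Shape n, lam ≤ μ ∧ ∃ s t : μ.Std, x = Hecke.murphy q n μ s t}

theorem strictSpan_le_cellSpan (lam : Shape n) :
    strictSpan R (Hecke.murphy q n) lam ≤ cellSpan q lam :=
  Submodule.span_mono fun _ ⟨μ, hμ, h⟩ => ⟨μ, hμ.le, h⟩

theorem cellSpan_le_strictSpan {lam μ : Shape n} (h : lam < μ) :
    cellSpan q μ ≤ strictSpan R (Hecke.murphy q n) lam :=
  Submodule.span_mono fun _ ⟨ν, hν, h'⟩ => ⟨ν, h.trans_le hν, h'⟩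

/-- The span of the elements `m_lam T_{w(t)}` for standard tableaux `t`. -/
def stdSpan (lam : Shape n) : Submodule R (Hecke q n) :=
  Submodule.span R (Set.range fun t : lam.Std => Hecke.m q lam * Hecke.T q (lam.perm t.1))

theorem Words.mem_of_word_mem (K : Submodule R (Words R n)) (h : ∀ w, word R w ∈ K)
    (x : Words R n) : x ∈ K := by
  induction x using Finsupp.induction_linear with
  | zero => exact zero_mem _
  | add x y hx hy => exact add_mem hx hy
  | single w r => rw [← mul_one r, ← smul_eq_mul, ← Finsupp.smul_single]; exact K.smul_mem _ (h w)

/-- The form in which straightening is applied; the bound on the letters is chosen from the word at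
hand. -/
theorem Words.mem_of_ballot (K : Submodule R (Words R n)) (hb : ∀ w, Ballot w → word R w ∈ K)
    (hK : ∀ i k w, 1 ≤ k → divPow q i n k (word R w) ∈ K) (x : Words R n) : x ∈ K := by
  refine Words.mem_of_word_mem K (fun w => ?_) x
  have hL : ∀ k, w k < Finset.univ.sup w + 1 :=
    fun k => Nat.lt_succ_of_le (Finset.le_sup (Finset.mem_univ k))
  have hle : ballotSpan R n (Finset.univ.sup w + 1) ⊔
      garnirSpan q n (Finset.univ.sup w + 1) ≤ K := by
    refine sup_le (Submodule.span_le.2 ?_) (Submodule.span_le.2 ?_)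
    · rintro _ ⟨v, hv, -, rfl⟩
      exact hb v hv
    · rintro _ ⟨i, k, v, hk, -, -, rfl⟩
      exact hK i k v hk
  exact hle (straightening q w hL)

theorem theta_divPow_mem_strictSpan {lam : Shape n}
    (IH : ∀ μ, lam < μ → twoSided q μ ≤ cellSpan q μ) {i k : ℕ} (hk : 1 ≤ k) (w : Fin n → ℕ) :
    theta q lam.rowFn (divPow q i n k (word R w)) ∈ strictSpan R (Hecke.murphy q n) lam := by
  rcases theta_divPow_mem q lam (i := i) hk w with h | ⟨μ, hμ, h⟩
  · rw [h]; exact zero_mem _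
  · exact cellSpan_le_strictSpan q hμ (IH μ hμ h)

/-- `m_λ h` is the image under `theta` of a combination of words. After straightening, ballot words
of content λ give the elements `m_λ T_{w(t)}`, other ballot words vanish, and divided powers fall
into higher cells. -/
theorem m_mul_mem_of_le {lam : Shape n}
    (IH : ∀ μ, lam < μ → twoSided q μ ≤ cellSpan q μ) (h : Hecke q n) :
    Hecke.m q lam * h ∈ stdSpan q lam ⊔ strictSpan R (Hecke.murphy q n) lam := by
  rw [m_eq_symmetrizer, ← theta_self q lam.rowFn_monotone, ← theta_rmul q lam.rowFn_monotone,
    ← Submodule.mem_comap]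
  refine Words.mem_of_ballot q _ (fun w hw => ?_) (fun i k w hk => ?_) _
  · rw [Submodule.mem_comap]
    by_cases hl : ∀ l, cnt w l = lam.diagram.rowLen l
    · obtain ⟨t, rfl⟩ := exists_std_of_ballot lam hw hl
      rw [theta_rowWord]
      exact Submodule.mem_sup_left (Submodule.subset_span ⟨t, rfl⟩)
    · push Not at hl
      obtain ⟨l, hl⟩ := hl
      rw [theta_word_eq_zero q hl]
      exact zero_mem _
  · exact Submodule.mem_sup_right (theta_divPow_mem_strictSpan q IH hk w)

theorem mul_mem_strictSpan_of_le {lam : Shape n}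
    (IH : ∀ μ, lam < μ → twoSided q μ ≤ cellSpan q μ) (a b : Hecke q n) {x : Hecke q n}
    (hx : x ∈ strictSpan R (Hecke.murphy q n) lam) :
    a * x * b ∈ strictSpan R (Hecke.murphy q n) lam := by
  unfold strictSpan at hx
  induction hx using Submodule.span_induction with
  | zero => simp
  | add x y _ _ hx hy => rw [mul_add, add_mul]; exact add_mem hx hy
  | smul r x _ hx =>
    rw [mul_smul_comm, smul_mul_assoc]; exact Submodule.smul_mem _ _ hx
  | mem x h =>
    obtain ⟨μ, hμ, s, t, rfl⟩ := h
    exact cellSpan_le_strictSpan q hμ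
      (IH μ hμ (mul_mem_twoSided q a b (murphy_mem_twoSided q μ s t)))

theorem st_mem_strictSpan {lam : Shape n} {x : Hecke q n}
    (hx : x ∈ strictSpan R (Hecke.murphy q n) lam) :
    Hecke.st q x ∈ strictSpan R (Hecke.murphy q n) lam := by
  rw [← Submodule.mem_comap]
  refine (Submodule.span_le.2 ?_) hx
  rintro _ ⟨μ, hμ, s, t, rfl⟩
  rw [SetLike.mem_coe, Submodule.mem_comap, st_murphy]
  exact Submodule.subset_span ⟨μ, hμ, t, s, rfl⟩

/-- Downward induction on dominance. In `a m_λ b` the right factor is straightened directly and the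
left one after applying `*`; the errors lie in higher cells, whose span is a two-sided ideal by
induction. -/
theorem twoSided_le_cellSpan (lam : Shape n) : twoSided q lam ≤ cellSpan q lam := by
  induction lam using WellFoundedGT.induction with
  | ind lam IH =>
  refine Submodule.span_le.2 ?_
  rintro _ ⟨a, b, rfl⟩
  have hleft : ∀ t : lam.Std, a * Hecke.m q lam * Hecke.T q (lam.perm t.1) ∈ cellSpan q lam := by
    intro t
    have h1 := m_mul_mem_of_le q IH (Hecke.st q a)
    have h2 : stdSpan q lam ⊔ strictSpan R (Hecke.murphy q n) lam ≤ (cellSpan q lam).comap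
        (LinearMap.mulRight R (Hecke.T q (lam.perm t.1)) ∘ₗ Hecke.st q) := by
      refine sup_le (Submodule.span_le.2 ?_) fun x hx => ?_
      · rintro _ ⟨s, rfl⟩
        simp only [SetLike.mem_coe, Submodule.mem_comap, LinearMap.comp_apply,
          LinearMap.mulRight_apply, Hecke.st_mul, st_m]
        exact Submodule.subset_span ⟨lam, le_rfl, s, t, rfl⟩
      · simp only [Submodule.mem_comap, LinearMap.comp_apply, LinearMap.mulRight_apply]
        have := mul_mem_strictSpan_of_le q IH 1 (Hecke.T q (lam.perm t.1)) (st_mem_strictSpan q hx)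
        rw [one_mul] at this
        exact strictSpan_le_cellSpan q lam this
    have h3 := h2 h1
    simpa [st_m] using h3
  have h1 := m_mul_mem_of_le q IH b
  have h2 : stdSpan q lam ⊔ strictSpan R (Hecke.murphy q n) lam ≤ (cellSpan q lam).comap
      (LinearMap.mulLeft R a) := by
    refine sup_le (Submodule.span_le.2 ?_) fun x hx => ?_
    · rintro _ ⟨t, rfl⟩
      simp only [SetLike.mem_coe, Submodule.mem_comap, LinearMap.mulLeft_apply]
      rw [← mul_assoc]
      exact hleft t
    · simp only [Submodule.mem_comap, LinearMap.mulLeft_apply]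
      have := mul_mem_strictSpan_of_le q IH a 1 hx
      rw [mul_one] at this
      exact strictSpan_le_cellSpan q lam this
  have h3 := h2 h1
  simp only [Submodule.mem_comap, LinearMap.mulLeft_apply] at h3
  rwa [SetLike.mem_coe, mul_assoc]

theorem m_mul_mem (lam : Shape n) (h : Hecke q n) :
    Hecke.m q lam * h ∈ stdSpan q lam ⊔ strictSpan R (Hecke.murphy q n) lam :=
  m_mul_mem_of_le q (fun μ _ => twoSided_le_cellSpan q μ) h

theorem mul_mem_strictSpan {lam : Shape n} (a b : Hecke q n) {x : Hecke q n}
    (hx : x ∈ strictSpan R (Hecke.murphy q n) lam) :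
    a * x * b ∈ strictSpan R (Hecke.murphy q n) lam :=
  mul_mem_strictSpan_of_le q (fun μ _ => twoSided_le_cellSpan q μ) a b hx

theorem theta_divPow_mem_strict (lam : Shape n) {i k : ℕ} (hk : 1 ≤ k) (w : Fin n → ℕ) :
    theta q lam.rowFn (divPow q i n k (word R w)) ∈ strictSpan R (Hecke.murphy q n) lam :=
  theta_divPow_mem_strictSpan q (fun μ _ => twoSided_le_cellSpan q μ) hk w

/-- The coefficients come from expanding `m_λ T_{w(t)} a`, before `T_{w(s)}^*` is multiplied on the
left; hence they do not depend on `s`. -/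
theorem murphy_mul_mem (lam : Shape n) (t : lam.Std) (a : Hecke q n) : ∃ r : lam.Std →₀ R,
    ∀ s : lam.Std, Hecke.murphy q n lam s t * a -
      r.linearCombination R (Hecke.murphy q n lam s) ∈ strictSpan R (Hecke.murphy q n) lam := by
  have h := m_mul_mem q lam (Hecke.T q (lam.perm t.1) * a)
  obtain ⟨y, hy, z, hz, hyz⟩ := Submodule.mem_sup.1 h
  rw [stdSpan, Finsupp.mem_span_range_iff_exists_finsupp] at hy
  obtain ⟨r, rfl⟩ := hy
  refine ⟨r, fun s => ?_⟩
  have h1 := mul_mem_strictSpan q (Hecke.st q (Hecke.T q (lam.perm s.1))) 1 hz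
  rw [mul_one] at h1
  convert h1 using 1
  have h2 : Hecke.st q (Hecke.T q (lam.perm s.1)) *
      r.linearCombination R (fun t : lam.Std => Hecke.m q lam * Hecke.T q (lam.perm t.1)) =
      r.linearCombination R (Hecke.murphy q n lam s) := by
    rw [Finsupp.linearCombination_apply, Finsupp.linearCombination_apply, Finsupp.sum, Finsupp.sum,
      Finset.mul_sum]
    refine Finset.sum_congr rfl fun i _ => ?_
    rw [mul_smul_comm, murphy_eq, mul_assoc]
  rw [Finsupp.linearCombination_apply, Finsupp.linearCombination_apply] at h2
  rw [murphy_eq, mul_assoc, mul_assoc, ← hyz, mul_add, h2, Finsupp.linearCombination_apply,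
    add_sub_cancel_left]

/-- The word with distinct letters has trivial stabilizer and symmetrizer `1`. So `1` lies in some
ideal `twoSided q μ`, and the span of the Murphy elements is everything. -/
theorem span_murphy : Submodule.span R (Set.range fun x : (lam : Shape n) × (lam.Std × lam.Std) =>
    Hecke.murphy q n x.1 x.2.1 x.2.2) = ⊤ := by
  rw [eq_top_iff]
  intro x _
  set w : Fin n → ℕ := fun k => k
  obtain ⟨μ, κ, e, he, -⟩ := exists_sorted w
  have hw : Monotone w := fun a b h => h
  have h1 := hom_word_mem_twoSided q (theta q w) (theta_rmul q hw) he
  rw [theta_self q hw] at h1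
  have h2 : symmetrizer q w = 1 := by
    classical
    rw [symmetrizer, Finset.sum_eq_single (Equiv.refl _)]
    · rw [inv_refl, pow_zero, one_smul, Hecke.T_refl]
    · intro v hv hne
      simp only [Finset.mem_filter, Finset.mem_univ, true_and] at hv
      exact absurd (Equiv.ext fun k => Fin.ext (congrFun hv k)) hne
    · intro h; exact absurd (by simp) h
  rw [h2] at h1
  have h3 := twoSided_le_cellSpan q μ (mul_mem_twoSided q x 1 h1)
  rw [mul_one, mul_one] at h3
  refine Submodule.span_mono ?_ h3
  rintro _ ⟨μ, -, s, t, rfl⟩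
  exact ⟨⟨μ, s, t⟩, rfl⟩

end Ideals

end HeckeCell

end


noncomputable section

namespace HeckeCell

/-! ### Counting standard tableaux in Young's lattice. -/

section Counting

open scoped Classical

namespace Shape

variable {n : ℕ}

theorem Std.lt_of_le {lam : Shape n} (t : lam.Std) {x y : {x // x ∈ lam.diagram.cells}}
    (h : x.1 ≤ y.1) (hne : x ≠ y) : t.1 x < t.1 y := by
  obtain ⟨⟨a, b⟩, hx⟩ := x
  obtain ⟨⟨c, d⟩, hy⟩ := y
  obtain ⟨hac, hbd⟩ := Prod.mk_le_mk.1 h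
  have hz : (a, d) ∈ lam.diagram.cells :=
    lam.diagram.isLowerSet (show (a, d) ≤ (c, d) from ⟨hac, le_rfl⟩) hy
  have h1 : b < d → t.1 ⟨(a, b), hx⟩ < t.1 ⟨(a, d), hz⟩ := fun h => t.2.1 ⟨_, hx⟩ ⟨_, hz⟩ rfl h
  have h2 : a < c → t.1 ⟨(a, d), hz⟩ < t.1 ⟨(c, d), hy⟩ := fun h => t.2.2 ⟨_, hz⟩ ⟨_, hy⟩ rfl h
  rcases hac.lt_or_eq with h3 | rfl
  · rcases hbd.lt_or_eq with h4 | rfl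
    · exact (h1 h4).trans (h2 h3)
    · exact h2 h3
  · rcases hbd.lt_or_eq with h4 | rfl
    · exact h1 h4
    · exact absurd rfl hne

theorem Std.isRemovable_lastNode {lam : Shape (n + 1)} (t : lam.Std) :
    lam.IsRemovable t.lastNode := by
  have hmem := (t.1.symm (Fin.last n)).2
  refine ⟨hmem, fun a b hba ha => ?_⟩
  simp only [Finset.coe_erase, Set.mem_sdiff, Finset.mem_coe, Set.mem_singleton_iff] at ha ⊢
  refine ⟨lam.diagram.isLowerSet hba ha.1, fun hb => ?_⟩
  have := t.lt_of_le (x := t.1.symm (Fin.last n)) (y := ⟨a, ha.1⟩) (le_trans hb.ge hba)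
    (fun h => ha.2 (by rw [Std.lastNode, h]))
  rw [Equiv.apply_symm_apply] at this
  exact absurd this (not_lt.2 (Fin.le_last _))

theorem adjoin_apply {lam : Shape (n + 1)} {α : ℕ × ℕ} (hα : lam.IsRemovable α)
    (s : (lam.remove α hα).Std) (x : {x // x ∈ lam.diagram.cells}) :
    (adjoin hα s).1 x = adjoinFun hα s.1 x := rfl

theorem lastNode_adjoin {lam : Shape (n + 1)} {α : ℕ × ℕ} (hα : lam.IsRemovable α)
    (s : (lam.remove α hα).Std) : (adjoin hα s).lastNode = α := by
  have : (adjoin hα s).1.symm (Fin.last n) = ⟨α, hα.1⟩ := by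
    rw [Equiv.symm_apply_eq, adjoin_apply, adjoinFun, dif_pos rfl]
  rw [Std.lastNode, this]

theorem adjoin_injective {lam : Shape (n + 1)} {α : ℕ × ℕ} (hα : lam.IsRemovable α) :
    Function.Injective (adjoin hα) := by
  intro s s' h
  refine Subtype.ext (Equiv.ext fun x => ?_)
  have hx : x.1 ∈ lam.diagram.cells ∧ x.1 ≠ α := by
    have := Finset.mem_erase.1 x.2
    exact ⟨this.2, this.1⟩
  have h1 : (adjoin hα s).1 ⟨x.1, hx.1⟩ = (adjoin hα s').1 ⟨x.1, hx.1⟩ := by rw [h]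
  simp only [adjoin_apply, adjoinFun] at h1
  rw [dif_neg hx.2, dif_neg hx.2] at h1
  exact Fin.castSucc_injective _ h1

theorem exists_adjoin {lam : Shape (n + 1)} {α : ℕ × ℕ} (hα : lam.IsRemovable α) (t : lam.Std)
    (ht : t.lastNode = α) : ∃ s, adjoin hα s = t := by
  have hmem : ∀ x : {x // x ∈ (lam.remove α hα).diagram.cells}, x.1 ∈ lam.diagram.cells :=
    fun x => (Finset.mem_erase.1 x.2).2
  have hne : ∀ x : {x // x ∈ (lam.remove α hα).diagram.cells},
      t.1 ⟨x.1, hmem x⟩ ≠ Fin.last n := fun x h => by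
    rw [← Equiv.eq_symm_apply] at h
    have h' := congrArg Subtype.val h
    exact (Finset.mem_erase.1 x.2).1 (h'.trans ht)
  refine ⟨⟨(lam.remove α hα).mkTableau (fun x => (t.1 ⟨x.1, hmem x⟩).castPred (hne x))
    fun x y h => ?_, fun x y h h' => ?_, fun x y h h' => ?_⟩, ?_⟩
  · have := t.1.injective (Fin.castPred_inj.1 h)
    exact Subtype.ext (Subtype.mk.inj this)
  · exact (Fin.castPred_lt_castPred_iff (hi := hne x) (hj := hne y)).2
      (t.2.1 ⟨x.1, hmem x⟩ ⟨y.1, hmem y⟩ h h')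
  · exact (Fin.castPred_lt_castPred_iff (hi := hne x) (hj := hne y)).2
      (t.2.2 ⟨x.1, hmem x⟩ ⟨y.1, hmem y⟩ h h')
  · refine Subtype.ext (Equiv.ext fun x => ?_)
    refine (adjoin_apply hα _ x).trans ?_
    rw [adjoinFun]
    split_ifs with h
    · have : x = t.1.symm (Fin.last n) := Subtype.ext (h.trans ht.symm)
      rw [this, Equiv.apply_symm_apply]
    · exact Fin.castSucc_castPred _ (hne ⟨x.1, mem_remove hα x.2 h⟩)

instance : Fintype (Shape n) := Fintype.ofFinite _

/-- The partitions obtained by adding a node to `μ`. -/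
def up (μ : Shape n) : Finset (Shape (n + 1)) := {lam | μ.diagram ≤ lam.diagram}

/-- The partitions obtained by removing a node of `lam`. -/
def down (lam : Shape (n + 1)) : Finset (Shape n) := {κ | κ.diagram ≤ lam.diagram}

theorem mem_up {μ : Shape n} {lam : Shape (n + 1)} :
    lam ∈ μ.up ↔ μ.diagram.cells ⊆ lam.diagram.cells := by
  simp [up, YoungDiagram.cells_subset_iff]

theorem mem_down {μ : Shape n} {lam : Shape (n + 1)} :
    μ ∈ lam.down ↔ μ.diagram.cells ⊆ lam.diagram.cells := by
  simp [down, YoungDiagram.cells_subset_iff]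

theorem ext_cells {κ μ : Shape n} (h : κ.diagram.cells = μ.diagram.cells) : κ = μ :=
  Shape.ext (YoungDiagram.ext h)

theorem card_cells (κ : Shape n) : κ.diagram.cells.card = n := κ.card_eq

theorem eq_of_subset {κ μ : Shape n} (h : κ.diagram.cells ⊆ μ.diagram.cells) : κ = μ :=
  ext_cells (Finset.eq_of_subset_of_card_le h (by rw [card_cells, card_cells]))

theorem exists_insert {κ : Shape n} {lam : Shape (n + 1)}
    (h : κ.diagram.cells ⊆ lam.diagram.cells) :
    ∃ α, α ∉ κ.diagram.cells ∧ insert α κ.diagram.cells = lam.diagram.cells ∧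
      α.2 = κ.diagram.rowLen α.1 := by
  obtain ⟨α, hα, h'⟩ := Finset.exists_eq_insert_iff.2 ⟨h, by rw [card_cells, card_cells]⟩
  refine ⟨α, hα, h', ?_⟩
  by_contra hne
  have h1 : κ.diagram.rowLen α.1 < α.2 := by
    have : ¬ α.2 < κ.diagram.rowLen α.1 := fun h => hα (YoungDiagram.mem_iff_lt_rowLen.2 h)
    omega
  have h2 : α ∈ lam.diagram.cells := h' ▸ Finset.mem_insert_self _ _
  have h3 : (α.1, κ.diagram.rowLen α.1) ∈ lam.diagram.cells :=
    lam.diagram.isLowerSet (show (α.1, κ.diagram.rowLen α.1) ≤ α from ⟨le_rfl, h1.le⟩) h2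
  rw [← h', Finset.mem_insert] at h3
  rcases h3 with h3 | h3
  · rw [← h3] at h1
    exact lt_irrefl _ h1
  · exact lt_irrefl _ (YoungDiagram.mem_iff_lt_rowLen.1 h3)

theorem card_std_eq_sum (lam : Shape (n + 1)) :
    Nat.card lam.Std = ∑ κ ∈ lam.down, Nat.card κ.Std := by
  have hfin : Finite {α // lam.IsRemovable α} :=
    Finite.of_injective (β := {x // x ∈ lam.diagram.cells}) (fun α => ⟨α.1, α.2.1⟩)
      fun a b h => Subtype.ext (Subtype.mk.inj h)
  have := Fintype.ofFinite {α // lam.IsRemovable α}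
  have h1 : Nat.card lam.Std =
      Nat.card (Σ α : {α // lam.IsRemovable α}, (lam.remove α.1 α.2).Std) := by
    refine (Nat.card_congr (Equiv.ofBijective (fun x => adjoin x.1.2 x.2) ⟨?_, fun t => ?_⟩)).symm
    · rintro ⟨⟨α, hα⟩, s⟩ ⟨⟨β, hβ⟩, s'⟩ h
      have h' := congrArg Std.lastNode h
      simp only [lastNode_adjoin] at h'
      subst h'
      obtain rfl := adjoin_injective hα h
      rfl
    · obtain ⟨s, hs⟩ := exists_adjoin t.isRemovable_lastNode t rfl
      exact ⟨⟨⟨_, t.isRemovable_lastNode⟩, s⟩, hs⟩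
  rw [h1, Nat.card_sigma]
  refine Finset.sum_bij (fun α _ => lam.remove α.1 α.2) (fun α _ => ?_) (fun α _ β _ h => ?_)
    (fun κ hκ => ?_) fun _ _ => rfl
  · exact mem_down.2 (Finset.erase_subset _ _)
  · have h' : lam.diagram.cells.erase α.1 = lam.diagram.cells.erase β.1 :=
      congrArg (fun κ : Shape n => κ.diagram.cells) h
    by_contra hne
    have : β.1 ∈ lam.diagram.cells.erase α.1 :=
      Finset.mem_erase.2 ⟨fun h => hne (Subtype.ext h.symm), β.2.1⟩
    rw [h'] at this
    exact absurd rfl (Finset.mem_erase.1 this).1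
  · obtain ⟨α, hα, h, -⟩ := exists_insert (mem_down.1 hκ)
    have h' : lam.diagram.cells.erase α = κ.diagram.cells := by
      rw [← h, Finset.erase_insert hα]
    refine ⟨⟨α, (h ▸ Finset.mem_insert_self _ _ : α ∈ lam.diagram.cells), ?_⟩, Finset.mem_univ _,
      ext_cells h'⟩
    rw [h']
    exact κ.diagram.isLowerSet

/-- A common cover of two different diagrams of equal size is their union. If it exists,
inclusion–exclusion shows that the intersection is covered by both. -/
theorem card_up_inter_le {μ ν : Shape (n + 1)} (hne : ν ≠ μ) :
    (μ.up ∩ ν.up).card ≤ (μ.down ∩ ν.down).card := by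
  rcases (μ.up ∩ ν.up).eq_empty_or_nonempty with h | ⟨lam, hlam⟩
  · simp [h]
  have hunion : ∀ lam ∈ μ.up ∩ ν.up,
      lam.diagram.cells = μ.diagram.cells ∪ ν.diagram.cells := by
    intro lam hlam
    rw [Finset.mem_inter, mem_up, mem_up] at hlam
    refine (Finset.eq_of_subset_of_card_le (Finset.union_subset hlam.1 hlam.2) ?_).symm
    by_contra hlt
    rw [card_cells, not_le] at hlt
    have h1 := Finset.eq_of_subset_of_card_le (s := μ.diagram.cells)
      (Finset.subset_union_left (s₂ := ν.diagram.cells)) (by rw [card_cells]; omega)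
    exact hne (eq_of_subset (by rw [h1]; exact Finset.subset_union_right))
  have h1 : (μ.up ∩ ν.up).card ≤ 1 := Finset.card_le_one.2 fun a ha b hb =>
    ext_cells ((hunion a ha).trans (hunion b hb).symm)
  refine h1.trans (Finset.card_pos.2 ⟨⟨μ.diagram ⊓ ν.diagram, ?_⟩, ?_⟩)
  · have h2 := Finset.card_union_add_card_inter μ.diagram.cells ν.diagram.cells
    rw [← hunion lam hlam, card_cells, card_cells, card_cells] at h2
    have h3 : (μ.diagram ⊓ ν.diagram).card = (μ.diagram.cells ∩ ν.diagram.cells).card := by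
      rw [← YoungDiagram.cells_inf]
    omega
  · rw [Finset.mem_inter, mem_down, mem_down]
    simp only [YoungDiagram.cells_inf]
    exact ⟨Finset.inter_subset_left, Finset.inter_subset_right⟩

/-- A node addable in row `i + 1` forces row `i` to be strictly longer, so row `i` ends in a
removable node. Only an addition to row `0` has no counterpart. -/
theorem card_up_le (μ : Shape (n + 1)) : μ.up.card ≤ μ.down.card + 1 := by
  have hup : ∀ lam : Shape (n + 2), ∃ i, lam ∈ μ.up →
      (i, μ.diagram.rowLen i) ∉ μ.diagram.cells ∧
      insert (i, μ.diagram.rowLen i) μ.diagram.cells = lam.diagram.cells := by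
    intro lam
    by_cases h : lam ∈ μ.up
    · obtain ⟨⟨a, b⟩, h1, h2, h3⟩ := exists_insert (mem_up.1 h)
      simp only at h3
      subst h3
      exact ⟨a, fun _ => ⟨h1, h2⟩⟩
    · exact ⟨0, fun h' => absurd h' h⟩
  choose f hf using hup
  have hdown : ∀ lam ∈ μ.up, f lam ≠ 0 → ∃ κ ∈ μ.down,
      insert (f lam - 1, μ.diagram.rowLen (f lam - 1) - 1) κ.diagram.cells =
        μ.diagram.cells ∧ (f lam - 1, μ.diagram.rowLen (f lam - 1) - 1) ∉ κ.diagram.cells := by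
    intro lam hlam h0
    obtain ⟨h1, h2⟩ := hf lam hlam
    set i := f lam - 1
    have hi : f lam = i + 1 := by omega
    rw [hi] at h1 h2
    have hlt : μ.diagram.rowLen (i + 1) < μ.diagram.rowLen i := by
      have h3 : (i, μ.diagram.rowLen (i + 1)) ∈ lam.diagram.cells :=
        lam.diagram.isLowerSet
          (show (i, μ.diagram.rowLen (i + 1)) ≤ (i + 1, μ.diagram.rowLen (i + 1)) from
            ⟨Nat.le_succ i, le_rfl⟩) (h2 ▸ Finset.mem_insert_self _ _)
      rw [← h2, Finset.mem_insert] at h3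
      rcases h3 with h3 | h3
      · simp at h3
      · exact YoungDiagram.mem_iff_lt_rowLen.1 h3
    have hmem : (i, μ.diagram.rowLen i - 1) ∈ μ.diagram.cells :=
      YoungDiagram.mem_iff_lt_rowLen.2 (show _ - 1 < _ by omega)
    have hrem : μ.IsRemovable (i, μ.diagram.rowLen i - 1) := by
      refine ⟨hmem, fun a b hba ha => ?_⟩
      simp only [Finset.coe_erase, Set.mem_sdiff, Finset.mem_coe, Set.mem_singleton_iff] at ha ⊢
      refine ⟨μ.diagram.isLowerSet hba ha.1, ?_⟩
      rintro rfl
      obtain ⟨a1, a2⟩ := a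
      obtain ⟨h3, h4⟩ := Prod.mk_le_mk.1 hba
      have h5 : a2 < μ.diagram.rowLen a1 := YoungDiagram.mem_iff_lt_rowLen.1 ha.1
      rcases h3.lt_or_eq with h6 | rfl
      · have := μ.diagram.rowLen_anti (i + 1) a1 h6
        omega
      · exact ha.2 (by rw [Prod.mk.injEq]; omega)
    exact ⟨μ.remove _ hrem, mem_down.2 (Finset.erase_subset _ _), Finset.insert_erase hmem,
      Finset.notMem_erase _ _⟩
  have hinj : Set.InjOn f μ.up := by
    intro a ha b hb h
    refine ext_cells ?_
    rw [← (hf a ha).2, ← (hf b hb).2, h]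
  have h0 : (μ.up.filter (f · = 0)).card ≤ 1 := Finset.card_le_one.2 fun a ha b hb => by
    rw [Finset.mem_filter] at ha hb
    exact hinj ha.1 hb.1 (ha.2.trans hb.2.symm)
  have h1 : (μ.up.filter (¬ f · = 0)).card ≤ μ.down.card := by
    rcases isEmpty_or_nonempty (Shape n) with hemp | hemp
    · rw [Finset.filter_eq_empty_iff.2 fun lam hlam h0 => hemp.elim (hdown lam hlam h0).choose]
      exact Nat.zero_le _
    choose! g hg using hdown
    refine Finset.card_le_card_of_injOn g (fun a ha => ?_) fun a ha b hb h => ?_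
    · simp only [Finset.coe_filter, Set.mem_ofPred_eq] at ha
      exact (hg a ha.1 ha.2).1
    · simp only [Finset.coe_filter, Set.mem_ofPred_eq] at ha hb
      obtain ⟨-, h2, h3⟩ := hg a ha.1 ha.2
      obtain ⟨-, h4, h5⟩ := hg b hb.1 hb.2
      rw [h] at h2 h3
      have h6 : (f a - 1, μ.diagram.rowLen (f a - 1) - 1) ∈ μ.diagram.cells :=
        h2 ▸ Finset.mem_insert_self _ _
      rw [← h4, Finset.mem_insert] at h6
      rcases h6 with h6 | h6
      · rw [Prod.mk.injEq] at h6
        exact hinj ha.1 hb.1 (by omega)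
      · exact absurd h6 h3
  have h2 : (μ.up.filter (f · = 0)).card + (μ.up.filter (¬ f · = 0)).card = μ.up.card := by
    convert Finset.card_filter_add_card_filter_not (s := μ.up) (f · = 0)
  omega

theorem subsingleton_of_le_one (hn : n ≤ 1) (κ μ : Shape n) : κ = μ := by
  refine eq_of_subset fun x hx => ?_
  have h1 : ∀ ν : Shape n, ∀ y ∈ ν.diagram.cells, ((0, 0) : ℕ × ℕ) ∈ ν.diagram.cells :=
    fun ν y hy => ν.diagram.isLowerSet
      (show ((0, 0) : ℕ × ℕ) ≤ y from ⟨Nat.zero_le _, Nat.zero_le _⟩) hy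
  have h2 := Finset.card_pos.2 ⟨x, hx⟩
  obtain ⟨y, hy⟩ := Finset.card_pos.1 (show 0 < μ.diagram.cells.card by
    rw [card_cells] at h2 ⊢; exact h2)
  have h3 := Finset.card_le_one.1 (show κ.diagram.cells.card ≤ 1 by rw [card_cells]; exact hn)
    x hx _ (h1 κ x hx)
  rw [h3]
  exact h1 μ y hy

/-- The differential poset argument: adding then removing a node exceeds removing then adding by at
most the identity. Applied to the numbers of tableaux this gives the induction step; the inequality
is enough for the basis theorem. -/
theorem sum_up_card_std_le (μ : Shape n) :
    ∑ lam ∈ μ.up, Nat.card lam.Std ≤ (n + 1) * Nat.card μ.Std := by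
  induction n with
  | zero =>
    have h1 : ∀ lam ∈ μ.up, Nat.card lam.Std ≤ Nat.card μ.Std := fun lam _ => by
      rw [card_std_eq_sum]
      refine (Finset.sum_le_sum_of_subset (t := {μ}) fun κ _ => ?_).trans (by simp)
      exact Finset.mem_singleton.2 (subsingleton_of_le_one zero_le_one κ μ)
    refine (Finset.sum_le_card_nsmul _ _ _ h1).trans ?_
    rw [smul_eq_mul]
    exact Nat.mul_le_mul_right _
      (Finset.card_le_one.2 fun a _ b _ => subsingleton_of_le_one le_rfl a b)
  | succ n ih =>
    have h1 : ∑ lam ∈ μ.up, Nat.card lam.Std =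
        ∑ ν : Shape (n + 1), (μ.up ∩ ν.up).card * Nat.card ν.Std := by
      rw [Finset.sum_congr rfl fun lam _ => card_std_eq_sum lam,
        Finset.sum_comm' (t' := Finset.univ) (s' := fun ν => μ.up ∩ ν.up)]
      · simp
      · intro lam ν
        simp [mem_up, mem_down]
    have h2 : ∑ κ ∈ μ.down, ∑ ν ∈ κ.up, Nat.card ν.Std =
        ∑ ν : Shape (n + 1), (μ.down ∩ ν.down).card * Nat.card ν.Std := by
      rw [Finset.sum_comm' (t' := Finset.univ) (s' := fun ν => μ.down ∩ ν.down)]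
      · simp
      · intro κ ν
        simp [mem_up, mem_down]
    have h3 : ∑ κ ∈ μ.down, ∑ ν ∈ κ.up, Nat.card ν.Std ≤ (n + 1) * Nat.card μ.Std := by
      rw [card_std_eq_sum, Finset.mul_sum]
      exact Finset.sum_le_sum fun κ _ => ih κ
    -- The diagonal term `ν = μ` is the only one that can gain, and it gains at most one copy of the
    -- number of tableaux of shape μ.
    have h4 : ∑ ν : Shape (n + 1), (μ.up ∩ ν.up).card * Nat.card ν.Std ≤
        ∑ ν : Shape (n + 1), ((μ.down ∩ ν.down).card * Nat.card ν.Std +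
          if ν = μ then Nat.card μ.Std else 0) := by
      refine Finset.sum_le_sum fun ν _ => ?_
      split_ifs with h
      · subst h
        rw [Finset.inter_self, Finset.inter_self, ← Nat.succ_mul]
        exact Nat.mul_le_mul_right _ (card_up_le ν)
      · exact Nat.mul_le_mul_right _ (card_up_inter_le h)
    rw [Finset.sum_add_distrib, ← h2, Finset.sum_ite_eq' Finset.univ μ] at h4
    simp only [Finset.mem_univ, if_true] at h4
    rw [h1]
    linarith

theorem sum_card_std_sq_le (n : ℕ) : ∑ lam : Shape n, Nat.card lam.Std ^ 2 ≤ n.factorial := by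
  induction n with
  | zero =>
    have h1 : ∀ lam : Shape 0, Nat.card lam.Std ≤ 1 := fun lam => by
      have : Subsingleton lam.Std := ⟨fun s t => Subtype.ext (Equiv.ext fun x => (s.1 x).elim0)⟩
      exact Finite.card_le_one_iff_subsingleton.2 this
    refine (Finset.sum_le_card_nsmul _ _ 1 fun lam _ =>
      (Nat.pow_le_one_iff (by norm_num)).2 (h1 lam)).trans ?_
    rw [smul_eq_mul, mul_one, Nat.factorial_zero]
    exact Finset.card_le_one.2 fun a _ b _ => subsingleton_of_le_one zero_le_one a b
  | succ n ih =>
    have h1 : ∑ lam : Shape (n + 1), Nat.card lam.Std ^ 2 =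
        ∑ κ : Shape n, Nat.card κ.Std * ∑ lam ∈ κ.up, Nat.card lam.Std := by
      have : ∀ lam : Shape (n + 1), Nat.card lam.Std ^ 2 =
          ∑ κ ∈ lam.down, Nat.card κ.Std * Nat.card lam.Std := fun lam => by
        rw [← Finset.sum_mul, ← card_std_eq_sum, sq]
      rw [Finset.sum_congr rfl fun lam _ => this lam,
        Finset.sum_comm' (t' := Finset.univ) (s' := fun κ => κ.up)]
      · simp only [Finset.mul_sum]
      · intro lam ν
        simp [mem_up, mem_down]
    rw [h1, Nat.factorial_succ]
    refine le_trans ?_ (Nat.mul_le_mul_left (n + 1) ih)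
    rw [Finset.mul_sum]
    refine Finset.sum_le_sum fun κ _ =>
      (Nat.mul_le_mul_left _ (sum_up_card_std_le κ)).trans_eq ?_
    ring

end Shape

end Counting

/-! ### The Murphy basis is cellular. -/

section MurphyBasis

variable {R : Type*} [CommRing R] (q : Rˣ) (n : ℕ)

/-- There are at most `n!` Murphy elements, so the free module on them embeds in the Hecke algebra
by means of the basis `T_v`. It also maps onto the Hecke algebra, and by Orzech's theorem such a
surjection onto a finite module over a commutative ring is injective. -/
theorem linearIndependent_murphy :
    LinearIndependent R (fun x : (lam : Shape n) × (lam.Std × lam.Std) =>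
      Hecke.murphy q n x.1 x.2.1 x.2.2) := by
  classical
  have hcard : Nat.card ((lam : Shape n) × (lam.Std × lam.Std)) ≤
      Nat.card (Equiv.Perm (Fin n)) := by
    rw [Nat.card_sigma, Nat.card_perm, Nat.card_fin]
    simpa [Nat.card_prod, sq] using Shape.sum_card_std_sq_le n
  have : Finite ((lam : Shape n) × (lam.Std × lam.Std)) := inferInstance
  have := Fintype.ofFinite ((lam : Shape n) × (lam.Std × lam.Std))
  rw [Nat.card_eq_fintype_card, Nat.card_eq_fintype_card] at hcard
  obtain ⟨f⟩ := Function.Embedding.nonempty_of_card_le hcard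
  have : Module.Finite R (Hecke q n) := Module.Finite.of_basis (TBasis q)
  refine OrzechProperty.injective_of_surjective_of_injective
    ((TBasis q).repr.symm.toLinearMap ∘ₗ Finsupp.lmapDomain R R f) _
    ((TBasis q).repr.symm.injective.comp (Finsupp.mapDomain_injective f.injective)) ?_
  rw [← LinearMap.range_eq_top, Finsupp.range_linearCombination]
  exact span_murphy q

theorem isMurphyCellular : IsMurphyCellular q n where
  finite_index := inferInstance
  finite_tab _ := inferInstance
  star_star := Hecke.st_st q
  linearIndependent := linearIndependent_murphy q n
  span_eq_top := span_murphy q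
  mul_mem := murphy_mul_mem q
  star_mem lam s t := by
    have := st_murphy q lam s t
    rw [Hecke.st_apply] at this
    rw [this, sub_self]
    exact zero_mem _

end MurphyBasis

end HeckeCell

end


noncomputable section

namespace HeckeCell

/-! ## Restriction of cell modules -/

namespace Shape

variable {n : ℕ}

theorem isStandard_rowTableau (lam : Shape n) : lam.IsStandard lam.rowTableau := by
  refine ⟨fun x y h h' => ?_, fun x y h h' => ?_⟩ <;>
    rw [Fin.lt_def, coe_rowTableau, coe_rowTableau]
  · rw [h]
    omega
  · have h1 := lam.rowEntry_lt x.2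
    have h2 := lam.rowSum_mono (show x.1.1 + 1 ≤ y.1.1 from h')
    omega

/-- The tableau `t^lam`, as a standard tableau. -/
def rowStd (lam : Shape n) : lam.Std := ⟨lam.rowTableau, lam.isStandard_rowTableau⟩

theorem perm_rowTableau (lam : Shape n) : lam.perm lam.rowTableau = Equiv.refl _ :=
  Equiv.symm_trans_self _

theorem rowWord_last {lam : Shape (n + 1)} (t : lam.Std) :
    lam.rowWord t.1 (Fin.last n) = t.lastNode.1 := rfl

theorem rowWord_adjoin {lam : Shape (n + 1)} {α : ℕ × ℕ} (hα : lam.IsRemovable α)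
    (s : (lam.remove α hα).Std) :
    lam.rowWord (adjoin hα s).1 = snoc ((lam.remove α hα).rowWord s.1) α.1 := by
  funext k
  induction k using Fin.lastCases with
  | last => rw [snoc_last, rowWord_last, lastNode_adjoin]
  | cast k =>
    rw [snoc_castSucc]
    have hx := Finset.mem_erase.1 (s.1.symm k).2
    have : (adjoin hα s).1.symm k.castSucc = ⟨(s.1.symm k).1, hx.2⟩ := by
      rw [Equiv.symm_apply_eq, adjoin_apply, adjoinFun, dif_neg hx.1]
      simp
    rw [rowWord, this]
    rfl

theorem rowLen_remove {lam : Shape (n + 1)} {α : ℕ × ℕ} (hα : lam.IsRemovable α) (l : ℕ) :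
    lam.diagram.rowLen l =
      (lam.remove α hα).diagram.rowLen l + if α.1 = l then 1 else 0 := by
  rw [← cnt_rowWord _ (adjoin hα (lam.remove α hα).rowStd).1, rowWord_adjoin, cnt_snoc,
    cnt_rowWord]

theorem IsRemovable.snd_eq {lam : Shape (n + 1)} {α : ℕ × ℕ} (hα : lam.IsRemovable α) :
    α.2 = lam.diagram.rowLen α.1 - 1 := by
  have h1 : α.2 < lam.diagram.rowLen α.1 := YoungDiagram.mem_iff_lt_rowLen.1 hα.1
  by_contra hne
  have h2 : (α.1, α.2 + 1) ∈ (lam.diagram.cells.erase α : Set (ℕ × ℕ)) := by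
    simp only [Finset.coe_erase, Set.mem_sdiff, Finset.mem_coe, Set.mem_singleton_iff]
    refine ⟨YoungDiagram.mem_iff_lt_rowLen.2 (show α.2 + 1 < _ by omega), fun h => ?_⟩
    have := congrArg Prod.snd h
    simp at this
  have h3 := hα.2 (show α ≤ (α.1, α.2 + 1) from ⟨le_rfl, Nat.le_succ _⟩) h2
  simp at h3

theorem IsRemovable.eq_of_fst {lam : Shape (n + 1)} {α β : ℕ × ℕ} (hα : lam.IsRemovable α)
    (hβ : lam.IsRemovable β) (h : α.1 = β.1) : α = β :=
  Prod.ext h (by rw [hα.snd_eq, hβ.snd_eq, h])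

theorem rowSum_remove {lam : Shape (n + 1)} {α : ℕ × ℕ} (hα : lam.IsRemovable α) (j : ℕ) :
    lam.rowSum j = (lam.remove α hα).rowSum j + if α.1 < j then 1 else 0 := by
  simp only [rowSum, rowLen_remove hα, Finset.sum_add_distrib, Finset.sum_ite_eq, Finset.mem_range]

/-- Removing a lower node leaves a more dominant partition. -/
theorem remove_lt_remove {lam : Shape (n + 1)} {α β : ℕ × ℕ} (hα : lam.IsRemovable α)
    (hβ : lam.IsRemovable β) (h : β.1 < α.1) : lam.remove β hβ < lam.remove α hα := by
  refine lt_of_le_not_ge (fun j => ?_) fun hle => ?_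
  · have h1 := rowSum_remove hα j
    have h2 := rowSum_remove hβ j
    split_ifs at h1 h2 <;> omega
  · have h1 := rowSum_remove hα (β.1 + 1)
    have h2 := rowSum_remove hβ (β.1 + 1)
    have h3 : (lam.remove α hα).rowSum (β.1 + 1) ≤ (lam.remove β hβ).rowSum (β.1 + 1) := hle _
    split_ifs at h1 h2 <;> omega

/-- Each row has at most one removable node, so ordering by rows determines the list; `Fin.rev`
makes it run from the bottom row up. -/
theorem exists_removable_list (lam : Shape (n + 1)) : ∃ (p : ℕ) (α : Fin p → ℕ × ℕ),
    (∀ j, lam.IsRemovable (α j)) ∧ (∀ β, lam.IsRemovable β → ∃ j, α j = β) ∧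
    ∀ i j, i < j → (α j).1 < (α i).1 := by
  classical
  set S : Finset (ℕ × ℕ) := lam.diagram.cells.filter lam.IsRemovable
  set A : Finset ℕ := S.image Prod.fst
  have hA : ∀ a ∈ A, ∃ β, lam.IsRemovable β ∧ β.1 = a := by
    intro a ha
    obtain ⟨β, hβ, rfl⟩ := Finset.mem_image.1 ha
    exact ⟨β, (Finset.mem_filter.1 hβ).2, rfl⟩
  choose! f hf hf' using hA
  have hmem : ∀ j, A.orderEmbOfFin rfl j ∈ A := Finset.orderEmbOfFin_mem A rfl
  refine ⟨A.card, fun j => f (A.orderEmbOfFin rfl j.rev), fun j => hf _ (hmem _),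
    fun β hβ => ?_, fun i j hij => ?_⟩
  · have h1 : β.1 ∈ A := Finset.mem_image_of_mem _ (Finset.mem_filter.2 ⟨hβ.1, hβ⟩)
    have h2 : β.1 ∈ Set.range (A.orderEmbOfFin rfl) := by
      rw [Finset.range_orderEmbOfFin]
      exact h1
    obtain ⟨j, hj⟩ := h2
    refine ⟨j.rev, IsRemovable.eq_of_fst (hf _ (hmem _)) hβ ?_⟩
    rw [hf' _ (hmem _), Fin.rev_rev, hj]
  · simp only
    rw [hf' _ (hmem _), hf' _ (hmem _), OrderEmbedding.lt_iff_lt, Fin.rev_lt_rev]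
    exact hij

end Shape

/-! ### Filtration of the restricted cell module. -/

section Branching

variable {R : Type*} [CommRing R] (q : Rˣ) {n : ℕ}

/-- The cell module of the Hecke algebra for the partition `lam`. -/
abbrev Specht (lam : Shape n) : Type _ := (isMurphyCellular q n).CellModule lam

/-- The basis of the cell module. -/
abbrev spechtBasis (lam : Shape n) : Module.Basis lam.Std R (Specht q lam) :=
  (isMurphyCellular q n).cellBasis lam

/-- The lift of the cell module to the Hecke algebra that sends `m_t` to `m_lam T_{w(t)}`. -/
def lift (lam : Shape n) : Specht q lam →ₗ[R] Hecke q n :=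
  Finsupp.linearCombination R (Hecke.murphy q n lam lam.rowStd)

theorem lift_basis (lam : Shape n) (t : lam.Std) :
    lift q lam (spechtBasis q lam t) = theta q lam.rowFn (word R (lam.rowWord t.1)) := by
  have h1 : lift q lam (spechtBasis q lam t) = Hecke.murphy q n lam lam.rowStd t := by
    refine (Finsupp.linearCombination_single R (1 : R) t).trans (one_smul _ _)
  rw [h1, theta_rowWord, murphy_eq, Shape.rowStd, Shape.perm_rowTableau, Hecke.T_refl,
    Hecke.st_one, one_mul]

theorem lift_mul_sub (lam : Shape n) (y : Specht q lam) (a : Hecke q n) :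
    lift q lam y * a - lift q lam (MulOpposite.op a • y) ∈
      strictSpan R (Hecke.murphy q n) lam :=
  (isMurphyCellular q n).act_spec lam lam.rowStd y a

/-- The elements of the Hecke algebra that are lifted from a submodule of the cell module, modulo
partitions that dominate `lam`. -/
def liftSpan (lam : Shape n) (Q : Submodule R (Specht q lam)) : Submodule R (Hecke q n) :=
  Q.map (lift q lam) ⊔ strictSpan R (Hecke.murphy q n) lam

theorem strictSpan_le_liftSpan (lam : Shape n) (Q : Submodule R (Specht q lam)) :
    strictSpan R (Hecke.murphy q n) lam ≤ liftSpan q lam Q := le_sup_right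

theorem lift_mem_liftSpan {lam : Shape n} {Q : Submodule R (Specht q lam)} {y : Specht q lam}
    (hy : y ∈ Q) : lift q lam y ∈ liftSpan q lam Q :=
  Submodule.mem_sup_left (Submodule.mem_map_of_mem hy)

theorem liftSpan_mono (lam : Shape n) {P Q : Submodule R (Specht q lam)} (h : P ≤ Q) :
    liftSpan q lam P ≤ liftSpan q lam Q := sup_le_sup_right (Submodule.map_mono h) _

theorem eq_of_lift_sub_mem {lam : Shape n} {x y : Specht q lam}
    (h : lift q lam x - lift q lam y ∈ strictSpan R (Hecke.murphy q n) lam) : x = y := by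
  rw [← map_sub] at h
  exact sub_eq_zero.1 ((isMurphyCellular q n).eq_zero_of_mem lam lam.rowStd _ h)

theorem mem_of_lift_mem_liftSpan {lam : Shape n} {Q : Submodule R (Specht q lam)}
    {y : Specht q lam} (h : lift q lam y ∈ liftSpan q lam Q) : y ∈ Q := by
  obtain ⟨_, ⟨x, hx, rfl⟩, z, hz, hxz⟩ := Submodule.mem_sup.1 h
  have : y = x := eq_of_lift_sub_mem q (by rw [← hxz, add_sub_cancel_left]; exact hz)
  rw [this]
  exact hx

/-- The span of the `m_t` whose largest entry is in row `r` or below. -/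
def lowSpan (lam : Shape (n + 1)) (r : ℕ) : Submodule R (Specht q lam) :=
  Submodule.span R (spechtBasis q lam '' {t | r ≤ t.lastNode.1})

theorem lowSpan_anti (lam : Shape (n + 1)) {r s : ℕ} (h : r ≤ s) :
    lowSpan q lam s ≤ lowSpan q lam r :=
  Submodule.span_mono (Set.image_mono fun _ ht => h.trans ht)

/-- For `r ≠ i` the letter `r` passes through the divided power, whose image is in a higher cell.
For `r = i` the exchange relation leaves a term ending in `r + 1`, covered by the hypothesis `ih`.
-/
theorem theta_app_divPow_mem (lam : Shape (n + 1)) {r : ℕ}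
    (ih : ∀ x : Words R n,
      theta q lam.rowFn (app (r + 1) x) ∈ liftSpan q lam (lowSpan q lam (r + 1)))
    (i : ℕ) {k : ℕ} (hk : 1 ≤ k) (w : Fin n → ℕ) :
    theta q lam.rowFn (app r (divPow q i n k (word R w))) ∈
      liftSpan q lam (lowSpan q lam (r + 1)) := by
  by_cases h : r = i
  · subst h
    obtain ⟨k, rfl⟩ : ∃ m, k = m + 1 := ⟨k - 1, by omega⟩
    have h1 := congrArg (theta q lam.rowFn) (divPow_succ_app_self_word (R := R) q r k w)
    rw [map_add, map_smul, map_smul] at h1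
    exact mem_of_add_smul_mem _ (isUnit_pow_coe q _) h1 (Submodule.smul_mem _ _ (ih _))
      (strictSpan_le_liftSpan q _ _ (theta_divPow_mem_strict q lam hk _))
  · rw [← divPow_app_of_ne q h, app_word]
    exact strictSpan_le_liftSpan q _ _ (theta_divPow_mem_strict q lam hk _)

theorem rowLen_eq_zero (lam : Shape n) {r : ℕ} (h : n ≤ r) : lam.diagram.rowLen r = 0 := by
  by_contra hne
  have : (r, 0) ∈ lam.diagram.cells :=
    YoungDiagram.mem_iff_lt_rowLen.2 (show 0 < _ from Nat.pos_of_ne_zero hne)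
  have := (Shape.mem_range this).1
  simp only at this
  omega

/-- Downward induction on the row `r`, with `d` bounding the rows still below. From row `n + 1` on,
λ has no nodes and the image is zero. In the step the prefix is straightened; since λ is a
partition, a ballot prefix followed by `r` is again ballot when the total content is λ. -/
theorem theta_app_mem_aux (lam : Shape (n + 1)) (d : ℕ) : ∀ r l : ℕ, n + 1 ≤ r + d → r ≤ l →
    ∀ x : Words R n, theta q lam.rowFn (app l x) ∈ liftSpan q lam (lowSpan q lam r) := by
  induction d with
  | zero =>
    intro r l hr hl x
    refine Words.mem_of_word_mem
      ((liftSpan q lam (lowSpan q lam r)).comap (theta q lam.rowFn ∘ₗ app l)) (fun u => ?_) x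
    rw [Submodule.mem_comap, LinearMap.comp_apply, app_word, theta_word_eq_zero q (l := l)]
    · exact zero_mem _
    · rw [rowLen_eq_zero lam (by omega), cnt_snoc]
      simp
  | succ d ih =>
    intro r l hr hl x
    rcases hl.lt_or_eq with hl | rfl
    · exact liftSpan_mono q lam (lowSpan_anti q lam (Nat.le_succ r))
        (ih (r + 1) l (by omega) hl x)
    · refine Words.mem_of_ballot q
        ((liftSpan q lam (lowSpan q lam r)).comap (theta q lam.rowFn ∘ₗ app r))
        (fun u hu => ?_) (fun i k w hk => ?_) x
      · rw [Submodule.mem_comap, LinearMap.comp_apply, app_word]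
        by_cases hc : ∀ j, cnt (snoc u r) j = lam.diagram.rowLen j
        · have hb : Ballot (snoc u r) := ballot_snoc.2 ⟨hu, fun i => by
            rw [hc, hc]
            exact lam.diagram.rowLen_anti i (i + 1) (Nat.le_succ i)⟩
          obtain ⟨t, ht⟩ := exists_std_of_ballot lam hb hc
          rw [← ht, ← lift_basis]
          refine lift_mem_liftSpan q (Submodule.subset_span ⟨t, ?_, rfl⟩)
          change r ≤ t.lastNode.1
          rw [← Shape.rowWord_last, ht, snoc_last]
        · push Not at hc
          obtain ⟨j, hj⟩ := hc
          rw [theta_word_eq_zero q hj]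
          exact zero_mem _
      · exact liftSpan_mono q lam (lowSpan_anti q lam (Nat.le_succ r))
          (theta_app_divPow_mem q lam (ih (r + 1) (r + 1) (by omega) le_rfl) i hk w)

theorem theta_app_mem (lam : Shape (n + 1)) {r l : ℕ} (h : r ≤ l) (x : Words R n) :
    theta q lam.rowFn (app l x) ∈ liftSpan q lam (lowSpan q lam r) :=
  theta_app_mem_aux q lam (n + 1) r l (by omega) h x

/-- The smaller algebra preserves the last letter of a row word, so only straightening can move the
largest entry, and it moves it downwards. -/
theorem op_incl_smul_mem_lowSpan (lam : Shape (n + 1)) (r : ℕ) (b : Hecke q n)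
    {y : Specht q lam} (hy : y ∈ lowSpan q lam r) :
    MulOpposite.op (Hecke.incl q n b) • y ∈ lowSpan q lam r := by
  refine mem_of_lift_mem_liftSpan q ?_
  have h1 := strictSpan_le_liftSpan q lam (lowSpan q lam r)
    (lift_mul_sub q lam y (Hecke.incl q n b))
  refine (Submodule.sub_mem_iff_right _ ?_).1 h1
  have h2 : lowSpan q lam r ≤ (liftSpan q lam (lowSpan q lam r)).comap
      (LinearMap.mulRight R (Hecke.incl q n b) ∘ₗ lift q lam) := by
    refine Submodule.span_le.2 ?_
    rintro _ ⟨t, ht, rfl⟩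
    rw [SetLike.mem_coe, Submodule.mem_comap, LinearMap.comp_apply, LinearMap.mulRight_apply,
      lift_basis, ← theta_rmul q lam.rowFn_monotone, ← snoc_init (lam.rowWord t.1), ← app_word,
      rmul_incl_app]
    exact theta_app_mem q lam ht _
  exact h2 hy

theorem op_smul_smul (lam : Shape n) (a : Hecke q n) (r : R) (y : Specht q lam) :
    MulOpposite.op a • r • y = r • MulOpposite.op a • y :=
  ((isMurphyCellular q n).act lam a).map_smul r y

/-- The map `m_s ↦ m_{s ∪ α}`. -/
def adjoinMap {lam : Shape (n + 1)} {α : ℕ × ℕ} (hα : lam.IsRemovable α) :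
    Specht q (lam.remove α hα) →ₗ[R] Specht q lam :=
  (spechtBasis q (lam.remove α hα)).constr R fun s => spechtBasis q lam (Shape.adjoin hα s)

theorem adjoinMap_basis {lam : Shape (n + 1)} {α : ℕ × ℕ} (hα : lam.IsRemovable α)
    (s : (lam.remove α hα).Std) : adjoinMap q hα (spechtBasis q _ s) =
      spechtBasis q lam (Shape.adjoin hα s) := Module.Basis.constr_basis _ _ _ _

/-- The core of the branching isomorphism: a single straightening of `x` serves λ∖α and, with the
row of α appended, also λ. Working in the product of the two Hecke algebras makes the same `y`
appear on both sides. Ballot words match because `theta` vanishes for both shapes or for neither;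
divided powers become negligible in both components. -/
theorem exists_lift_eq {lam : Shape (n + 1)} {α : ℕ × ℕ} (hα : lam.IsRemovable α)
    (x : Words R n) : ∃ y : Specht q (lam.remove α hα),
      theta q (lam.remove α hα).rowFn x - lift q _ y ∈
        strictSpan R (Hecke.murphy q n) (lam.remove α hα) ∧
      theta q lam.rowFn (app α.1 x) - lift q lam (adjoinMap q hα y) ∈
        liftSpan q lam (lowSpan q lam (α.1 + 1)) := by
  set μ := lam.remove α hα
  let f : Specht q μ →ₗ[R] Hecke q n × Hecke q (n + 1) :=
    (lift q μ).prod (lift q lam ∘ₗ adjoinMap q hα)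
  let g : Words R n →ₗ[R] Hecke q n × Hecke q (n + 1) :=
    (theta q μ.rowFn).prod (theta q lam.rowFn ∘ₗ app α.1)
  let P : Submodule R (Hecke q n × Hecke q (n + 1)) :=
    (strictSpan R (Hecke.murphy q n) μ).prod (liftSpan q lam (lowSpan q lam (α.1 + 1)))
  have key : g x ∈ LinearMap.range f ⊔ P := by
    rw [← Submodule.mem_comap]
    refine Words.mem_of_ballot q _ (fun u hu => ?_) (fun i k w hk => ?_) x
    · rw [Submodule.mem_comap]
      by_cases hc : ∀ j, cnt u j = μ.diagram.rowLen j
      · obtain ⟨s, rfl⟩ := exists_std_of_ballot μ hu hc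
        refine Submodule.mem_sup_left ⟨spechtBasis q μ s, ?_⟩
        refine Prod.ext (lift_basis q μ s) ?_
        change lift q lam (adjoinMap q hα (spechtBasis q μ s)) =
          theta q lam.rowFn (app α.1 (word R (μ.rowWord s.1)))
        rw [adjoinMap_basis, lift_basis, Shape.rowWord_adjoin, app_word]
      · push Not at hc
        obtain ⟨j, hj⟩ := hc
        have h1 : g (word R u) = 0 := by
          refine Prod.ext (theta_word_eq_zero q hj) ?_
          change theta q lam.rowFn (app α.1 (word R u)) = 0
          rw [app_word, theta_word_eq_zero q (l := j)]
          rw [cnt_snoc, Shape.rowLen_remove hα]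
          exact fun h => hj (Nat.add_right_cancel h)
        rw [h1]
        exact zero_mem _
    · refine Submodule.mem_sup_right ⟨theta_divPow_mem_strict q μ hk w, ?_⟩
      exact theta_app_divPow_mem q lam (theta_app_mem q lam le_rfl) i hk w
  obtain ⟨_, ⟨y, rfl⟩, z, hz, hyz⟩ := Submodule.mem_sup.1 key
  have h1 : g x - f y = z := by rw [← hyz, add_sub_cancel_left]
  rw [← h1] at hz
  exact ⟨y, hz.1, hz.2⟩

/-- On a basis element this is `exists_lift_eq` for `x` the row word of `s` times `b`: there `y`
must be `m_s b`, and appending the row of α commutes with the action of `b`. -/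
theorem adjoinMap_smul_sub_mem {lam : Shape (n + 1)} {α : ℕ × ℕ} (hα : lam.IsRemovable α)
    (b : Hecke q n) (y : Specht q (lam.remove α hα)) :
    adjoinMap q hα (MulOpposite.op b • y) -
      MulOpposite.op (Hecke.incl q n b) • adjoinMap q hα y ∈ lowSpan q lam (α.1 + 1) := by
  have hbasis : ∀ s, adjoinMap q hα (MulOpposite.op b • spechtBasis q _ s) -
      MulOpposite.op (Hecke.incl q n b) • adjoinMap q hα (spechtBasis q _ s) ∈
        lowSpan q lam (α.1 + 1) := by
    intro s
    obtain ⟨y, h1, h2⟩ := exists_lift_eq q hα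
      (rmul q b (word R ((lam.remove α hα).rowWord s.1)))
    rw [theta_rmul q (Shape.rowFn_monotone _), ← lift_basis] at h1
    have h3 : MulOpposite.op b • spechtBasis q _ s = y := by
      refine eq_of_lift_sub_mem q ?_
      have := sub_mem h1 (lift_mul_sub q _ (spechtBasis q _ s) b)
      rwa [sub_sub_sub_cancel_left] at this
    rw [← rmul_incl_app, theta_rmul q (Shape.rowFn_monotone _), app_word,
      ← Shape.rowWord_adjoin, ← lift_basis] at h2
    rw [h3, adjoinMap_basis]
    refine mem_of_lift_mem_liftSpan q ?_
    have := sub_mem (strictSpan_le_liftSpan q lam (lowSpan q lam (α.1 + 1))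
      (lift_mul_sub q lam (spechtBasis q lam (Shape.adjoin hα s)) (Hecke.incl q n b))) h2
    rwa [sub_sub_sub_cancel_left, ← map_sub] at this
  have hy : y ∈ Submodule.span R (Set.range (spechtBasis q (lam.remove α hα))) :=
    (spechtBasis q (lam.remove α hα)).mem_span y
  induction hy using Submodule.span_induction with
  | mem _ h =>
    obtain ⟨s, rfl⟩ := h
    exact hbasis s
  | zero => simp
  | add x y _ _ hx hy =>
    rw [smul_add, map_add, map_add, smul_add, add_sub_add_comm]
    exact add_mem hx hy
  | smul r y _ hy =>
    rw [op_smul_smul, map_smul (adjoinMap q hα), map_smul (adjoinMap q hα), op_smul_smul,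
      ← smul_sub]
    exact Submodule.smul_mem _ _ hy

theorem adjoinMap_mem_lowSpan {lam : Shape (n + 1)} {α : ℕ × ℕ} (hα : lam.IsRemovable α)
    (y : Specht q (lam.remove α hα)) : adjoinMap q hα y ∈
      Submodule.span R (spechtBasis q lam '' {t | t.lastNode.1 = α.1}) := by
  have h : LinearMap.range (adjoinMap q hα) ≤
      Submodule.span R (spechtBasis q lam '' {t | t.lastNode.1 = α.1}) := by
    rw [adjoinMap, Module.Basis.constr_range]
    refine Submodule.span_mono ?_
    rintro _ ⟨s, rfl⟩
    exact ⟨_, congrArg Prod.fst (Shape.lastNode_adjoin hα s), rfl⟩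
  exact h ⟨y, rfl⟩

theorem eq_zero_of_adjoinMap_mem {lam : Shape (n + 1)} {α : ℕ × ℕ} (hα : lam.IsRemovable α)
    {y : Specht q (lam.remove α hα)} (h : adjoinMap q hα y ∈ lowSpan q lam (α.1 + 1)) :
    y = 0 := by
  have hdisj : Disjoint {t : lam.Std | t.lastNode.1 = α.1} {t | α.1 + 1 ≤ t.lastNode.1} := by
    rw [Set.disjoint_left]
    rintro t (h1 : t.lastNode.1 = α.1) (h2 : α.1 + 1 ≤ t.lastNode.1)
    omega
  have h0 := Submodule.disjoint_def.1
    ((spechtBasis q lam).linearIndependent.disjoint_span_image hdisj) _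
    (adjoinMap_mem_lowSpan q hα y) h
  have hinj : Function.Injective (adjoinMap q hα) := by
    exact Module.Basis.injective_constr_of_linearIndependent _
      ((spechtBasis q lam).linearIndependent.comp _ (Shape.adjoin_injective hα))
  exact hinj (h0.trans (map_zero _).symm)

theorem exists_adjoinMap_sub_mem {lam : Shape (n + 1)} {α : ℕ × ℕ} (hα : lam.IsRemovable α)
    {x : Specht q lam} (hx : x ∈ lowSpan q lam α.1) :
    ∃ y, adjoinMap q hα y - x ∈ lowSpan q lam (α.1 + 1) := by
  have h : lowSpan q lam α.1 ≤ LinearMap.range (adjoinMap q hα) ⊔ lowSpan q lam (α.1 + 1) := by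
    refine Submodule.span_le.2 ?_
    rintro _ ⟨t, ht, rfl⟩
    rcases (show α.1 ≤ t.lastNode.1 from ht).lt_or_eq with h | h
    · exact Submodule.mem_sup_right (Submodule.subset_span ⟨t, h, rfl⟩)
    · obtain ⟨s, rfl⟩ := Shape.exists_adjoin hα t
        (Shape.IsRemovable.eq_of_fst t.isRemovable_lastNode hα h.symm)
      exact Submodule.mem_sup_left ⟨spechtBasis q _ s, adjoinMap_basis q hα s⟩
  obtain ⟨_, ⟨y, rfl⟩, z, hz, hyz⟩ := Submodule.mem_sup.1 (h hx)
  refine ⟨y, ?_⟩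
  rw [← hyz, sub_add_cancel_left]
  exact neg_mem hz

/-- The restriction of the cell module of `lam`. -/
abbrev ResSpecht (lam : Shape (n + 1)) : Type _ := Res (Hecke.incl q n) (Specht q lam)

/-- The span of the `m_t` whose largest entry is in row `r` or below, as a submodule of the
restriction. -/
def lowSubmodule (lam : Shape (n + 1)) (r : ℕ) :
    Submodule (Hecke q n)ᵐᵒᵖ (ResSpecht q lam) where
  carrier := {x | (toRes (Hecke.incl q n) _).symm x ∈ lowSpan q lam r}
  add_mem' := (lowSpan q lam r).add_mem
  zero_mem' := (lowSpan q lam r).zero_mem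
  smul_mem' b _ hx := op_incl_smul_mem_lowSpan q lam r b.unop hx

theorem coe_lowSubmodule (lam : Shape (n + 1)) (r : ℕ) :
    (lowSubmodule q lam r : Set (ResSpecht q lam)) =
      Submodule.span R {x | ∃ t : lam.Std, r ≤ t.lastNode.1 ∧
        x = toRes (Hecke.incl q n) _ (spechtBasis q lam t)} := by
  change ((lowSpan q lam r : Submodule R (Specht q lam)) : Set (Specht q lam)) = _
  rw [lowSpan]
  congr 2
  ext x
  constructor
  · rintro ⟨t, ht, rfl⟩
    exact ⟨t, ht, rfl⟩
  · rintro ⟨t, ht, rfl⟩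
    exact ⟨t, ht, rfl⟩

/-- The subquotients of the restricted cell module are cell modules. -/
theorem exists_equiv_quotient {lam : Shape (n + 1)} {α : ℕ × ℕ} (hα : lam.IsRemovable α)
    {N N' : Submodule (Hecke q n)ᵐᵒᵖ (ResSpecht q lam)} (hN : N = lowSubmodule q lam α.1)
    (hN' : N' = lowSubmodule q lam (α.1 + 1)) :
    ∃ e : Specht q (lam.remove α hα) ≃ₗ[(Hecke q n)ᵐᵒᵖ] (N ⧸ N'.submoduleOf N),
      ∀ s : (lam.remove α hα).Std,
        ∃ hs : toRes (Hecke.incl q n) _ (spechtBasis q lam (Shape.adjoin hα s)) ∈ N,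
          e (spechtBasis q _ s) = Submodule.Quotient.mk ⟨_, hs⟩ := by
  subst hN hN'
  have hmem : ∀ y, toRes (Hecke.incl q n) _ (adjoinMap q hα y) ∈ lowSubmodule q lam α.1 :=
    fun y => (Submodule.span_mono (Set.image_mono fun t (ht : _ = _) => ht.ge) :
      _ ≤ lowSpan q lam α.1) (adjoinMap_mem_lowSpan q hα y)
  let f : Specht q (lam.remove α hα) →ₗ[(Hecke q n)ᵐᵒᵖ]
      (lowSubmodule q lam α.1 ⧸
        (lowSubmodule q lam (α.1 + 1)).submoduleOf (lowSubmodule q lam α.1)) :=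
    { toFun := fun y => Submodule.Quotient.mk ⟨_, hmem y⟩
      map_add' := fun x y => by
        rw [← Submodule.Quotient.mk_add]
        congr 1
        exact Subtype.ext (map_add (adjoinMap q hα) x y)
      map_smul' := fun b y => by
        rw [RingHom.id_apply, ← Submodule.Quotient.mk_smul, Submodule.Quotient.eq]
        exact adjoinMap_smul_sub_mem q hα b.unop y }
  have hf : Function.Bijective f := by
    refine ⟨(injective_iff_map_eq_zero f).2 fun y hy => ?_, fun x => ?_⟩
    · have hy' : Submodule.Quotient.mk ⟨_, hmem y⟩ = (0 : lowSubmodule q lam α.1 ⧸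
          (lowSubmodule q lam (α.1 + 1)).submoduleOf (lowSubmodule q lam α.1)) := hy
      rw [Submodule.Quotient.mk_eq_zero] at hy'
      exact eq_zero_of_adjoinMap_mem q hα hy'
    · obtain ⟨⟨x, hx⟩, rfl⟩ := Submodule.Quotient.mk_surjective _ x
      obtain ⟨y, hy⟩ := exists_adjoinMap_sub_mem q hα hx
      exact ⟨y, (Submodule.Quotient.eq _).2 hy⟩
  refine ⟨LinearEquiv.ofBijective f hf, fun s => ?_⟩
  have h := hmem (spechtBasis q _ s)
  rw [adjoinMap_basis] at h
  refine ⟨h, ?_⟩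
  refine (Submodule.Quotient.eq (p := (lowSubmodule q lam (α.1 + 1)).submoduleOf
    (lowSubmodule q lam α.1)) (x := ⟨_, hmem (spechtBasis q _ s)⟩)).2 ?_
  have h0 : (⟨_, hmem (spechtBasis q _ s)⟩ : lowSubmodule q lam α.1) = ⟨_, h⟩ :=
    Subtype.ext (congrArg (toRes (Hecke.incl q n) _) (adjoinMap_basis q hα s))
  rw [h0, sub_self]
  exact zero_mem _

end Branching

end HeckeCell

end

/-! ### The branching theorem. -/

open HeckeCell
theorem mainTheorem9 {R : Type*} [CommRing R] [IsDomain R] (q : Rˣ) :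
    ∃ h : ∀ k : ℕ, IsMurphyCellular q k,
      ∀ (n : ℕ) (lam : Shape (n + 1)),
        ∃ (p : ℕ) (α : Fin p → ℕ × ℕ) (hα : ∀ j, lam.IsRemovable (α j))
          (N : Fin (p + 1) →
            Submodule (Hecke q n)ᵐᵒᵖ (Res (Hecke.incl q n) ((h (n + 1)).CellModule lam))),
          -- `α` lists all the removable nodes of `lam`, from bottom to top
          (∀ β, lam.IsRemovable β → ∃ j, α j = β) ∧
          (∀ i j, i < j → (α j).1 < (α i).1) ∧
          -- `N j` is spanned by the `m_t` whose largest entry is in one of the first `j` nodes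
          (∀ j, (N j : Set (Res (Hecke.incl q n) ((h (n + 1)).CellModule lam))) =
            Submodule.span R {x | ∃ t : lam.Std, (∃ i : Fin p, i.castSucc < j ∧ t.lastNode = α i) ∧
              x = toRes (Hecke.incl q n) _ ((h (n + 1)).cellBasis lam t)}) ∧
          (h n).IsOrderPreservingCellFiltration N (fun j => lam.remove (α j) (hα j)) ∧
          -- the isomorphisms are given by `m_s ↦ m_{s ∪ α_j} + N_{j-1}`
          ∀ j : Fin p, ∃ e : (h n).CellModule (lam.remove (α j) (hα j)) ≃ₗ[(Hecke q n)ᵐᵒᵖ]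
              (N j.succ ⧸ (N j.castSucc).submoduleOf (N j.succ)),
            ∀ s : (lam.remove (α j) (hα j)).Std,
              ∃ hs : toRes (Hecke.incl q n) _
                  ((h (n + 1)).cellBasis lam (Shape.adjoin (hα j) s)) ∈ N j.succ,
                e ((h n).cellBasis _ s) = Submodule.Quotient.mk ⟨_, hs⟩ := by
  refine ⟨isMurphyCellular q, fun n lam => ?_⟩
  obtain ⟨p, α, hα, hall, hlt⟩ := lam.exists_removable_list
  have hle : ∀ i j, (α j).1 ≤ (α i).1 ↔ i ≤ j := fun i j => by
    refine ⟨fun h => not_lt.1 fun h' => absurd (hlt _ _ h') (not_lt.2 h), fun h => ?_⟩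
    rcases h.lt_or_eq with h | rfl
    · exact (hlt _ _ h).le
    · exact le_rfl
  -- `N j` is cut out by a row threshold: the largest entry lies in row `thr j` or below. The value
  -- `n + 1` at `j = 0` exceeds all row indices and gives the zero submodule.
  let thr : Fin (p + 1) → ℕ := Fin.cons (n + 1) fun j => (α j).1
  have hthr : ∀ (j : Fin (p + 1)) (t : lam.Std),
      (∃ i : Fin p, i.castSucc < j ∧ t.lastNode = α i) ↔ thr j ≤ t.lastNode.1 := by
    intro j t
    obtain ⟨k, hk⟩ := hall _ t.isRemovable_lastNode
    have hinj : ∀ i, t.lastNode = α i ↔ i = k := fun i => by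
      rw [← hk]
      refine ⟨fun h => le_antisymm ((hle _ _).1 (by rw [h])) ((hle _ _).1 (by rw [h])), fun h => by rw [h]⟩
    simp only [hinj, exists_eq_right]
    rw [← hk]
    induction j using Fin.cases with
    | zero =>
      have := (Shape.mem_range (hα k).1).1
      simp only [Fin.not_lt_zero, false_iff, not_le]
      exact this
    | succ j =>
      change _ ↔ (α j).1 ≤ (α k).1
      rw [hle, Fin.castSucc_lt_succ_iff]
  -- No removable node lies strictly between the rows of two consecutive `α`, so the preceding
  -- threshold may be replaced by the row just below that of `α j`, which is what
  -- `exists_equiv_quotient` expects.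
  have hcast : ∀ j : Fin p, lowSubmodule q lam (thr j.castSucc) =
      lowSubmodule q lam ((α j).1 + 1) := by
    intro j
    refine SetLike.coe_injective ?_
    rw [coe_lowSubmodule, coe_lowSubmodule]
    congr 3
    ext x
    refine exists_congr fun t => and_congr_left fun _ => ?_
    rw [← hthr]
    obtain ⟨k, hk⟩ := hall _ t.isRemovable_lastNode
    rw [← hk]
    constructor
    · rintro ⟨i, hi, h⟩
      rw [h]
      exact hlt _ _ (Fin.castSucc_lt_castSucc_iff.1 hi)
    · intro h
      refine ⟨k, Fin.castSucc_lt_castSucc_iff.2 (not_le.1 fun h' => ?_), rfl⟩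
      exact absurd ((hle _ _).2 h') (not_le.2 h)
  have hiso := fun j : Fin p => exists_equiv_quotient q (hα j)
    (N := lowSubmodule q lam (thr j.succ)) rfl (hcast j)
  refine ⟨p, α, hα, fun j => lowSubmodule q lam (thr j), hall, hlt, fun j => ?_,
    ⟨?_, ?_, fun j => ?_, fun j => ⟨(hiso j).choose⟩, fun i j hij => ?_⟩, hiso⟩
  · rw [coe_lowSubmodule]
    simp only [hthr]
  · refine SetLike.coe_injective ?_
    rw [coe_lowSubmodule]
    simp only [← hthr]
    simp
  · rw [eq_top_iff]
    intro x _
    change _ ∈ lowSpan q lam _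
    have : {t : lam.Std | thr (Fin.last p) ≤ t.lastNode.1} = Set.univ := by
      refine Set.eq_univ_of_forall fun t => (hthr _ t).1 ?_
      obtain ⟨k, hk⟩ := hall _ t.isRemovable_lastNode
      exact ⟨k, Fin.castSucc_lt_last k, hk.symm⟩
    rw [lowSpan, this, Set.image_univ, Module.Basis.span_eq]
    trivial
  · rw [hcast]
    exact lowSpan_anti q lam (Nat.le_succ (α j).1)
  · exact Shape.remove_lt_remove (hα i) (hα j) (hlt i j hij)
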